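/- **Model.** Let $J\ge 1$, $p_0\in\mathbb R$, $\sigma_v,\sigma_1,\sigma_{1_+},\sigma_2>0$, $\sigma_\varepsilon,\sigma_z\ge 0$, and let $v\sim N(p_0,\sigma_v^2)$, $z\sim N(0,\sigma_z^2)$, $u_1\sim N(0,\sigma_1^2)$, $u_{1_+}\sim N(0,\sigma_{1_+}^2)$, $u_2\sim N(0,\sigma_2^2)$, $\varepsilon_1,\dots,\varepsilon_J\sim N(0,\sigma_\varepsilon^2)$ be mutually independent. An informed trader (IT) submits orders $i_1$ and $i_2=i_2(v,i_1,y_1)$; the $j$-th high-frequency trader (HFT) observes $s_j=i_1+\varepsilon_j$ and submits $x_{1j}=x_{1j}(s_j,y_1)$ and $x_{2j}$, a function of $s_j,y_1,y_{1_+}$ and her own $x_{1j}$. The order flows are $y_1=i_1+u_1$, $y_{1_+}=\sum_j x_{1j}+u_{1_+}$, $y_2=i_2+\sum_j x_{2j}+u_2$. Profits are $\pi^{IT}_1=i_1(v-p_1)$, $\pi^{IT}_2=i_2(v-p_2)$, $\pi_{1j}=x_{1j}(v-p_{1_+})$, $\pi_{2j}=x_{2j}(v-p_2)$. An equilibrium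 with inventory aversions $\gamma_j\in[0,\infty]$ requires: 1. $p_1=E(v|y_1)$, $p_{1_+}=E(v|y_1,y_{1_+})$, $p_2=E(v|y_1,y_{1_+},y_2)$. 2. (a) After every first order $i_1$, $i_2$ is the maximizer of $E(\pi^{IT}_2|v,i_1,y_1)$. (b) In a mixed-strategy equilibrium ($\sigma_z>0$), $E(\pi_1^{IT}+\pi_2^{IT}|v)$ is the same for all pure strategies $i_1=i_1(v)$; in a pure-strategy equilibrium ($\sigma_z=0$), $i_1$ is the maximizer of $E(\pi_1^{IT}+\pi_2^{IT}|v)$ over all strategies $i_1=i_1(v)$. 3. For each $j$: (a) after every own first order $x_{1j}=x_{1j}(s_j,y_1)$, $x_{2j}$ is the maximizer of $E(\pi_{2j}-\gamma_j(x_{1j}+x_{2j})^2|s_j,y_1,y_{1_+})$; (b) $x_{1j}$ is the maximizer of $E(\pi_{1j}+\pi_{2j}-\gamma_j(x_{1j}+x_{2j})^2|s_j,y_1)$, where $x_{2j}$ responds to $x_{1j}$ as prescribed. Here strategies are measurable, a deviation is considered whenever its expected profit and expected squared inventory exist, "the maximizer" means the unique maximizer up to null sets, and $\infty\cdot 0=0$.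 All HFTs are Round-Trippers: $\gamma_j=\infty$ for every $j$. A *linear* equilibrium is one of the form $$p_1=p_0+\lambda_1y_1,\quad p_{1_+}=p_1+\lambda_{1_+}y_{1_+},\quad p_2=p_1+\lambda_{21}y_{1_+}+\lambda_{22}y_2,$$ $$i_1=\alpha_1(v-p_0)+z,\quad i_2=\alpha_{21}(v-E(v|y_1))+\alpha_{22}(i_1-E(i_1|y_1)),\quad x_{1j}=\beta_{12}(s_j-E(s_j|y_1)),\quad x_{2j}=-x_{1j},$$ where the conditional expectations denote the continuous functions of $y_1$ that represent them for this profile. Put $\theta_{1_+}=\sigma_{1_+}^2/\sigma_1^2$, $\theta_2=\sigma_2^2/\sigma_1^2$, $\theta_\varepsilon=\sigma_\varepsilon^2/\sigma_1^2$, $\theta_z=\sigma_z^2/\sigma_1^2$, $\Lambda_\bullet=\lambda_\bullet\sigma_1/\sigma_v$, $A_1=\alpha_1\sigma_v/\sigma_1$, $A_{21}=\alpha_{21}\sigma_v/\sigma_1$, and write $A=A_1$, $\beta=\beta_{12}$. **Theorem.** (i) Real coefficients form a mixed-strategy linear equilibrium if and only if $(A,\theta_z,\beta)$ satisfies $$\begin{aligned}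 0={}&\beta^3J^2\big(J(A^4(4\theta_{1_+}+4\theta_2-\theta_z)-2A^2\theta_z(-2\theta_{1_+}-2\theta_2+\theta_z+1)-\theta_z(\theta_z+1)^2)\\ &\quad+\theta_\varepsilon(A^2+\theta_z+1)(A^6+A^4(2\theta_z+1)+A^2(4\theta_{1_+}+4\theta_2+\theta_z^2-1)-(\theta_z+1)^2)\big)\\ &+\beta^2J(A^2+\theta_z+1)\big(4A^2J(\theta_{1_+}(2A^2+2\theta_z-1)+\theta_2(A^2+\theta_z-1))\\ &\quad+\theta_\varepsilon(A^2+\theta_z+1)(A^6+A^4(2\theta_z-1)+A^2(4\theta_{1_+}+4\theta_2+\theta_z^2-1)+(\theta_z+1)^2)\big)\\ &+\beta J\theta_{1_+}(A^2+\theta_z+1)(5A^6+A^4(10\theta_z-1)+A^2(4\theta_2+5\theta_z^2-5)+(\theta_z+1)^2)\\ &+\theta_{1_+}(A^2+\theta_z+1)^2(A^6+A^4(2\theta_z-1)+A^2(4\theta_2+\theta_z^2-1)+(\theta_z+1)^2),\\ 0={}&4A^2\beta J\theta_{1_+}(A^4+2A^2\theta_z+A^2+\theta_z^2+\theta_z)\\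 &+\beta^2J\big(J(A^4(4\theta_{1_+}+4\theta_2-\theta_z)-2A^2\theta_z(-2\theta_{1_+}-2\theta_2+\theta_z+1)-\theta_z(\theta_z+1)^2)\\ &\quad+\theta_\varepsilon(A^2+\theta_z+1)(A^6+A^4(2\theta_z+1)+A^2(4\theta_{1_+}+4\theta_2+\theta_z^2-1)-(\theta_z+1)^2)\big)\\ &+\theta_{1_+}(A^2+\theta_z+1)(A^6+A^4(2\theta_z+1)+A^2(4\theta_2+\theta_z^2-1)-(\theta_z+1)^2),\\ 0={}&A^4\theta_{1_+}(4\theta_\varepsilon+J+2)+2A^2\theta_{1_+}(4\theta_\varepsilon(\theta_z+1)+J\theta_z+J+2\theta_z+1)\\ &+\beta^2\big(A^4J(\theta_\varepsilon+J)(4\theta_\varepsilon+J+2)\\ &\quad+A^2J(8\theta_\varepsilon^2(\theta_z+1)+2\theta_\varepsilon(5J\theta_z+J+2\theta_z+1)+J(J+2)(2\theta_z-1))\\ &\quad+J(4\theta_\varepsilon^2(\theta_z+1)^2+\theta_\varepsilon(\theta_z+1)(J(5\theta_z-3)+2\theta_z)+J(J+2)(\theta_z-1)\theta_z)\big)\\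 &+\theta_{1_+}(\theta_z+1)(4\theta_\varepsilon(\theta_z+1)+J\theta_z+J+2\theta_z),\\ 0<{}&A,\qquad 0<\theta_z,\\ 0<{}&-\frac{A\big(\beta^2J(\theta_\varepsilon(A^2+\theta_z+1)+J(A^2+\theta_z-1))+\theta_{1_+}(A^2+\theta_z+1)\big)}{\beta J\big(\beta^2J(\theta_\varepsilon(A^2+\theta_z+1)+J(A^2+\theta_z))+\theta_{1_+}(A^2+\theta_z+1)\big)} \end{aligned}$$ (the last inequality including $\beta\neq0$), and the remaining coefficients are $$\Lambda_1=\Lambda_{22}=\frac{A}{A^2+\theta_z+1},\quad \Lambda_{1_+}=\frac{A\beta J}{\beta^2J[\theta_\varepsilon(A^2+\theta_z+1)+J(A^2+\theta_z)]+\theta_{1_+}(A^2+\theta_z+1)},$$ $$\Lambda_{21}=\Lambda_{22}+\frac{A}{\beta J},\quad A_{21}=\frac1{2\Lambda_{22}},\quad \alpha_{22}=-\frac{A^2+\theta_z+1}{2}.$$ (ii) Real coefficients form a pure-strategy linear equilibrium if and only if $\sigma_z=0$, $(\Lambda_{21},\Lambda_{22},A,\beta)$ satisfies $$\begin{aligned}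 0={}&2A^4\Lambda_{22}+\beta(A^2J(\Lambda_{22}-\Lambda_{21})+J(\Lambda_{21}-\Lambda_{22}))-A\beta^2J^2(\Lambda_{21}-\Lambda_{22})^2+A-2\Lambda_{22},\\ 0={}&\beta^2(-A^3J(3\theta_\varepsilon+J+2)-3A\theta_\varepsilon J)+A^3\theta_{1_+}+A\theta_{1_+}\\ &+\beta^3(\Lambda_{21}-\Lambda_{22})\big(A^4J(\theta_\varepsilon+J)(4\theta_\varepsilon+J+2)+A^2\theta_\varepsilon J(8\theta_\varepsilon+5J+2)+4\theta_\varepsilon^2J\big)\\ &+\beta(\Lambda_{21}-\Lambda_{22})\theta_{1_+}\big(A^4(4\theta_\varepsilon+J+2)+A^2(8\theta_\varepsilon+J+2)+4\theta_\varepsilon\big),\\ 0={}&\Lambda_{21}\big[(\beta^2\theta_\varepsilon J+\theta_{1_+})G^2-4A\beta J\theta_{1_+}\Lambda_{22}G\\ &\quad+4\Lambda_{22}^2\big(A^2\beta^2J^2(\theta_{1_+}+\theta_2)+(A^2+1)(\beta^2\theta_\varepsilon J(\theta_{1_+}+\theta_2)+\theta_{1_+}\theta_2)\big)\big]\\ &-2\beta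 J\Lambda_{22}(2A\theta_2\Lambda_{22}+\beta\theta_\varepsilon G),\qquad\text{where } G=1-A\beta J(\Lambda_{21}-\Lambda_{22}),\\ 0={}&A^2\beta^4\theta_\varepsilon J^3(\Lambda_{21}-\Lambda_{22})^2+\beta^2J\big(\theta_\varepsilon(4(A^2+1)\Lambda_{22}^2(\theta_{1_+}+\theta_2)-1)\\ &\quad+A^2J(\Lambda_{21}^2\theta_{1_+}+2\Lambda_{21}\Lambda_{22}\theta_{1_+}+\Lambda_{22}^2(\theta_{1_+}+4\theta_2))\big)+\theta_{1_+}(4(A^2+1)\Lambda_{22}^2\theta_2-1),\\ 0<{}&\Lambda_{22},\\ 0<{}&\beta^2\big(\theta_\varepsilon J(\Lambda_{22}-\Lambda_{21})-A^2J(\theta_\varepsilon+J)(\Lambda_{21}-\Lambda_{22})\big)-A^2\theta_{1_+}(\Lambda_{21}-\Lambda_{22})+A\beta J+\theta_{1_+}(\Lambda_{22}-\Lambda_{21}),\\ 0<{}&4A^3\Lambda_{22}-A^2+2A\beta J(\Lambda_{22}-\Lambda_{21})+4A\Lambda_{22}-\beta^2J^2(\Lambda_{21}-\Lambda_{22})^2,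 \end{aligned}$$ and the remaining coefficients are $$\Lambda_1=\frac{A}{A^2+1},\quad\Lambda_{1_+}=\frac{A\beta J}{\beta^2J(A^2\theta_\varepsilon+A^2J+\theta_\varepsilon)+\theta_{1_+}(A^2+1)},\quad A_{21}=\frac1{2\Lambda_{22}},\quad\alpha_{22}=-\frac{\beta J(\Lambda_{21}-\Lambda_{22})}{2\Lambda_{22}}.$$ (iii) In every mixed- or pure-strategy linear equilibrium $\beta_{12}>0$; in every pure-strategy linear equilibrium also $\Lambda_{21},\Lambda_{22},A_1>0$. -/

import Mathlib

open MeasureTheory ProbabilityTheory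
open scoped ENNReal

noncomputable section

namespace Kyle

/-- Parameters of the market: prior mean and volatility of the asset, standard deviations of the
noise orders at times `1`, `1₊`, `2`, and of the error of the high-frequency traders' signals. -/
structure Market where
  p0 : ℝ
  σv : ℝ
  σ1 : ℝ
  σ1p : ℝ
  σ2 : ℝ
  σε : ℝ
  σv_pos : 0 < σv
  σ1_pos : 0 < σ1
  σ1p_pos : 0 < σ1p
  σ2_pos : 0 < σ2
  σε_nonneg : 0 ≤ σε

/-- The relative size of the time-`1₊` market. -/
def Market.θ1p (M : Market) : ℝ := M.σ1p ^ 2 / M.σ1 ^ 2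

/-- The relative size of the time-`2` market. -/
def Market.θ2 (M : Market) : ℝ := M.σ2 ^ 2 / M.σ1 ^ 2

/-- The relative size of the signal noise. -/
def Market.θε (M : Market) : ℝ := M.σε ^ 2 / M.σ1 ^ 2

/-- The exogenous randomness: the value `v`, the informed trader's endogenous noise `z`, the noise
orders `u1`, `u1p`, `u2` and the signal errors `ε j`; all are Gaussian and mutually independent. -/
structure Primitives (M : Market) (J : ℕ) (σz : ℝ) {Ω : Type*} [MeasurableSpace Ω]
    (μ : Measure Ω) where
  v : Ω → ℝ
  z : Ω → ℝ
  u1 : Ω → ℝ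
  u1p : Ω → ℝ
  u2 : Ω → ℝ
  ε : Fin J → Ω → ℝ
  measurable_v : Measurable v
  measurable_z : Measurable z
  measurable_u1 : Measurable u1
  measurable_u1p : Measurable u1p
  measurable_u2 : Measurable u2
  measurable_ε : ∀ j, Measurable (ε j)
  law_v : μ.map v = gaussianReal M.p0 (M.σv ^ 2).toNNReal
  law_z : μ.map z = gaussianReal 0 (σz ^ 2).toNNReal
  law_u1 : μ.map u1 = gaussianReal 0 (M.σ1 ^ 2).toNNReal
  law_u1p : μ.map u1p = gaussianReal 0 (M.σ1p ^ 2).toNNReal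
  law_u2 : μ.map u2 = gaussianReal 0 (M.σ2 ^ 2).toNNReal
  law_ε : ∀ j, μ.map (ε j) = gaussianReal 0 (M.σε ^ 2).toNNReal
  indep : iIndepFun (Sum.elim ![v, z, u1, u1p, u2] ε) μ

/-- A profile of pricing rules and strategies, each as a function of what its owner knows.
* prices: `p1 y₁`, `p1p y₁ y₁₊`, `p2 y₁ y₁₊ y₂`;
* informed trader: `i1 v z` (where `z` is her private randomization) and `i2 v i₁ y₁`;
* `j`-th high-frequency trader with signal `s`: `x1 j s y₁` and `x2 j s y₁ x₁ⱼ y₁₊`, where `x₁ⱼ` is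
  her own executed first order. -/
structure Profile (J : ℕ) where
  p1 : ℝ → ℝ
  p1p : ℝ → ℝ → ℝ
  p2 : ℝ → ℝ → ℝ → ℝ
  i1 : ℝ → ℝ → ℝ
  i2 : ℝ → ℝ → ℝ → ℝ
  x1 : Fin J → ℝ → ℝ → ℝ
  x2 : Fin J → ℝ → ℝ → ℝ → ℝ → ℝ

/-- All pricing rules and strategies are (jointly) measurable. -/
structure Profile.IsMeasurable {J : ℕ} (P : Profile J) : Prop where
  p1 : Measurable P.p1
  p1p : Measurable fun t : ℝ × ℝ => P.p1p t.1 t.2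
  p2 : Measurable fun t : ℝ × ℝ × ℝ => P.p2 t.1 t.2.1 t.2.2
  i1 : Measurable fun t : ℝ × ℝ => P.i1 t.1 t.2
  i2 : Measurable fun t : ℝ × ℝ × ℝ => P.i2 t.1 t.2.1 t.2.2
  x1 : ∀ j, Measurable fun t : ℝ × ℝ => P.x1 j t.1 t.2
  x2 : ∀ j, Measurable fun t : ℝ × ℝ × ℝ × ℝ => P.x2 j t.1 t.2.1 t.2.2.1 t.2.2.2

section Play

variable {M : Market} {J : ℕ} {σz : ℝ} {Ω : Type*} [MeasurableSpace Ω] {μ : Measure Ω}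

/-! The play of a profile: realized orders, order flows, prices and profits. -/

def I1 (X : Primitives M J σz μ) (P : Profile J) (ω : Ω) : ℝ := P.i1 (X.v ω) (X.z ω)

def Y1 (X : Primitives M J σz μ) (P : Profile J) (ω : Ω) : ℝ := I1 X P ω + X.u1 ω

/-- The signal of the `j`-th high-frequency trader about the first order. -/
def Sig (X : Primitives M J σz μ) (P : Profile J) (j : Fin J) (ω : Ω) : ℝ := I1 X P ω + X.ε j ω

def X1 (X : Primitives M J σz μ) (P : Profile J) (j : Fin J) (ω : Ω) : ℝ :=
  P.x1 j (Sig X P j ω) (Y1 X P ω)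

def Y1p (X : Primitives M J σz μ) (P : Profile J) (ω : Ω) : ℝ := ∑ j, X1 X P j ω + X.u1p ω

def I2 (X : Primitives M J σz μ) (P : Profile J) (ω : Ω) : ℝ :=
  P.i2 (X.v ω) (I1 X P ω) (Y1 X P ω)

def X2 (X : Primitives M J σz μ) (P : Profile J) (j : Fin J) (ω : Ω) : ℝ :=
  P.x2 j (Sig X P j ω) (Y1 X P ω) (X1 X P j ω) (Y1p X P ω)

def Y2 (X : Primitives M J σz μ) (P : Profile J) (ω : Ω) : ℝ :=
  I2 X P ω + ∑ j, X2 X P j ω + X.u2 ω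

def Price1 (X : Primitives M J σz μ) (P : Profile J) (ω : Ω) : ℝ := P.p1 (Y1 X P ω)

def Price1p (X : Primitives M J σz μ) (P : Profile J) (ω : Ω) : ℝ :=
  P.p1p (Y1 X P ω) (Y1p X P ω)

def Price2 (X : Primitives M J σz μ) (P : Profile J) (ω : Ω) : ℝ :=
  P.p2 (Y1 X P ω) (Y1p X P ω) (Y2 X P ω)

/-- The informed trader's profit from her first order. -/
def ITProfit1 (X : Primitives M J σz μ) (P : Profile J) (ω : Ω) : ℝ :=
  (X.v ω - Price1 X P ω) * I1 X P ω

/-- The informed trader's profit from her second order. -/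
def ITProfit2 (X : Primitives M J σz μ) (P : Profile J) (ω : Ω) : ℝ :=
  (X.v ω - Price2 X P ω) * I2 X P ω

def ITProfit (X : Primitives M J σz μ) (P : Profile J) (ω : Ω) : ℝ :=
  ITProfit1 X P ω + ITProfit2 X P ω

/-- The `j`-th high-frequency trader's profit from her first order. -/
def HFTProfit1 (X : Primitives M J σz μ) (P : Profile J) (j : Fin J) (ω : Ω) : ℝ :=
  (X.v ω - Price1p X P ω) * X1 X P j ω

/-- The `j`-th high-frequency trader's profit from her second order. -/
def HFTProfit2 (X : Primitives M J σz μ) (P : Profile J) (j : Fin J) (ω : Ω) : ℝ :=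
  (X.v ω - Price2 X P ω) * X2 X P j ω

def HFTProfit (X : Primitives M J σz μ) (P : Profile J) (j : Fin J) (ω : Ω) : ℝ :=
  HFTProfit1 X P j ω + HFTProfit2 X P j ω

/-- The squared terminal inventory of the `j`-th high-frequency trader. -/
def SqInventory (X : Primitives M J σz μ) (P : Profile J) (j : Fin J) (ω : Ω) : ℝ :=
  (X1 X P j ω + X2 X P j ω) ^ 2

/-- The information carried by a random variable. -/
abbrev sigmaOf {Ω β : Type*} [MeasurableSpace β] (f : Ω → β) : MeasurableSpace Ω :=
  MeasurableSpace.comap f inferInstance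

/-- `E(profit - γ * cost | m)` for an inventory aversion `γ ∈ [0, ∞]`, with `∞ * 0 = 0`. -/
def penalized (μ : Measure Ω) (m : MeasurableSpace Ω) (γ : ℝ≥0∞) (profit cost : Ω → ℝ) (ω : Ω) :
    EReal :=
  ((condExp m μ profit ω : ℝ) : EReal) - ((γ * ENNReal.ofReal (condExp m μ cost ω) : ℝ≥0∞) : EReal)

/-- Action `a` with value `V` is the maximizer against action `a'` with value `V'`: it is
never worse, and it is better wherever the two actions differ. -/
def Beats (μ : Measure Ω) (a : Ω → ℝ) (V : Ω → EReal) (a' : Ω → ℝ) (V' : Ω → EReal) : Prop :=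
  ∀ᵐ ω ∂μ, V' ω ≤ V ω ∧ (a' ω ≠ a ω → V' ω < V ω)

/-- Dealers' weak-efficiency pricing. -/
structure DealersEfficient (X : Primitives M J σz μ) (P : Profile J) : Prop where
  price1 : Price1 X P =ᵐ[μ] condExp (sigmaOf (Y1 X P)) μ X.v
  price1p : Price1p X P =ᵐ[μ] condExp (sigmaOf fun ω => (Y1 X P ω, Y1p X P ω)) μ X.v
  price2 : Price2 X P =ᵐ[μ]
    condExp (sigmaOf fun ω => (Y1 X P ω, Y1p X P ω, Y2 X P ω)) μ X.v

/-- In the second stage, whatever first order `ι` has been executed, `i2` is the maximizer of the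
informed trader's conditional expected second-stage profit given `(v, i₁, y₁)`, over all
measurable strategies `κ` (compared whenever the expected profits exist). -/
def ITSecondOptimal (X : Primitives M J σz μ) (P : Profile J) : Prop :=
  ∀ ι : ℝ → ℝ → ℝ, Measurable (fun t : ℝ × ℝ => ι t.1 t.2) →
  ∀ κ : ℝ → ℝ → ℝ → ℝ, Measurable (fun t : ℝ × ℝ × ℝ => κ t.1 t.2.1 t.2.2) →
    let Q : Profile J := { P with i1 := ι }
    let Q' : Profile J := { P with i1 := ι, i2 := κ }
    let f := fun ω => (X.v ω, I1 X Q ω, Y1 X Q ω)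
    Integrable (ITProfit2 X Q) μ → Integrable (ITProfit2 X Q') μ →
      Beats μ (I2 X Q) (fun ω => ((condExp (sigmaOf f) μ (ITProfit2 X Q) ω : ℝ) : EReal))
        (I2 X Q') (fun ω => ((condExp (sigmaOf f) μ (ITProfit2 X Q') ω : ℝ) : EReal))

/-- First stage of a mixed-strategy equilibrium: the informed trader is indifferent among all pure
strategies `i₁ = ι(v)`. -/
def ITFirstIndifferent (X : Primitives M J σz μ) (P : Profile J) : Prop :=
  ∀ ι ι' : ℝ → ℝ, Measurable ι → Measurable ι' →
    let Q : Profile J := { P with i1 := fun v _ => ι v }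
    let Q' : Profile J := { P with i1 := fun v _ => ι' v }
    Integrable (ITProfit X Q) μ → Integrable (ITProfit X Q') μ →
      condExp (sigmaOf X.v) μ (ITProfit X Q) =ᵐ[μ] condExp (sigmaOf X.v) μ (ITProfit X Q')

/-- First stage of a pure-strategy equilibrium: `i1` is the maximizer of the informed trader's
conditional expected total profit given `v`, over all measurable strategies `i₁ = ι(v)`. -/
def ITFirstOptimal (X : Primitives M J σz μ) (P : Profile J) : Prop :=
  ∀ ι : ℝ → ℝ, Measurable ι →
    let Q' : Profile J := { P with i1 := fun v _ => ι v }
    Integrable (ITProfit X Q') μ →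
      Beats μ (I1 X P) (fun ω => ((condExp (sigmaOf X.v) μ (ITProfit X P) ω : ℝ) : EReal))
        (I1 X Q') (fun ω => ((condExp (sigmaOf X.v) μ (ITProfit X Q') ω : ℝ) : EReal))

/-- In the second stage, whatever own first order `ξ(s, y₁)` has been executed, `x2 j` is the
maximizer of the `j`-th high-frequency trader's conditional expected penalized second-stage profit
given `(s, y₁, y₁₊)`, over all measurable strategies `χ(s, y₁, y₁₊)`. -/
def HFTSecondOptimal (X : Primitives M J σz μ) (γ : Fin J → ℝ≥0∞) (P : Profile J) (j : Fin J) :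
    Prop :=
  ∀ ξ : ℝ → ℝ → ℝ, Measurable (fun t : ℝ × ℝ => ξ t.1 t.2) →
  ∀ χ : ℝ → ℝ → ℝ → ℝ, Measurable (fun t : ℝ × ℝ × ℝ => χ t.1 t.2.1 t.2.2) →
    let Q : Profile J := { P with x1 := Function.update P.x1 j ξ }
    let Q' : Profile J :=
      { P with
        x1 := Function.update P.x1 j ξ
        x2 := Function.update P.x2 j fun s y _ yp => χ s y yp }
    let f := fun ω => (Sig X Q j ω, Y1 X Q ω, Y1p X Q ω)
    Integrable (HFTProfit2 X Q j) μ → Integrable (SqInventory X Q j) μ →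
    Integrable (HFTProfit2 X Q' j) μ → Integrable (SqInventory X Q' j) μ →
      Beats μ (X2 X Q j) (penalized μ (sigmaOf f) (γ j) (HFTProfit2 X Q j) (SqInventory X Q j))
        (X2 X Q' j) (penalized μ (sigmaOf f) (γ j) (HFTProfit2 X Q' j) (SqInventory X Q' j))

/-- In the first stage, `x1 j` is the maximizer of the `j`-th high-frequency trader's conditional
expected penalized total profit given `(s, y₁)`, over all measurable strategies `ξ(s, y₁)`. -/
def HFTFirstOptimal (X : Primitives M J σz μ) (γ : Fin J → ℝ≥0∞) (P : Profile J) (j : Fin J) :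
    Prop :=
  ∀ ξ : ℝ → ℝ → ℝ, Measurable (fun t : ℝ × ℝ => ξ t.1 t.2) →
    let Q' : Profile J := { P with x1 := Function.update P.x1 j ξ }
    let f := fun ω => (Sig X P j ω, Y1 X P ω)
    Integrable (HFTProfit X Q' j) μ → Integrable (SqInventory X Q' j) μ →
      Beats μ (X1 X P j) (penalized μ (sigmaOf f) (γ j) (HFTProfit X P j) (SqInventory X P j))
        (X1 X Q' j) (penalized μ (sigmaOf f) (γ j) (HFTProfit X Q' j) (SqInventory X Q' j))

/-- The equilibrium conditions shared by mixed- and pure-strategy equilibria. -/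
structure IsBaseEquilibrium (X : Primitives M J σz μ) (γ : Fin J → ℝ≥0∞) (P : Profile J) :
    Prop where
  measurable : P.IsMeasurable
  integrable_it1 : Integrable (ITProfit1 X P) μ
  integrable_it2 : Integrable (ITProfit2 X P) μ
  integrable_hft1 : ∀ j, Integrable (HFTProfit1 X P j) μ
  integrable_hft2 : ∀ j, Integrable (HFTProfit2 X P j) μ
  integrable_inv : ∀ j, Integrable (SqInventory X P j) μ
  dealers : DealersEfficient X P
  it_second : ITSecondOptimal X P
  hft_second : ∀ j, HFTSecondOptimal X γ P j
  hft_first : ∀ j, HFTFirstOptimal X γ P j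

/-- Mixed-strategy equilibrium: the endogenous noise is nondegenerate and the informed trader is
indifferent in the first stage. -/
structure IsMixedEquilibrium (X : Primitives M J σz μ) (γ : Fin J → ℝ≥0∞) (P : Profile J) :
    Prop extends IsBaseEquilibrium X γ P where
  noise : 0 < σz
  it_first : ITFirstIndifferent X P

/-- Pure-strategy equilibrium: there is no endogenous noise. -/
structure IsPureEquilibrium (X : Primitives M J σz μ) (γ : Fin J → ℝ≥0∞) (P : Profile J) :
    Prop extends IsBaseEquilibrium X γ P where
  noise : σz = 0
  it_first : ITFirstOptimal X P

end Play

/-- Coefficients of a linear profile in which all high-frequency traders use the same first-round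
intensity `β12` and clear their positions in the second round. -/
structure Coeffs where
  l1 : ℝ
  l1p : ℝ
  l21 : ℝ
  l22 : ℝ
  α1 : ℝ
  α21 : ℝ
  α22 : ℝ
  β12 : ℝ

/-- The linear profile with Round-Trippers. Here `ev`, `ei`, `es j` stand for the functions
`y₁ ↦ E(v | y₁)`, `y₁ ↦ E(i₁ | y₁)`, `y₁ ↦ E(s | y₁)`, with `s` the signal of trader `j`. -/
def linearProfile (M : Market) {J : ℕ} (c : Coeffs) (ev ei : ℝ → ℝ) (es : Fin J → ℝ → ℝ) :
    Profile J where
  p1 y1 := M.p0 + c.l1 * y1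
  p1p y1 y1p := M.p0 + c.l1 * y1 + c.l1p * y1p
  p2 y1 y1p y2 := M.p0 + c.l1 * y1 + c.l21 * y1p + c.l22 * y2
  i1 v z := c.α1 * (v - M.p0) + z
  i2 v i1 y1 := c.α21 * (v - ev y1) + c.α22 * (i1 - ei y1)
  x1 j s y1 := c.β12 * (s - es j y1)
  x2 _ _ _ x1 _ := -x1

section Linear

variable {M : Market} {J : ℕ} {σz : ℝ} {Ω : Type*} [MeasurableSpace Ω] {μ : Measure Ω}

/-- `ev`, `ei`, `es j` are the continuous versions of the conditional means given `y₁` along the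
play of `P`. -/
structure IsBelief (X : Primitives M J σz μ) (P : Profile J) (ev ei : ℝ → ℝ)
    (es : Fin J → ℝ → ℝ) : Prop where
  continuous_ev : Continuous ev
  continuous_ei : Continuous ei
  continuous_es : ∀ j, Continuous (es j)
  ev_eq : (fun ω => ev (Y1 X P ω)) =ᵐ[μ] condExp (sigmaOf (Y1 X P)) μ X.v
  ei_eq : (fun ω => ei (Y1 X P ω)) =ᵐ[μ] condExp (sigmaOf (Y1 X P)) μ (I1 X P)
  es_eq : ∀ j, (fun ω => es j (Y1 X P ω)) =ᵐ[μ] condExp (sigmaOf (Y1 X P)) μ (Sig X P j)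

/-- The coefficients `c` form a mixed-strategy linear equilibrium with `J` Round-Trippers, that is,
with infinite inventory aversion of every high-frequency trader. -/
def IsMixedLinear (X : Primitives M J σz μ) (c : Coeffs) : Prop :=
  ∃ (ev ei : ℝ → ℝ) (es : Fin J → ℝ → ℝ),
    IsBelief X (linearProfile M c ev ei es) ev ei es ∧
      IsMixedEquilibrium X (fun _ => ∞) (linearProfile M c ev ei es)

/-- The coefficients `c` form a pure-strategy linear equilibrium with `J` Round-Trippers. -/
def IsPureLinear (X : Primitives M J σz μ) (c : Coeffs) : Prop :=
  ∃ (ev ei : ℝ → ℝ) (es : Fin J → ℝ → ℝ),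
    IsBelief X (linearProfile M c ev ei es) ev ei es ∧
      IsPureEquilibrium X (fun _ => ∞) (linearProfile M c ev ei es)

end Linear

/-! Dimensionless coefficients. -/

def Coeffs.L1 (c : Coeffs) (M : Market) : ℝ := c.l1 / (M.σv / M.σ1)
def Coeffs.L1p (c : Coeffs) (M : Market) : ℝ := c.l1p / (M.σv / M.σ1)
def Coeffs.L21 (c : Coeffs) (M : Market) : ℝ := c.l21 / (M.σv / M.σ1)
def Coeffs.L22 (c : Coeffs) (M : Market) : ℝ := c.l22 / (M.σv / M.σ1)
def Coeffs.A1 (c : Coeffs) (M : Market) : ℝ := c.α1 / (M.σ1 / M.σv)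
def Coeffs.A21 (c : Coeffs) (M : Market) : ℝ := c.α21 / (M.σ1 / M.σv)

/-- The system for `(A, z, b) = (A₁, θ_z, β₁₂)` in the mixed-strategy equilibrium, with
`(t1, t2, e) = (θ₁₊, θ₂, θ_ε)`. -/
structure MixedSystem (J t1 t2 e A z b : ℝ) : Prop where
  eq1 : 0 =
    b ^ 3 * J ^ 2 *
        (J * (A ^ 4 * (4 * t1 + 4 * t2 - z) - 2 * A ^ 2 * z * (-2 * t1 - 2 * t2 + z + 1)
            - z * (z + 1) ^ 2)
          + e * (A ^ 2 + z + 1) *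
            (A ^ 6 + A ^ 4 * (2 * z + 1) + A ^ 2 * (4 * t1 + 4 * t2 + z ^ 2 - 1) - (z + 1) ^ 2))
      + b ^ 2 * J * (A ^ 2 + z + 1) *
        (4 * A ^ 2 * J * (t1 * (2 * A ^ 2 + 2 * z - 1) + t2 * (A ^ 2 + z - 1))
          + e * (A ^ 2 + z + 1) *
            (A ^ 6 + A ^ 4 * (2 * z - 1) + A ^ 2 * (4 * t1 + 4 * t2 + z ^ 2 - 1) + (z + 1) ^ 2))
      + b * J * t1 * (A ^ 2 + z + 1) *
        (5 * A ^ 6 + A ^ 4 * (10 * z - 1) + A ^ 2 * (4 * t2 + 5 * z ^ 2 - 5) + (z + 1) ^ 2)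
      + t1 * (A ^ 2 + z + 1) ^ 2 *
        (A ^ 6 + A ^ 4 * (2 * z - 1) + A ^ 2 * (4 * t2 + z ^ 2 - 1) + (z + 1) ^ 2)
  eq2 : 0 =
    4 * A ^ 2 * b * J * t1 * (A ^ 4 + 2 * A ^ 2 * z + A ^ 2 + z ^ 2 + z)
      + b ^ 2 * J *
        (J * (A ^ 4 * (4 * t1 + 4 * t2 - z) - 2 * A ^ 2 * z * (-2 * t1 - 2 * t2 + z + 1)
            - z * (z + 1) ^ 2)
          + e * (A ^ 2 + z + 1) *
            (A ^ 6 + A ^ 4 * (2 * z + 1) + A ^ 2 * (4 * t1 + 4 * t2 + z ^ 2 - 1) - (z + 1) ^ 2))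
      + t1 * (A ^ 2 + z + 1) *
        (A ^ 6 + A ^ 4 * (2 * z + 1) + A ^ 2 * (4 * t2 + z ^ 2 - 1) - (z + 1) ^ 2)
  eq3 : 0 =
    A ^ 4 * t1 * (4 * e + J + 2)
      + 2 * A ^ 2 * t1 * (4 * e * (z + 1) + J * z + J + 2 * z + 1)
      + b ^ 2 *
        (A ^ 4 * J * (e + J) * (4 * e + J + 2)
          + A ^ 2 * J * (8 * e ^ 2 * (z + 1) + 2 * e * (5 * J * z + J + 2 * z + 1)
              + J * (J + 2) * (2 * z - 1))
          + J * (4 * e ^ 2 * (z + 1) ^ 2 + e * (z + 1) * (J * (5 * z - 3) + 2 * z)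
              + J * (J + 2) * (z - 1) * z))
      + t1 * (z + 1) * (4 * e * (z + 1) + J * z + J + 2 * z)
  A_pos : 0 < A
  soc : 0 <
    -(A * (b ^ 2 * J * (e * (A ^ 2 + z + 1) + J * (A ^ 2 + z - 1)) + t1 * (A ^ 2 + z + 1)) /
      (b * J * (b ^ 2 * J * (e * (A ^ 2 + z + 1) + J * (A ^ 2 + z)) + t1 * (A ^ 2 + z + 1))))
  z_pos : 0 < z

/-- The remaining coefficients `(L1, L1p, L21, L22, A21, a22) = (Λ₁, Λ₁₊, Λ₂₁, Λ₂₂, A₂₁, α₂₂)` in the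
mixed-strategy equilibrium. -/
structure MixedFormulas (J t1 e A z b L1 L1p L21 L22 A21 a22 : ℝ) : Prop where
  L1_eq : L1 = A / (A ^ 2 + z + 1)
  L1p_eq : L1p =
    A * b * J / (b ^ 2 * J * (e * (A ^ 2 + z + 1) + J * (A ^ 2 + z)) + t1 * (A ^ 2 + z + 1))
  L22_eq : L22 = L1
  L21_eq : L21 = L22 + A / (b * J)
  A21_eq : A21 = 1 / (2 * L22)
  a22_eq : a22 = -((A ^ 2 + z + 1) / 2)

/-- The system for `(L21, L22, A, b) = (Λ₂₁, Λ₂₂, A₁, β₁₂)` in the pure-strategy equilibrium, with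
`(t1, t2, e) = (θ₁₊, θ₂, θ_ε)`. -/
structure PureSystem (J t1 t2 e L21 L22 A b : ℝ) : Prop where
  eq1 : 0 =
    2 * A ^ 4 * L22 + b * (A ^ 2 * J * (L22 - L21) + J * (L21 - L22))
      - A * b ^ 2 * J ^ 2 * (L21 - L22) ^ 2 + A - 2 * L22
  eq2 : 0 =
    b ^ 2 * (A ^ 3 * (-J) * (3 * e + J + 2) - 3 * A * e * J) + A ^ 3 * t1
      + b ^ 3 *
        (A ^ 4 * J * (e + J) * (4 * e + J + 2) * (L21 - L22)
          + A ^ 2 * e * J * (8 * e + 5 * J + 2) * (L21 - L22) + 4 * e ^ 2 * J * (L21 - L22))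
      + b *
        (A ^ 4 * t1 * (4 * e + J + 2) * (L21 - L22) + A ^ 2 * t1 * (8 * e + J + 2) * (L21 - L22)
          + 4 * e * t1 * (L21 - L22))
      + A * t1
  eq3 : 0 =
    L21 *
        ((b ^ 2 * e * J + t1) * (1 - A * b * J * (L21 - L22)) ^ 2
          - 4 * A * b * J * t1 * L22 * (1 - A * b * J * (L21 - L22))
          + 4 * L22 ^ 2 *
            (A ^ 2 * b ^ 2 * J ^ 2 * (t1 + t2)
              + (A ^ 2 + 1) * (b ^ 2 * e * J * (t1 + t2) + t1 * t2)))
      - 2 * b * J * L22 * (2 * A * t2 * L22 + b * e * (1 - A * b * J * (L21 - L22)))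
  eq4 : 0 =
    A ^ 2 * b ^ 4 * e * J ^ 3 * (L21 - L22) ^ 2
      + b ^ 2 * J *
        (e * (4 * (A ^ 2 + 1) * L22 ^ 2 * (t1 + t2) - 1)
          + A ^ 2 * J * (L21 ^ 2 * t1 + 2 * L21 * L22 * t1 + L22 ^ 2 * (t1 + 4 * t2)))
      + t1 * (4 * (A ^ 2 + 1) * L22 ^ 2 * t2 - 1)
  L22_pos : 0 < L22
  soc_hft : 0 <
    b ^ 2 * (e * J * (L22 - L21) - A ^ 2 * J * (e + J) * (L21 - L22))
      + A ^ 2 * t1 * (-(L21 - L22)) + A * b * J + t1 * (L22 - L21)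
  soc_it : 0 <
    4 * A ^ 3 * L22 - A ^ 2 + 2 * A * b * J * (L22 - L21) + 4 * A * L22
      - b ^ 2 * J ^ 2 * (L21 - L22) ^ 2

/-- The remaining coefficients `(L1, L1p, A21, a22) = (Λ₁, Λ₁₊, A₂₁, α₂₂)` in the pure-strategy
equilibrium. -/
structure PureFormulas (J t1 e L21 L22 A b L1 L1p A21 a22 : ℝ) : Prop where
  L1_eq : L1 = A / (A ^ 2 + 1)
  L1p_eq : L1p = A * b * J / (b ^ 2 * J * (A ^ 2 * e + A ^ 2 * J + e) + t1 * (A ^ 2 + 1))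
  A21_eq : A21 = 1 / (2 * L22)
  a22_eq : a22 = -(b * J * (L21 - L22) / (2 * L22))

end Kyle

end

/-! Everything is Gaussian and every rule is linear, so each equilibrium condition reduces to
finitely many scalar equations.

Continuity forces the beliefs to be the linear regressions on `y₁` (`IsBelief.linearProfile_eq`),
which leaves one concrete profile, `regressionProfile`. Let W and D be `v` and `i₁` net of their
regressions on `y₁`. Both later order flows are combinations of W, D, the signal errors and fresh
noise, hence uncorrelated with `y₁`.

Dealers: a linear price is a conditional mean iff its error is uncorrelated with the observed flows.
This gives the regression slope and the normal equations (`dealersEfficient_iff`).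

Informed trader: given her information, her second profit is `i₂ (edge - λ₂₂ i₂)`. Optimality after
every first order means `λ₂₂ > 0` and `i₂ = edge / (2 λ₂₂)`, which fixes `α₂₁` and `α₂₂`
(`itSecondOptimal_iff`). Her total expected profit given `v` is then a quadratic in `i₁`
(`itValue`). Indifference says that its linear and quadratic coefficients vanish; pure optimality
says that it is strictly concave and stationary at `α₁ (v - p₀)`.

High-frequency traders: infinite aversion makes any leftover inventory cost infinity, so closing the
position is optimal after every first order. What remains is `x₁ (p₂ - p₁₊)`, a quadratic in the own
order, which yields one sign and one slope condition (`hftFirstOptimal_iff`).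

Necessity is tested with the constant shifts ±1/(n+1), sufficiency by completing the square. Since
deviations are arbitrary measurable functions and only total profits are integrable, conditional
means are computed by truncation (`condExp_add_sum_mul_eq`).

In dimensionless form the conditions are `LinearEquations` plus the first-stage condition of the
informed trader. Two polynomials of each system are the normal equations for `p₂` multiplied by the
adjugate of the covariance matrix of the two later flows. That matrix is positive definite
(`flow_gram_det_pos`), so nothing is lost. The other polynomials are nonzero multiples of
first-order conditions. The signs in (iii) follow from the first-order condition of the
high-frequency traders together with the second-order conditions, and in the pure case also from the
normal equations. -/

noncomputable section

namespace Kyle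

/-! ### Dimensionless equations and the covariance matrix of the later flows -/

/-- The dimensionless equations of a linear profile that hold in mixed- and pure-strategy
equilibria alike. -/
structure LinearEquations (J t1 t2 e z A b L1 L1p L21 L22 A21 a22 : ℝ) : Prop where
  price1 : L1 * (A ^ 2 + z + 1) = A
  price1p : b * J * A =
    L1p * (b ^ 2 * J * (e * (A ^ 2 + z + 1) + J * (A ^ 2 + z)) + t1 * (A ^ 2 + z + 1))
  price2_flow1p : b * J * A =
    L21 * (b ^ 2 * J * (e * (A ^ 2 + z + 1) + J * (A ^ 2 + z)) + t1 * (A ^ 2 + z + 1)) +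
    L22 * (b * J * (A21 * A + (a22 - b * J) * (A ^ 2 + z)) - b ^ 2 * J * e * (A ^ 2 + z + 1))
  price2_flow2 : A21 * (z + 1) + (a22 - b * J) * A =
    L21 * (b * J * (A21 * A + (a22 - b * J) * (A ^ 2 + z)) - b ^ 2 * J * e * (A ^ 2 + z + 1)) +
    L22 * (A21 ^ 2 * (z + 1) + 2 * A21 * (a22 - b * J) * A + (a22 - b * J) ^ 2 * (A ^ 2 + z) +
      (b ^ 2 * J * e + t2) * (A ^ 2 + z + 1))
  it_soc : 0 < L22
  it_value : 2 * L22 * A21 = 1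
  it_order : 2 * L22 * a22 = -((L21 - L22) * b * J)
  hft_soc : 0 < L1p + L22 - L21
  hft_foc : (L21 - L1p) * (b * (J * (A ^ 2 + z) + e * (A ^ 2 + z + 1))) +
    L22 * (A21 * A + (a22 - b * J) * (A ^ 2 + z) - b * e * (A ^ 2 + z + 1)) -
    (L1p + L22 - L21) * b * (A ^ 2 + z + e * (A ^ 2 + z + 1)) = 0

/-- The determinant of the covariance matrix of the order flows `y₁₊` and `y₂` given `y₁`. -/
theorem flow_gram_det_pos {J t1 t2 e z A b A21 q S : ℝ} (hJ : 0 < J) (ht1 : 0 < t1) (ht2 : 0 < t2)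
    (he : 0 ≤ e) (hz : 0 ≤ z) (hS : S = A ^ 2 + z + 1) :
    0 < (b ^ 2 * J * (e * S + J * (A ^ 2 + z)) + t1 * S) *
        (A21 ^ 2 * (z + 1) + 2 * A21 * q * A + q ^ 2 * (A ^ 2 + z) + (b ^ 2 * J * e + t2) * S) -
      (b * J * (A21 * A + q * (A ^ 2 + z)) - b ^ 2 * J * e * S) ^ 2 := by
  have hS0 : 0 < S := by rw [hS]; positivity
  have hX : 0 ≤ b ^ 2 * J * (e * S + J * (A ^ 2 + z)) := by positivity
  have hY : 0 ≤ A21 ^ 2 * (z + 1) + 2 * A21 * q * A + q ^ 2 * (A ^ 2 + z) + b ^ 2 * J * e * S := by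
    have : A21 ^ 2 * (z + 1) + 2 * A21 * q * A + q ^ 2 * (A ^ 2 + z) =
      z * q ^ 2 + z * A21 ^ 2 + (A21 + q * A) ^ 2 := by ring
    rw [this]; positivity
  -- Without the noise terms `t1 * S` and `t2 * S` the matrix is still positive semidefinite; its
  -- determinant is an explicit sum of nonnegative terms.
  have hD : 0 ≤ b ^ 2 * J * (e * S + J * (A ^ 2 + z)) *
      (A21 ^ 2 * (z + 1) + 2 * A21 * q * A + q ^ 2 * (A ^ 2 + z) + b ^ 2 * J * e * S) -
      (b * J * (A21 * A + q * (A ^ 2 + z)) - b ^ 2 * J * e * S) ^ 2 := by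
    have : b ^ 2 * J * (e * S + J * (A ^ 2 + z)) *
      (A21 ^ 2 * (z + 1) + 2 * A21 * q * A + q ^ 2 * (A ^ 2 + z) + b ^ 2 * J * e * S) -
      (b * J * (A21 * A + q * (A ^ 2 + z)) - b ^ 2 * J * e * S) ^ 2 =
      (b * J) ^ 2 * A21 ^ 2 * (z * S) + b ^ 2 * J * e * S *
        (z * (q + b * J) ^ 2 + z * A21 ^ 2 + (A21 + (q + b * J) * A) ^ 2) := by
      rw [hS]; ring
    rw [this]; positivity
  have h1 : 0 < t1 * S := by positivity
  have h2 : 0 < t2 * S := by positivity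
  -- Adding a positive diagonal adds two nonnegative cross terms and the positive product `t1 * t2 *
  -- S ^ 2`.
  nlinarith [mul_nonneg hX h2.le, mul_nonneg hY h1.le, mul_pos h1 h2]

/-- Cramer's rule for a symmetric `2 × 2` system. -/
theorem eq_zero_of_cramer {r s x y w : ℝ} (hdet : 0 < x * y - w ^ 2) (h1 : s * x - r * w = 0)
    (h2 : r * y - s * w = 0) : r = 0 ∧ s = 0 := by
  constructor
  · have : r * (x * y - w ^ 2) = 0 := by linear_combination x * h2 + w * h1
    exact (mul_eq_zero.1 this).resolve_right hdet.ne'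
  · have : s * (x * y - w ^ 2) = 0 := by linear_combination y * h1 + w * h2
    exact (mul_eq_zero.1 this).resolve_right hdet.ne'

/-! ### Algebra of the mixed-strategy system -/

section Mixed

variable {J t1 t2 e z A b : ℝ}

/-- With residuals r, s of the normal equations for `y₁₊`, `y₂`, variances x, y and covariance w,
the first polynomial is a multiple of `r y - s w`. The second is a multiple of `s x - r w`
(`mixed_identity2`). Together they are the adjugate applied to (r, s), ready for
`eq_zero_of_cramer`. -/
theorem mixed_identity1 (hA : A ≠ 0) (hb : b ≠ 0) (hJ : J ≠ 0) {S L21 L22 A21 a22 : ℝ}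
    (hS0 : S ≠ 0) (hS : S = A ^ 2 + z + 1) (hL22 : L22 = A / S) (hL21 : L21 = A / S + A / (b * J))
    (hA21 : A21 = S / (2 * A)) (ha22 : a22 = -(S / 2)) :
    b ^ 3 * J ^ 2 *
        (J * (A ^ 4 * (4 * t1 + 4 * t2 - z) - 2 * A ^ 2 * z * (-2 * t1 - 2 * t2 + z + 1)
            - z * (z + 1) ^ 2)
          + e * (A ^ 2 + z + 1) *
            (A ^ 6 + A ^ 4 * (2 * z + 1) + A ^ 2 * (4 * t1 + 4 * t2 + z ^ 2 - 1) - (z + 1) ^ 2))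
      + b ^ 2 * J * (A ^ 2 + z + 1) *
        (4 * A ^ 2 * J * (t1 * (2 * A ^ 2 + 2 * z - 1) + t2 * (A ^ 2 + z - 1))
          + e * (A ^ 2 + z + 1) *
            (A ^ 6 + A ^ 4 * (2 * z - 1) + A ^ 2 * (4 * t1 + 4 * t2 + z ^ 2 - 1) + (z + 1) ^ 2))
      + b * J * t1 * (A ^ 2 + z + 1) *
        (5 * A ^ 6 + A ^ 4 * (10 * z - 1) + A ^ 2 * (4 * t2 + 5 * z ^ 2 - 5) + (z + 1) ^ 2)
      + t1 * (A ^ 2 + z + 1) ^ 2 *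
        (A ^ 6 + A ^ 4 * (2 * z - 1) + A ^ 2 * (4 * t2 + z ^ 2 - 1) + (z + 1) ^ 2) =
    -4 * A * J * b * (
      (b * J * A - (L21 * (b ^ 2 * J * (e * S + J * (A ^ 2 + z)) + t1 * S) +
          L22 * (b * J * (A21 * A + (a22 - b * J) * (A ^ 2 + z)) - b ^ 2 * J * e * S))) *
        (A21 ^ 2 * (z + 1) + 2 * A21 * (a22 - b * J) * A + (a22 - b * J) ^ 2 * (A ^ 2 + z) +
          (b ^ 2 * J * e + t2) * S) -
      (A21 * (z + 1) + (a22 - b * J) * A -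
        (L21 * (b * J * (A21 * A + (a22 - b * J) * (A ^ 2 + z)) - b ^ 2 * J * e * S) +
          L22 * (A21 ^ 2 * (z + 1) + 2 * A21 * (a22 - b * J) * A +
            (a22 - b * J) ^ 2 * (A ^ 2 + z) + (b ^ 2 * J * e + t2) * S))) *
        (b * J * (A21 * A + (a22 - b * J) * (A ^ 2 + z)) - b ^ 2 * J * e * S)) := by
  subst hL22 hL21 hA21 ha22
  -- `S` stays an opaque nonzero variable while denominators are cleared; its polynomial value is
  -- needed only by `ring`.
  field_simp
  subst hS
  ring

theorem mixed_identity2 (hA : A ≠ 0) (hb : b ≠ 0) (hJ : J ≠ 0) {S L21 L22 A21 a22 : ℝ}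
    (hS0 : S ≠ 0) (hS : S = A ^ 2 + z + 1) (hL22 : L22 = A / S) (hL21 : L21 = A / S + A / (b * J))
    (hA21 : A21 = S / (2 * A)) (ha22 : a22 = -(S / 2)) :
    4 * A ^ 2 * b * J * t1 * (A ^ 4 + 2 * A ^ 2 * z + A ^ 2 + z ^ 2 + z)
      + b ^ 2 * J *
        (J * (A ^ 4 * (4 * t1 + 4 * t2 - z) - 2 * A ^ 2 * z * (-2 * t1 - 2 * t2 + z + 1)
            - z * (z + 1) ^ 2)
          + e * (A ^ 2 + z + 1) *
            (A ^ 6 + A ^ 4 * (2 * z + 1) + A ^ 2 * (4 * t1 + 4 * t2 + z ^ 2 - 1) - (z + 1) ^ 2))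
      + t1 * (A ^ 2 + z + 1) *
        (A ^ 6 + A ^ 4 * (2 * z + 1) + A ^ 2 * (4 * t2 + z ^ 2 - 1) - (z + 1) ^ 2) =
    -4 * A * (
      (A21 * (z + 1) + (a22 - b * J) * A -
        (L21 * (b * J * (A21 * A + (a22 - b * J) * (A ^ 2 + z)) - b ^ 2 * J * e * S) +
          L22 * (A21 ^ 2 * (z + 1) + 2 * A21 * (a22 - b * J) * A +
            (a22 - b * J) ^ 2 * (A ^ 2 + z) + (b ^ 2 * J * e + t2) * S))) *
        (b ^ 2 * J * (e * S + J * (A ^ 2 + z)) + t1 * S) -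
      (b * J * A - (L21 * (b ^ 2 * J * (e * S + J * (A ^ 2 + z)) + t1 * S) +
          L22 * (b * J * (A21 * A + (a22 - b * J) * (A ^ 2 + z)) - b ^ 2 * J * e * S))) *
        (b * J * (A21 * A + (a22 - b * J) * (A ^ 2 + z)) - b ^ 2 * J * e * S)) := by
  subst hL22 hL21 hA21 ha22
  field_simp
  subst hS
  ring

/-- The third polynomial is the first-order condition of a high-frequency trader with the solved
coefficients inserted, up to the factor `2 * J * D / A`, which is nonzero when `J` and `D` are. -/
theorem mixed_identity3 (hA : A ≠ 0) (hb : b ≠ 0) (hJ : J ≠ 0) {S D L1p L21 L22 A21 a22 : ℝ}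
    (hS0 : S ≠ 0) (hD0 : D ≠ 0) (hS : S = A ^ 2 + z + 1)
    (hD : D = b ^ 2 * J * (e * (A ^ 2 + z + 1) + J * (A ^ 2 + z)) + t1 * (A ^ 2 + z + 1))
    (hL1p : L1p = A * b * J / D)
    (hL22 : L22 = A / S) (hL21 : L21 = A / S + A / (b * J))
    (hA21 : A21 = S / (2 * A)) (ha22 : a22 = -(S / 2)) :
    A ^ 4 * t1 * (4 * e + J + 2)
      + 2 * A ^ 2 * t1 * (4 * e * (z + 1) + J * z + J + 2 * z + 1)
      + b ^ 2 *
        (A ^ 4 * J * (e + J) * (4 * e + J + 2)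
          + A ^ 2 * J * (8 * e ^ 2 * (z + 1) + 2 * e * (5 * J * z + J + 2 * z + 1)
              + J * (J + 2) * (2 * z - 1))
          + J * (4 * e ^ 2 * (z + 1) ^ 2 + e * (z + 1) * (J * (5 * z - 3) + 2 * z)
              + J * (J + 2) * (z - 1) * z))
      + t1 * (z + 1) * (4 * e * (z + 1) + J * z + J + 2 * z) =
    (2 * J * D / A) *
     ((L21 - L1p) * (b * (J * (A ^ 2 + z) + e * S)) +
        L22 * (A21 * A + (a22 - b * J) * (A ^ 2 + z) - b * e * S) -
        (L1p + L22 - L21) * b * (A ^ 2 + z + e * S)) := by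
  subst hL1p hL22 hL21 hA21 ha22
  field_simp
  subst hD hS
  ring

/-- Identifies the long fraction in the system with the curvature in the second-order condition of
the high-frequency traders. -/
theorem mixed_soc_eq (hb : b ≠ 0) (hJ : J ≠ 0) {D L1p L21 L22 : ℝ} (hD0 : D ≠ 0)
    (hD : D = b ^ 2 * J * (e * (A ^ 2 + z + 1) + J * (A ^ 2 + z)) + t1 * (A ^ 2 + z + 1))
    (hL1p : L1p = A * b * J / D) (hL21 : L21 = L22 + A / (b * J)) :
    -(A * (b ^ 2 * J * (e * (A ^ 2 + z + 1) + J * (A ^ 2 + z - 1)) + t1 * (A ^ 2 + z + 1)) /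
      (b * J * D)) = L1p + L22 - L21 := by
  subst hL1p hL21
  field_simp
  subst hD
  ring

end Mixed

/-- The two extra conjuncts are the first-stage indifference of the informed trader. Together with
her second-stage rule they solve for every coefficient in terms of `A`, `z`, `b`; the normal
equations for `p₂` and the remaining first-order condition become the three polynomials. -/
theorem mixed_equations_iff {J t1 t2 e z A b L1 L1p L21 L22 A21 a22 : ℝ} (hJ : 0 < J)
    (ht1 : 0 < t1) (ht2 : 0 < t2) (he : 0 ≤ e) (hz : 0 < z) :
    (LinearEquations J t1 t2 e z A b L1 L1p L21 L22 A21 a22 ∧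
      A ^ 2 + z + 1 + a22 - A21 * A = 0 ∧
      L22 * (a22 - A21 * A) ^ 2 = L1 * (A ^ 2 + z + 1) ^ 2) ↔
    MixedSystem J t1 t2 e A z b ∧ MixedFormulas J t1 e A z b L1 L1p L21 L22 A21 a22 := by
  have hS : 0 < A ^ 2 + z + 1 := by positivity
  have hD : 0 < b ^ 2 * J * (e * (A ^ 2 + z + 1) + J * (A ^ 2 + z)) + t1 * (A ^ 2 + z + 1) := by
    positivity
  constructor
  · rintro ⟨⟨p1, p1p, p2a, p2b, l0, iv, io, k0, foc⟩, m1, m2⟩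
    -- By `m1` the response `a22 - A21 * A` equals minus the scaled flow variance, so `m2` compares
    -- `L22` and `L1` with the same positive factor.
    have hL : L22 = L1 := by
      have : (L22 - L1) * (A ^ 2 + z + 1) ^ 2 = 0 := by
        linear_combination m2 + L22 * (A ^ 2 + z + 1 - (a22 - A21 * A)) * m1
      have := (mul_eq_zero.1 this).resolve_right (by positivity)
      linarith
    have hA : 0 < A := by rw [← p1, ← hL]; positivity
    have hL22 : L22 = A / (A ^ 2 + z + 1) := by rw [hL]; field_simp; exact p1
    -- Multiply `m1` by `2 * L22`, insert the second-stage rules `iv`, `io`, and use that `L22`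
    -- times the scaled flow variance is `A`.
    have hc : (L21 - L22) * (b * J) = A := by
      rw [← hL] at p1
      linear_combination (-2 * L22) * m1 + io - A * iv + 2 * p1
    have hb : b ≠ 0 := by
      rintro rfl
      apply hA.ne'
      linear_combination -hc
    have hL21 : L21 = A / (A ^ 2 + z + 1) + A / (b * J) := by
      rw [← hL22]; field_simp; linear_combination hc
    have hA21 : A21 = (A ^ 2 + z + 1) / (2 * A) := by
      rw [hL22] at iv; field_simp; field_simp at iv; linear_combination iv
    have ha22 : a22 = -((A ^ 2 + z + 1) / 2) := by
      have : A21 * A = (A ^ 2 + z + 1) / 2 := by rw [hA21]; field_simp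
      linear_combination m1 + this
    have hL1p : L1p = A * b * J /
        (b ^ 2 * J * (e * (A ^ 2 + z + 1) + J * (A ^ 2 + z)) + t1 * (A ^ 2 + z + 1)) := by
      rw [eq_div_iff hD.ne']; linear_combination -p1p
    refine ⟨⟨?_, ?_, ?_, hA, ?_, hz⟩, ⟨?_, hL1p, hL, ?_, ?_, ha22⟩⟩
    · rw [mixed_identity1 hA.ne' hb hJ.ne' hS.ne' rfl hL22 hL21 hA21 ha22, ← p2a, ← p2b]
      ring
    · rw [mixed_identity2 hA.ne' hb hJ.ne' hS.ne' rfl hL22 hL21 hA21 ha22, ← p2a, ← p2b]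
      ring
    · rw [mixed_identity3 hA.ne' hb hJ.ne' hS.ne' hD.ne' rfl rfl hL1p hL22 hL21 hA21 ha22, foc]
      ring
    · rw [mixed_soc_eq hb hJ.ne' hD.ne' rfl hL1p (show L21 = L22 + A / (b * J) by rw [hL21, hL22])]
      exact k0
    · rw [← hL, hL22]
    · rw [hL21, hL22]
    · rw [eq_div_iff (by positivity)]; linear_combination iv
  · rintro ⟨⟨e1, e2, e3, hA, soc, -⟩, ⟨hL1, hL1p, hL, hL21', hA21', ha22⟩⟩
    -- At `b = 0` the fraction in `soc` is a division by zero, hence 0, and the strict inequality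
    -- fails.
    have hb : b ≠ 0 := by
      rintro rfl
      simp at soc
    have hL22 : L22 = A / (A ^ 2 + z + 1) := by rw [hL, hL1]
    have hL21 : L21 = A / (A ^ 2 + z + 1) + A / (b * J) := by rw [hL21', hL22]
    have hA21 : A21 = (A ^ 2 + z + 1) / (2 * A) := by rw [hA21', hL22]; field_simp
    have hAJb : -4 * A * J * b ≠ 0 := by
      simp [hA.ne', hJ.ne', hb]
    rw [mixed_identity1 hA.ne' hb hJ.ne' hS.ne' rfl hL22 hL21 hA21 ha22] at e1
    rw [mixed_identity2 hA.ne' hb hJ.ne' hS.ne' rfl hL22 hL21 hA21 ha22] at e2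
    rw [mixed_identity3 hA.ne' hb hJ.ne' hS.ne' hD.ne' rfl rfl hL1p hL22 hL21 hA21 ha22] at e3
    rw [mixed_soc_eq hb hJ.ne' hD.ne' rfl hL1p hL21'] at soc
    have e1' := (mul_eq_zero.1 e1.symm).resolve_left hAJb
    have e2' := (mul_eq_zero.1 e2.symm).resolve_left (by simp [hA.ne'])
    have e3' := (mul_eq_zero.1 e3.symm).resolve_left
      (div_ne_zero (mul_ne_zero (mul_ne_zero two_ne_zero hJ.ne') hD.ne') hA.ne')
    obtain ⟨f1, f2⟩ := eq_zero_of_cramer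
      (flow_gram_det_pos (A := A) (b := b) (A21 := A21) (q := a22 - b * J) hJ ht1 ht2 he hz.le rfl)
      e2' e1'
    refine ⟨⟨?_, ?_, sub_eq_zero.1 f1, sub_eq_zero.1 f2, ?_, ?_, ?_, soc, e3'⟩, ?_, ?_⟩
    · rw [hL1]; field_simp
    · rw [hL1p]; field_simp
    · rw [hL22]; positivity
    · rw [hL22, hA21]; field_simp
    · rw [hL21', hL22, ha22]; field_simp; ring
    · rw [ha22, hA21]; field_simp; ring
    · rw [ha22, hA21, hL22, hL1]; field_simp; ring

/-- Write `Q = A ^ 2 + z`, `S = Q + 1`, and `D` for the large denominator, so that `N = D - b ^ 2 *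
J ^ 2`. If `b < 0`, the second-order condition forces `N > 0`. The third equation reads `2 N ((J+1)
Q + 2 e S) = J (Q - 1) D`. Since `b ^ 2 * J ^ 2 * (Q - 1) ≤ N`, its right side is at most `J Q N`,
which is less than its left side. -/
theorem MixedSystem.intensity_pos {J t1 t2 e z A b : ℝ} (hJ : 0 < J) (ht1 : 0 < t1) (he : 0 ≤ e)
    (h : MixedSystem J t1 t2 e A z b) : 0 < b := by
  obtain ⟨-, -, e3, hA, soc, hz⟩ := h
  have hS : 0 < A ^ 2 + z + 1 := by positivity
  have hQ : 0 < A ^ 2 + z := by positivity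
  have hD : 0 < b ^ 2 * J * (e * (A ^ 2 + z + 1) + J * (A ^ 2 + z)) + t1 * (A ^ 2 + z + 1) := by
    positivity
  have hb : b ≠ 0 := by
    rintro rfl
    simp at soc
  by_contra hneg
  replace hneg : b < 0 := lt_of_le_of_ne (not_lt.1 hneg) hb
  set N := b ^ 2 * J * (e * (A ^ 2 + z + 1) + J * (A ^ 2 + z - 1)) + t1 * (A ^ 2 + z + 1) with hN
  have hbJD := mul_neg_of_neg_of_pos (mul_neg_of_neg_of_pos hneg hJ) hD
  have hN0 : 0 < N := by
    by_contra hle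
    exact absurd soc (not_lt.2 (neg_nonpos.2 (div_nonneg_of_nonpos
      (mul_nonpos_of_nonneg_of_nonpos hA.le (not_lt.1 hle)) hbJD.le)))
  have e3' : 2 * N * ((J + 1) * (A ^ 2 + z) + 2 * (e * (A ^ 2 + z + 1))) +
      J * (1 - (A ^ 2 + z)) * (N + b ^ 2 * J ^ 2) = 0 := by
    rw [hN]; linear_combination -e3
  have hN1 : b ^ 2 * J ^ 2 * (A ^ 2 + z - 1) ≤ N := by
    have : 0 ≤ b ^ 2 * J * (e * (A ^ 2 + z + 1)) + t1 * (A ^ 2 + z + 1) := by positivity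
    rw [hN]; linarith
  have h1 : 0 < N * ((J + 2) * (A ^ 2 + z) + 4 * (e * (A ^ 2 + z + 1))) := by positivity
  have h2 := mul_le_mul_of_nonneg_left hN1 hJ.le
  linarith

/-! ### Algebra of the pure-strategy system -/

section Pure

variable {J t1 t2 e A b : ℝ}

/-- The bracket on the right is the stationarity condition for the informed trader's first order,
cleared of denominators. -/
theorem pure_identity1 {S L1 L21 L22 A21 a22 : ℝ} (hL : L22 ≠ 0) (hS0 : S ≠ 0)
    (hS : S = A ^ 2 + 1) (hL1 : L1 = A / S) (hA21 : A21 = 1 / (2 * L22))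
    (ha22 : a22 = -(b * J * (L21 - L22) / (2 * L22))) :
    2 * A ^ 4 * L22 + b * (A ^ 2 * J * (L22 - L21) + J * (L21 - L22))
      - A * b ^ 2 * J ^ 2 * (L21 - L22) ^ 2 + A - 2 * L22 =
    (-2 * L22) * (S ^ 2 + (a22 - A21 * A) * S +
      2 * A * (L22 * (a22 - A21 * A) ^ 2 - L1 * S ^ 2)) := by
  subst hL1 hA21 ha22
  field_simp
  subst hS
  ring

theorem pure_identity2 {S D L1p L21 L22 A21 a22 : ℝ} (hL : L22 ≠ 0) (hD0 : D ≠ 0)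
    (hS : S = A ^ 2 + 1) (hD : D = b ^ 2 * J * (e * S + J * A ^ 2) + t1 * S)
    (hL1p : L1p = A * b * J / D) (hA21 : A21 = 1 / (2 * L22))
    (ha22 : a22 = -(b * J * (L21 - L22) / (2 * L22))) :
    b ^ 2 * (A ^ 3 * (-J) * (3 * e + J + 2) - 3 * A * e * J) + A ^ 3 * t1
      + b ^ 3 *
        (A ^ 4 * J * (e + J) * (4 * e + J + 2) * (L21 - L22)
          + A ^ 2 * e * J * (8 * e + 5 * J + 2) * (L21 - L22) + 4 * e ^ 2 * J * (L21 - L22))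
      + b *
        (A ^ 4 * t1 * (4 * e + J + 2) * (L21 - L22) + A ^ 2 * t1 * (8 * e + J + 2) * (L21 - L22)
          + 4 * e * t1 * (L21 - L22))
      + A * t1 =
    2 * D *
     ((L21 - L1p) * (b * (J * A ^ 2 + e * S)) +
        L22 * (A21 * A + (a22 - b * J) * A ^ 2 - b * e * S) -
        (L1p + L22 - L21) * b * (A ^ 2 + e * S)) := by
  subst hL1p hA21 ha22
  field_simp
  subst hD hS
  ring

/-- As in the mixed case, this polynomial and that of `pure_identity4` are the adjugate applied to
the residuals of the normal equations. Here a common factor `S` has been divided out of the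
published polynomials. -/
theorem pure_identity3 {S L21 L22 A21 a22 : ℝ} (hL : L22 ≠ 0) (hS : S = A ^ 2 + 1)
    (hA21 : A21 = 1 / (2 * L22)) (ha22 : a22 = -(b * J * (L21 - L22) / (2 * L22))) :
    S * (L21 *
        ((b ^ 2 * e * J + t1) * (1 - A * b * J * (L21 - L22)) ^ 2
          - 4 * A * b * J * t1 * L22 * (1 - A * b * J * (L21 - L22))
          + 4 * L22 ^ 2 *
            (A ^ 2 * b ^ 2 * J ^ 2 * (t1 + t2)
              + (A ^ 2 + 1) * (b ^ 2 * e * J * (t1 + t2) + t1 * t2)))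
      - 2 * b * J * L22 * (2 * A * t2 * L22 + b * e * (1 - A * b * J * (L21 - L22)))) =
    (-4 * L22 ^ 2) * (
      (b * J * A - (L21 * (b ^ 2 * J * (e * S + J * A ^ 2) + t1 * S) +
          L22 * (b * J * (A21 * A + (a22 - b * J) * A ^ 2) - b ^ 2 * J * e * S))) *
        (A21 ^ 2 + 2 * A21 * (a22 - b * J) * A + (a22 - b * J) ^ 2 * A ^ 2 +
          (b ^ 2 * J * e + t2) * S) -
      (A21 + (a22 - b * J) * A -
        (L21 * (b * J * (A21 * A + (a22 - b * J) * A ^ 2) - b ^ 2 * J * e * S) +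
          L22 * (A21 ^ 2 + 2 * A21 * (a22 - b * J) * A +
            (a22 - b * J) ^ 2 * A ^ 2 + (b ^ 2 * J * e + t2) * S))) *
        (b * J * (A21 * A + (a22 - b * J) * A ^ 2) - b ^ 2 * J * e * S)) := by
  subst hA21 ha22
  field_simp
  subst hS
  ring

theorem pure_identity4 {S L21 L22 A21 a22 : ℝ} (hL : L22 ≠ 0) (hS : S = A ^ 2 + 1)
    (hA21 : A21 = 1 / (2 * L22)) (ha22 : a22 = -(b * J * (L21 - L22) / (2 * L22))) :
    S * (A ^ 2 * b ^ 4 * e * J ^ 3 * (L21 - L22) ^ 2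
      + b ^ 2 * J *
        (e * (4 * (A ^ 2 + 1) * L22 ^ 2 * (t1 + t2) - 1)
          + A ^ 2 * J * (L21 ^ 2 * t1 + 2 * L21 * L22 * t1 + L22 ^ 2 * (t1 + 4 * t2)))
      + t1 * (4 * (A ^ 2 + 1) * L22 ^ 2 * t2 - 1)) =
    (-4 * L22) * (
      (A21 + (a22 - b * J) * A -
        (L21 * (b * J * (A21 * A + (a22 - b * J) * A ^ 2) - b ^ 2 * J * e * S) +
          L22 * (A21 ^ 2 + 2 * A21 * (a22 - b * J) * A +
            (a22 - b * J) ^ 2 * A ^ 2 + (b ^ 2 * J * e + t2) * S))) *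
        (b ^ 2 * J * (e * S + J * A ^ 2) + t1 * S) -
      (b * J * A - (L21 * (b ^ 2 * J * (e * S + J * A ^ 2) + t1 * S) +
          L22 * (b * J * (A21 * A + (a22 - b * J) * A ^ 2) - b ^ 2 * J * e * S))) *
        (b * J * (A21 * A + (a22 - b * J) * A ^ 2) - b ^ 2 * J * e * S)) := by
  subst hA21 ha22
  field_simp
  subst hS
  ring

end Pure

/-- Stationarity is weaker than indifference and does not determine `L21` and `L22`, so they stay
unknowns and four equations remain. The two extra conjuncts are strict concavity and stationarity of
the informed trader's first-stage value. -/
theorem pure_equations_iff {J t1 t2 e A b L1 L1p L21 L22 A21 a22 : ℝ} (hJ : 0 < J)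
    (ht1 : 0 < t1) (ht2 : 0 < t2) (he : 0 ≤ e) :
    (LinearEquations J t1 t2 e 0 A b L1 L1p L21 L22 A21 a22 ∧
      L22 * (a22 - A21 * A) ^ 2 < L1 * (A ^ 2 + 1) ^ 2 ∧
      (A ^ 2 + 1) ^ 2 + (a22 - A21 * A) * (A ^ 2 + 1) +
        2 * A * (L22 * (a22 - A21 * A) ^ 2 - L1 * (A ^ 2 + 1) ^ 2) = 0) ↔
    PureSystem J t1 t2 e L21 L22 A b ∧ PureFormulas J t1 e L21 L22 A b L1 L1p A21 a22 := by
  have hS : 0 < A ^ 2 + 1 := by positivity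
  have hD : 0 < b ^ 2 * J * (e * (A ^ 2 + 1) + J * A ^ 2) + t1 * (A ^ 2 + 1) := by
    positivity
  have hDeq : b ^ 2 * J * (A ^ 2 * e + A ^ 2 * J + e) + t1 * (A ^ 2 + 1) =
      b ^ 2 * J * (e * (A ^ 2 + 1) + J * A ^ 2) + t1 * (A ^ 2 + 1) := by ring
  have hsoc : b ^ 2 * (e * J * (L22 - L21) - A ^ 2 * J * (e + J) * (L21 - L22))
      + A ^ 2 * t1 * (-(L21 - L22)) + A * b * J + t1 * (L22 - L21) =
      A * b * J - (L21 - L22) * (b ^ 2 * J * (e * (A ^ 2 + 1) + J * A ^ 2) + t1 * (A ^ 2 + 1)) := by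
    ring
  constructor
  · rintro ⟨⟨p1, p1p, p2a, p2b, l0, iv, io, k0, foc⟩, m1, m2⟩
    simp only [add_zero, zero_add, mul_one] at p1 p1p p2a p2b foc
    have hL1 : L1 = A / (A ^ 2 + 1) := by rw [eq_div_iff hS.ne']; exact p1
    have hA21 : A21 = 1 / (2 * L22) := by rw [eq_div_iff (by positivity)]; linear_combination iv
    have ha22 : a22 = -(b * J * (L21 - L22) / (2 * L22)) := by
      rw [← neg_div, eq_div_iff (by positivity)]; linear_combination io
    have hL1p : L1p = A * b * J /
        (b ^ 2 * J * (e * (A ^ 2 + 1) + J * A ^ 2) + t1 * (A ^ 2 + 1)) := by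
      rw [eq_div_iff hD.ne']; linear_combination -p1p
    refine ⟨⟨?_, ?_, ?_, ?_, l0, ?_, ?_⟩, ⟨hL1, by rw [hDeq]; exact hL1p, hA21, ha22⟩⟩
    · rw [pure_identity1 l0.ne' hS.ne' rfl hL1 hA21 ha22, m2, mul_zero]
    · rw [pure_identity2 l0.ne' hD.ne' rfl rfl hL1p hA21 ha22, foc, mul_zero]
    · refine ((mul_eq_zero.1 ((pure_identity3 l0.ne' rfl hA21 ha22).trans ?_)).resolve_left
        hS.ne').symm
      rw [← p2a, ← p2b]
      ring
    · refine ((mul_eq_zero.1 ((pure_identity4 l0.ne' rfl hA21 ha22).trans ?_)).resolve_left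
        hS.ne').symm
      rw [← p2a, ← p2b]
      ring
    · have := mul_pos k0 hD
      rw [hsoc]
      linarith
    · have h1 : 0 < 4 * L22 * (L1 * (A ^ 2 + 1) ^ 2 - L22 * (a22 - A21 * A) ^ 2) :=
        mul_pos (by positivity) (sub_pos.2 m1)
      rw [hL1, hA21, ha22] at h1
      field_simp at h1
      linarith
  · rintro ⟨⟨e1, e2, e3, e4, l0, shft, sit⟩, ⟨hL1, hL1p, hA21, ha22⟩⟩
    rw [hDeq] at hL1p
    rw [hsoc] at shft
    have p1 : L1 * (A ^ 2 + 1) = A := by rw [hL1]; field_simp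
    have p1p : b * J * A =
        L1p * (b ^ 2 * J * (e * (A ^ 2 + 1) + J * A ^ 2) + t1 * (A ^ 2 + 1)) := by
      rw [hL1p]; field_simp
    rw [pure_identity1 l0.ne' hS.ne' rfl hL1 hA21 ha22] at e1
    rw [pure_identity2 l0.ne' hD.ne' rfl rfl hL1p hA21 ha22] at e2
    have e3' := (pure_identity3 (A := A) (t1 := t1) (t2 := t2) (e := e) l0.ne' rfl hA21 ha22).symm
    have e4' := (pure_identity4 (A := A) (t1 := t1) (t2 := t2) (e := e) l0.ne' rfl hA21 ha22).symm
    rw [← e3, mul_zero] at e3'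
    rw [← e4, mul_zero] at e4'
    have hdet := flow_gram_det_pos (A := A) (b := b) (A21 := A21) (q := a22 - b * J) hJ ht1 ht2 he
      le_rfl rfl
    simp only [add_zero, zero_add, mul_one] at hdet
    obtain ⟨f1, f2⟩ := eq_zero_of_cramer hdet
      ((mul_eq_zero.1 e4').resolve_left (by simp [l0.ne']))
      ((mul_eq_zero.1 e3').resolve_left (by simp [l0.ne']))
    -- The inequality `soc_hft` is this quantity multiplied by the positive denominator of `L1p`.
    have hk : 0 < L1p + L22 - L21 := by
      refine pos_of_mul_pos_left (b := _) ?_ hD.le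
      linear_combination shft + p1p
    refine ⟨⟨?_, ?_, ?_, ?_, l0, ?_, ?_, hk, ?_⟩, ?_, ?_⟩
    · simpa using p1
    · simpa using p1p
    · simpa using sub_eq_zero.1 f1
    · simpa using sub_eq_zero.1 f2
    · rw [hA21]; field_simp
    · rw [ha22]; field_simp
    · simpa using (mul_eq_zero.1 e2.symm).resolve_left (by simp [hD.ne'])
    · refine sub_pos.1 (pos_of_mul_pos_right (a := 4 * L22) ?_ (by positivity))
      rw [hL1, hA21, ha22]
      field_simp
      linarith
    · exact (mul_eq_zero.1 e1.symm).resolve_left (by simp [l0.ne'])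

/-- Put `G = 1 - A b J (L21 - L22)`. The concavity inequality gives `A > 0`. The high-frequency
first-order condition writes `A * G` as `b` times a positive number, so `b * G > 0`, and the first
normal equation for `p₂` then gives `L21 > 0`. If `b` were negative, every part of the third
equation would be nonnegative and one of them positive. -/
theorem PureSystem.signs {J t1 t2 e L21 L22 A b : ℝ} (hJ : 0 < J) (ht1 : 0 < t1) (ht2 : 0 < t2)
    (he : 0 ≤ e) (h : PureSystem J t1 t2 e L21 L22 A b) :
    0 < L21 ∧ 0 < L22 ∧ 0 < A ∧ 0 < b := by
  have hL22 := h.L22_pos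
  have hS : 0 < A ^ 2 + 1 := by positivity
  have hA : 0 < A := by
    have h1 := h.soc_it
    have h2 : 0 < (4 * L22 * (A ^ 2 + 1)) * A := by
      -- The right side of `soc_it` is the expression `h2` minus this square.
      nlinarith [sq_nonneg (A + b * J * (L21 - L22))]
    exact pos_of_mul_pos_right h2 (by positivity)
  -- The remaining coefficients are defined by their formulas, which makes the original equations
  -- available; the formulas themselves are then generalized away.
  obtain ⟨heq, -⟩ := (pure_equations_iff hJ ht1 ht2 he).2 ⟨h, ⟨rfl, rfl, rfl, rfl⟩⟩
  obtain ⟨-, -, p2a, -, -, iv, io, k0, foc⟩ := heq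
  simp only [add_zero] at p2a foc k0
  generalize A * b * J / (b ^ 2 * J * (A ^ 2 * e + A ^ 2 * J + e) + t1 * (A ^ 2 + 1)) = L1p
    at foc k0
  generalize 1 / (2 * L22) = A21 at p2a foc iv
  generalize -(b * J * (L21 - L22) / (2 * L22)) = a22 at p2a foc io
  have hfoc : 2 * b * ((L1p + L22 - L21) * ((J + 1) * A ^ 2 + 2 * e * (A ^ 2 + 1))) =
      A * (1 - A * b * J * (L21 - L22)) := by
    linear_combination -2 * foc + A * iv + A ^ 2 * io
  have hb : b ≠ 0 := by
    rintro rfl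
    exact hA.ne (by linear_combination hfoc)
  have hK : 0 < (L1p + L22 - L21) * ((J + 1) * A ^ 2 + 2 * e * (A ^ 2 + 1)) := by positivity
  have hbG : 0 < b * (1 - A * b * J * (L21 - L22)) := by
    have h1 : 0 < b * (A * (1 - A * b * J * (L21 - L22))) := by
      rw [← hfoc]
      have : 0 < b ^ 2 := by positivity
      nlinarith [mul_pos this hK]
    refine pos_of_mul_pos_right (a := A) ?_ hA.le
    linarith
  have hL21 : 0 < L21 := by
    have h1 : L21 * (2 * (A ^ 2 + 1) * (t1 + b ^ 2 * J * e)) =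
        J * A * (b * (1 - A * b * J * (L21 - L22))) +
          2 * (A ^ 2 + 1) * L22 * (b ^ 2 * J * e) := by
      linear_combination -2 * p2a - b * J * A * iv - b * J * A ^ 2 * io
    refine pos_of_mul_pos_left (b := 2 * (A ^ 2 + 1) * (t1 + b ^ 2 * J * e)) ?_ (by positivity)
    rw [h1]
    positivity
  refine ⟨hL21, hL22, hA, ?_⟩
  by_contra hneg
  replace hneg : b < 0 := lt_of_le_of_ne (not_lt.1 hneg) hb
  have e3 := h.eq3
  -- The bracket of the third equation with its `t1` terms collected into the square of `G - 2 * A *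
  -- b * J * L22`.
  have h1 : 0 ≤ L21 * (b ^ 2 * e * J * (1 - A * b * J * (L21 - L22)) ^ 2 +
      t1 * (1 - A * b * J * (L21 - L22) - 2 * A * b * J * L22) ^ 2 +
      4 * L22 ^ 2 * (A ^ 2 * b ^ 2 * J ^ 2 * t2 +
        (A ^ 2 + 1) * (b ^ 2 * e * J * (t1 + t2) + t1 * t2))) := by positivity
  have h2 : 0 < -b * J * L22 * (2 * A * t2 * L22) := by
    have := neg_pos.2 hneg
    positivity
  have h3 : 0 < -b * (J * L22) := mul_pos (neg_pos.2 hneg) (mul_pos hJ hL22)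
  have h4 := mul_nonneg h3.le (mul_nonneg he hbG.le)
  linarith

/-! ### Conditional expectations without termwise integrability -/

section CondExp

variable {Ω : Type*} {m m0 : MeasurableSpace Ω} {μ : Measure Ω}

/-- Pulling out known coefficients from a sum of mean-zero terms. Only the whole sum, and not each
of its terms, is assumed to be integrable. -/
theorem condExp_add_sum_mul_eq [IsFiniteMeasure μ] (hm : m ≤ m0) {κ : Type*} (s : Finset κ)
    {F a : Ω → ℝ} {b R : κ → Ω → ℝ} (ha : Measurable[m] a) (hb : ∀ k ∈ s, Measurable[m] (b k))
    (hR : ∀ k ∈ s, Integrable (R k) μ) (hR0 : ∀ k ∈ s, condExp m μ (R k) =ᵐ[μ] 0)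
    (hF : Integrable F μ) (hFe : F =ᵐ[μ] fun ω => a ω + ∑ k ∈ s, b k ω * R k ω) :
    condExp m μ F =ᵐ[μ] a := by
  -- The coefficients are truncated on the sets `B ≤ n`, which are known events exhausting the
  -- space. There all known factors are bounded, so each term is integrable and the usual pull-out
  -- rule applies.
  let B : Ω → ℝ := fun ω => |a ω| + ∑ k ∈ s, |b k ω|
  have hB : Measurable[m] B :=
    (continuous_abs.measurable.comp ha).add
      (Finset.measurable_fun_sum s fun k hk => continuous_abs.measurable.comp (hb k hk))
  let E : ℕ → Set Ω := fun n => {ω | B ω ≤ n}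
  have hE : ∀ n, MeasurableSet[m] (E n) := fun n => hB measurableSet_Iic
  have hbE : ∀ n, ∀ k ∈ s, ∀ ω, ‖(E n).indicator (b k) ω‖ ≤ n := by
    intro n k hk ω
    by_cases h : ω ∈ E n
    · rw [Set.indicator_of_mem h, Real.norm_eq_abs]
      have h1 := Finset.single_le_sum (f := fun k => |b k ω|) (fun _ _ => abs_nonneg _) hk
      have h2 : B ω ≤ n := h
      have h3 := abs_nonneg (a ω)
      simp only [B] at h2 h1
      linarith
    · rw [Set.indicator_of_notMem h]; simp
  have haE : ∀ n, ∀ ω, ‖(E n).indicator a ω‖ ≤ n := by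
    intro n ω
    by_cases h : ω ∈ E n
    · rw [Set.indicator_of_mem h, Real.norm_eq_abs]
      have h1 : 0 ≤ ∑ k ∈ s, |b k ω| := Finset.sum_nonneg fun _ _ => abs_nonneg _
      have h2 : B ω ≤ n := h
      simp only [B] at h2
      linarith
    · rw [Set.indicator_of_notMem h]; simp
  have key : ∀ n, (E n).indicator (condExp m μ F) =ᵐ[μ] (E n).indicator a := by
    intro n
    refine (condExp_indicator hF (hE n)).symm.trans ?_
    have hbm : ∀ k ∈ s, StronglyMeasurable[m] ((E n).indicator (b k)) := fun k hk =>
      ((hb k hk).indicator (hE n)).stronglyMeasurable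
    have ham : StronglyMeasurable[m] ((E n).indicator a) :=
      (ha.indicator (hE n)).stronglyMeasurable
    have hai : Integrable ((E n).indicator a) μ :=
      Integrable.of_bound (ham.mono hm).aestronglyMeasurable n (ae_of_all _ (haE n))
    have hbi : ∀ k ∈ s, Integrable ((E n).indicator (b k) * R k) μ := fun k hk =>
      (hR k hk).bdd_mul ((hbm k hk).mono hm).aestronglyMeasurable
        (ae_of_all _ (hbE n k hk))
    have h1 : (E n).indicator F =ᵐ[μ]
        (E n).indicator a + ∑ k ∈ s, (E n).indicator (b k) * R k := by
      filter_upwards [hFe] with ω hω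
      by_cases h : ω ∈ E n
      · simp [h, hω, Set.indicator_of_mem]
      · simp [h, Set.indicator_of_notMem]
    refine (condExp_congr_ae h1).trans ?_
    refine (condExp_add hai (integrable_finsetSum' _ hbi) m).trans ?_
    rw [condExp_of_stronglyMeasurable hm ham hai]
    have h2 : condExp m μ (∑ k ∈ s, (E n).indicator (b k) * R k) =ᵐ[μ] 0 := by
      refine (condExp_finsetSum hbi m).trans ?_
      have h3 : ∀ k ∈ s, condExp m μ ((E n).indicator (b k) * R k) =ᵐ[μ] 0 := by
        intro k hk
        refine (condExp_stronglyMeasurable_mul_of_bound hm (hbm k hk) (hR k hk) n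
          (ae_of_all _ (hbE n k hk))).trans ?_
        filter_upwards [hR0 k hk] with ω hω
        simp [hω]
      have h4 : ∀ᵐ ω ∂μ, ∀ k ∈ s, condExp m μ ((E n).indicator (b k) * R k) ω = 0 :=
        (ae_ball_iff s.countable_toSet).2 h3
      filter_upwards [h4] with ω hω
      simp only [Finset.sum_apply, Pi.zero_apply]
      exact Finset.sum_eq_zero hω
    filter_upwards [h2] with ω hω
    simp [hω]
  filter_upwards [ae_all_iff.2 key] with ω hω
  obtain ⟨n, hn⟩ := exists_nat_ge (B ω)
  have h : ω ∈ E n := hn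
  simpa [h] using hω n

theorem condExp_add_mul_eq [IsFiniteMeasure μ] (hm : m ≤ m0) {F a b R : Ω → ℝ}
    (ha : Measurable[m] a) (hb : Measurable[m] b) (hR : Integrable R μ)
    (hR0 : condExp m μ R =ᵐ[μ] 0) (hF : Integrable F μ)
    (hFe : F =ᵐ[μ] fun ω => a ω + b ω * R ω) : condExp m μ F =ᵐ[μ] a :=
  condExp_add_sum_mul_eq hm {()} (b := fun _ => b) (R := fun _ => R) ha (fun _ _ => hb)
    (fun _ _ => hR) (fun _ _ => hR0) hF (by simpa using hFe)

/-- A random variable with vanishing conditional mean is orthogonal to what is known. -/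
theorem integral_mul_eq_zero_of_condExp_eq_zero (hm : m ≤ m0) [SigmaFinite (μ.trim hm)]
    {R Y : Ω → ℝ} (hY : Measurable[m] Y) (hR : Integrable R μ)
    (hYR : Integrable (fun ω => Y ω * R ω) μ) (h0 : condExp m μ R =ᵐ[μ] 0) :
    ∫ ω, Y ω * R ω ∂μ = 0 := by
  rw [← integral_condExp hm]
  have h1 : condExp m μ (fun ω => Y ω * R ω) =ᵐ[μ] 0 := by
    refine (condExp_mul_of_stronglyMeasurable_left hY.stronglyMeasurable hYR hR).trans ?_
    filter_upwards [h0] with ω hω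
    simp [hω]
  rw [integral_congr_ae h1]
  simp

theorem condExp_eq_zero_of_indepFun [IsProbabilityMeasure μ] {β : Type*} [MeasurableSpace β]
    {R : Ω → ℝ} {f : Ω → β} (hR : Measurable R) (hf : Measurable f) (h : IndepFun R f μ)
    (h0 : ∫ ω, R ω ∂μ = 0) : condExp (sigmaOf f) μ R =ᵐ[μ] 0 := by
  refine (condExp_indep_eq hR.comap_le hf.comap_le
    (comap_measurable R).stronglyMeasurable h).trans ?_
  rw [h0]; rfl

/-- If a quadratic increment is negative for all small nonzero steps, then its slope vanishes and
its curvature is negative. -/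
theorem slope_eq_zero_of_forall_step_neg {K L : ℝ}
    (h : ∀ n : ℕ, -K * (1 / ((n : ℝ) + 1)) ^ 2 + 1 / ((n : ℝ) + 1) * L < 0 ∧
      -K * (1 / ((n : ℝ) + 1)) ^ 2 - 1 / ((n : ℝ) + 1) * L < 0) : 0 < K ∧ L = 0 := by
  -- Adding the two inequalities at step 1 gives `K > 0`; the smaller steps bound `|L|` by `K / (n +
  -- 1)`.
  have h0 := h 0
  norm_num at h0
  refine ⟨by linarith [h0.1, h0.2], ?_⟩
  have key : ∀ n : ℕ, |L| ≤ K * (1 / ((n : ℝ) + 1)) := by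
    intro n
    have hn : 0 < 1 / ((n : ℝ) + 1) := by positivity
    obtain ⟨h1, h2⟩ := h n
    rw [abs_le]
    constructor <;> nlinarith
  have hlim : Filter.Tendsto (fun n : ℕ => K * (1 / ((n : ℝ) + 1))) Filter.atTop (nhds (K * 0)) :=
    tendsto_one_div_add_atTop_nhds_zero_nat.const_mul K
  rw [mul_zero] at hlim
  exact abs_eq_zero.1 (le_antisymm (ge_of_tendsto' hlim key) (abs_nonneg L))

end CondExp

/-! ### Linear combinations of independent Gaussian variables -/

section Gaussian

variable {Ω : Type*} [MeasurableSpace Ω] {μ : Measure Ω} {ι : Type*}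
  {Z : ι → Ω → ℝ} {s : ι → ℝ}

/-- Independent centered Gaussian random variables with variances `s i`. -/
structure IsGaussianFamily (Z : ι → Ω → ℝ) (s : ι → ℝ) (μ : Measure Ω) : Prop where
  measurable : ∀ i, Measurable (Z i)
  nonneg : ∀ i, 0 ≤ s i
  law : ∀ i, μ.map (Z i) = gaussianReal 0 (s i).toNNReal
  indep : iIndepFun Z μ

namespace IsGaussianFamily

theorem isProbabilityMeasure (h : IsGaussianFamily Z s μ) : IsProbabilityMeasure μ :=
  h.indep.isProbabilityMeasure

theorem hasGaussianLaw (h : IsGaussianFamily Z s μ) (i : ι) : HasGaussianLaw (Z i) μ where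
  isGaussian_map := by rw [h.law i]; infer_instance

theorem memLp (h : IsGaussianFamily Z s μ) (i : ι) : MemLp (Z i) 2 μ :=
  (h.hasGaussianLaw i).memLp_two

theorem integral_eq_zero (h : IsGaussianFamily Z s μ) (i : ι) : ∫ ω, Z i ω ∂μ = 0 := by
  have h1 := integral_map (μ := μ) (h.measurable i).aemeasurable
    (f := fun x : ℝ => x) (by fun_prop)
  rw [← h1, h.law i]
  exact integral_id_gaussianReal

theorem covariance (h : IsGaussianFamily Z s μ) [DecidableEq ι] (i j : ι) :
    cov[Z i, Z j; μ] = if i = j then s i else 0 := by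
  have := h.isProbabilityMeasure
  split_ifs with hij
  · subst hij
    rw [covariance_self (h.measurable i).aemeasurable]
    have h1 := variance_map (μ := μ) (X := fun x : ℝ => x) (Y := Z i) (by fun_prop)
      (h.measurable i).aemeasurable
    have h2 : Var[fun x : ℝ => x; μ.map (Z i)] = s i := by
      rw [h.law i, variance_fun_id_gaussianReal, Real.coe_toNNReal _ (h.nonneg i)]
    rw [← h2, h1]
    rfl
  · exact (h.indep.indepFun hij).covariance_eq_zero (h.memLp i) (h.memLp j)

end IsGaussianFamily

variable [Fintype ι]

/-- A linear combination of the random variables `Z i`. -/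
def lin (Z : ι → Ω → ℝ) (a : ι → ℝ) (ω : Ω) : ℝ := ∑ i, a i * Z i ω

/-- The covariance of two linear combinations of uncorrelated variables with variances `s i`. -/
def covOf (s a b : ι → ℝ) : ℝ := ∑ i, a i * b i * s i

namespace IsGaussianFamily

theorem hasGaussianLaw_pi (h : IsGaussianFamily Z s μ) : HasGaussianLaw (fun ω i => Z i ω) μ :=
  h.indep.hasGaussianLaw h.hasGaussianLaw

theorem measurable_lin (h : IsGaussianFamily Z s μ) (a : ι → ℝ) : Measurable (lin Z a) :=
  Finset.measurable_fun_sum _ fun i _ => (h.measurable i).const_mul _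

theorem memLp_lin (h : IsGaussianFamily Z s μ) (a : ι → ℝ) : MemLp (lin Z a) 2 μ :=
  memLp_finsetSum _ fun i _ => (h.memLp i).const_mul _

theorem integrable_lin (h : IsGaussianFamily Z s μ) (a : ι → ℝ) : Integrable (lin Z a) μ :=
  have := h.isProbabilityMeasure
  (h.memLp_lin a).integrable one_le_two

theorem integral_lin (h : IsGaussianFamily Z s μ) (a : ι → ℝ) : ∫ ω, lin Z a ω ∂μ = 0 := by
  have := h.isProbabilityMeasure
  unfold lin
  rw [integral_finsetSum _ fun i _ => ((h.memLp i).integrable one_le_two).const_mul _]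
  simp [integral_const_mul, h.integral_eq_zero]

theorem integrable_lin_mul_lin (h : IsGaussianFamily Z s μ) (a b : ι → ℝ) :
    Integrable (fun ω => lin Z a ω * lin Z b ω) μ :=
  (h.memLp_lin a).integrable_mul (h.memLp_lin b)

theorem covariance_lin (h : IsGaussianFamily Z s μ) (a b : ι → ℝ) :
    cov[lin Z a, lin Z b; μ] = covOf s a b := by
  classical
  have := h.isProbabilityMeasure
  unfold lin covOf
  rw [covariance_fun_sum_fun_sum (fun i => (h.memLp i).const_mul _)
    (fun i => (h.memLp i).const_mul _)]
  simp only [covariance_const_mul_left, covariance_const_mul_right, h.covariance]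
  refine Finset.sum_congr rfl fun i _ => ?_
  rw [Finset.sum_eq_single i]
  · simp; ring
  · intro j _ hj; simp [Ne.symm hj]
  · simp

theorem integral_lin_mul_lin (h : IsGaussianFamily Z s μ) (a b : ι → ℝ) :
    ∫ ω, lin Z a ω * lin Z b ω ∂μ = covOf s a b := by
  have := h.isProbabilityMeasure
  rw [← h.covariance_lin, covariance_eq_sub (h.memLp_lin a) (h.memLp_lin b), h.integral_lin]
  simp

/-- Uncorrelated linear combinations of a Gaussian family are independent. -/
theorem indepFun_lin (h : IsGaussianFamily Z s μ) {κ' κ : Type*} [Fintype κ'] [Fintype κ]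
    (a : κ' → ι → ℝ) (b : κ → ι → ℝ) (hab : ∀ l k, covOf s (a l) (b k) = 0) :
    IndepFun (fun ω l => lin Z (a l) ω) (fun ω k => lin Z (b k) ω) μ := by
  -- Both blocks together are a linear image of one Gaussian vector, so they are jointly Gaussian,
  -- and vanishing covariances suffice for independence. Degenerate variances do no harm.
  have hg : HasGaussianLaw
      (fun ω => (fun l : κ' => lin Z (a l) ω, fun k : κ => lin Z (b k) ω)) μ := by
    let L : (ι → ℝ) →L[ℝ] (κ' → ℝ) × (κ → ℝ) :=
      (ContinuousLinearMap.pi fun l => ∑ i, a l i • ContinuousLinearMap.proj i).prod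
        (ContinuousLinearMap.pi fun k => ∑ i, b k i • ContinuousLinearMap.proj i)
    have := h.hasGaussianLaw_pi.map_fun L
    convert! this using 2 with ω
    ext <;> simp [L, lin]
  exact hg.indepFun_of_covariance_eval fun l k => by
    have := h.covariance_lin (a l) (b k)
    rw [hab] at this
    exact this

/-- A function of linear combinations has constant conditional mean given a signal generated by
linear combinations that are uncorrelated with them. -/
theorem condExp_comp_eq_zero (h : IsGaussianFamily Z s μ) {κ' κ β : Type*} [Fintype κ']
    [Fintype κ] [MeasurableSpace β] (a : κ' → ι → ℝ) (b : κ → ι → ℝ) {R : Ω → ℝ}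
    {φ : (κ' → ℝ) → ℝ} (hφ : Measurable φ) (hR : R = fun ω => φ fun l => lin Z (a l) ω)
    {f : Ω → β} {g : (κ → ℝ) → β}
    (hg : Measurable g) (hfg : f = fun ω => g fun k => lin Z (b k) ω)
    (hab : ∀ l k, covOf s (a l) (b k) = 0) (h0 : ∫ ω, R ω ∂μ = 0) :
    condExp (sigmaOf f) μ R =ᵐ[μ] 0 := by
  have := h.isProbabilityMeasure
  have ha : Measurable fun ω l => lin Z (a l) ω := measurable_pi_lambda _ fun k =>
    h.measurable_lin _
  have hb : Measurable fun ω k => lin Z (b k) ω := measurable_pi_lambda _ fun k =>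
    h.measurable_lin _
  subst hfg hR
  exact condExp_eq_zero_of_indepFun (hφ.comp ha) (hg.comp hb)
    ((h.indepFun_lin a b hab).comp hφ hg) h0

/-- The conditional mean of a linear combination given a signal generated by other linear
combinations vanishes if it is uncorrelated with all of them. -/
theorem condExp_lin_eq_zero (h : IsGaussianFamily Z s μ) {κ β : Type*} [Fintype κ]
    [MeasurableSpace β] {a : ι → ℝ} (b : κ → ι → ℝ) {f : Ω → β} {g : (κ → ℝ) → β}
    (hg : Measurable g) (hfg : f = fun ω => g fun k => lin Z (b k) ω)
    (hab : ∀ k, covOf s a (b k) = 0) : condExp (sigmaOf f) μ (lin Z a) =ᵐ[μ] 0 := by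
  exact h.condExp_comp_eq_zero (fun _ : Unit => a) b (φ := fun x => x ()) (by fun_prop) rfl hg hfg
    (fun _ => hab) (h.integral_lin a)

/-- If an affine function of a Gaussian family vanishes almost surely, then so do its constant and
its covariances. -/
theorem eq_zero_of_ae_eq_zero (h : IsGaussianFamily Z s μ) {a : ι → ℝ} {k : ℝ}
    (h0 : ∀ᵐ ω ∂μ, lin Z a ω + k = 0) : k = 0 ∧ ∀ b, covOf s a b = 0 := by
  have := h.isProbabilityMeasure
  have hk : k = 0 := by
    have h1 : ∫ ω, (lin Z a ω + k) ∂μ = 0 := by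
      rw [integral_congr_ae (g := fun _ => 0) h0]; simp
    rw [integral_add (h.integrable_lin a) (integrable_const k), h.integral_lin] at h1
    simpa using h1
  refine ⟨hk, fun b => ?_⟩
  rw [← h.integral_lin_mul_lin, integral_congr_ae (g := fun _ => 0)]
  · simp
  · filter_upwards [h0] with ω hω
    rw [hk, add_zero] at hω
    rw [hω, zero_mul]

/-- Converse of `condExp_lin_eq_zero`: a combination recoverable from the signal is known, hence
orthogonal to anything with vanishing conditional mean. -/
theorem covOf_eq_zero_of_condExp (h : IsGaussianFamily Z s μ) {β : Type*}
    [MeasurableSpace β] {a b : ι → ℝ} {f : Ω → β} {g : β → ℝ} (hf : Measurable f)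
    (hg : Measurable g) (hfg : ∀ ω, g (f ω) = lin Z b ω)
    (h0 : condExp (sigmaOf f) μ (lin Z a) =ᵐ[μ] 0) : covOf s a b = 0 := by
  have := h.isProbabilityMeasure
  have hb : Measurable[sigmaOf f] (lin Z b) := by
    have : lin Z b = g ∘ f := funext fun ω => (hfg ω).symm
    rw [this]
    exact hg.comp (comap_measurable f)
  have h1 := integral_mul_eq_zero_of_condExp_eq_zero hf.comap_le hb (h.integrable_lin a)
    (h.integrable_lin_mul_lin b a) h0
  rw [h.integral_lin_mul_lin] at h1
  rw [← h1]
  exact Finset.sum_congr rfl fun i _ => by ring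

end IsGaussianFamily

end Gaussian

/-! ### Bilinearity of combinations and covariances -/

section Bilinear

variable {Ω : Type*} {ι : Type*} [Fintype ι]

theorem lin_add (Z : ι → Ω → ℝ) (a b : ι → ℝ) (ω : Ω) :
    lin Z (a + b) ω = lin Z a ω + lin Z b ω := by
  simp [lin, add_mul, Finset.sum_add_distrib]

theorem lin_sub (Z : ι → Ω → ℝ) (a b : ι → ℝ) (ω : Ω) :
    lin Z (a - b) ω = lin Z a ω - lin Z b ω := by
  simp [lin, sub_mul, Finset.sum_sub_distrib]

theorem lin_smul (Z : ι → Ω → ℝ) (k : ℝ) (a : ι → ℝ) (ω : Ω) :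
    lin Z (k • a) ω = k * lin Z a ω := by
  simp [lin, Finset.mul_sum, mul_assoc]

theorem covOf_comm (s a b : ι → ℝ) : covOf s a b = covOf s b a :=
  Finset.sum_congr rfl fun _ _ => by ring

theorem covOf_add_left (s a b c : ι → ℝ) : covOf s (a + b) c = covOf s a c + covOf s b c := by
  simp [covOf, add_mul, Finset.sum_add_distrib]

theorem covOf_sub_left (s a b c : ι → ℝ) : covOf s (a - b) c = covOf s a c - covOf s b c := by
  simp [covOf, sub_mul, Finset.sum_sub_distrib]

theorem covOf_smul_left (s : ι → ℝ) (k : ℝ) (a c : ι → ℝ) :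
    covOf s (k • a) c = k * covOf s a c := by
  simp [covOf, Finset.mul_sum, mul_assoc]

theorem covOf_add_right (s a b c : ι → ℝ) : covOf s c (a + b) = covOf s c a + covOf s c b := by
  simp only [covOf_comm s c, covOf_add_left]

theorem covOf_sub_right (s a b c : ι → ℝ) : covOf s c (a - b) = covOf s c a - covOf s c b := by
  simp only [covOf_comm s c, covOf_sub_left]

theorem covOf_smul_right (s : ι → ℝ) (k : ℝ) (a c : ι → ℝ) :
    covOf s c (k • a) = k * covOf s c a := by
  simp only [covOf_comm s c, covOf_smul_left]

end Bilinear

/-! ### The linear play in coordinates of the exogenous noise -/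

section Primitives

variable {M : Market} {J : ℕ} {σz : ℝ} {Ω : Type*} [MeasurableSpace Ω] {μ : Measure Ω}

/-- The centered exogenous randomness. -/
def Primitives.centered (X : Primitives M J σz μ) : Fin 5 ⊕ Fin J → Ω → ℝ :=
  Sum.elim ![fun ω => X.v ω - M.p0, X.z, X.u1, X.u1p, X.u2] X.ε

/-- The variances of the exogenous randomness. -/
def variances (M : Market) (J : ℕ) (σz : ℝ) : Fin 5 ⊕ Fin J → ℝ :=
  Sum.elim ![M.σv ^ 2, σz ^ 2, M.σ1 ^ 2, M.σ1p ^ 2, M.σ2 ^ 2] fun _ => M.σε ^ 2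

theorem Primitives.isGaussianFamily (X : Primitives M J σz μ) :
    IsGaussianFamily X.centered (variances M J σz) μ where
  measurable := by
    rintro (i | j)
    · fin_cases i
      exacts [X.measurable_v.sub_const _, X.measurable_z, X.measurable_u1, X.measurable_u1p,
        X.measurable_u2]
    · exact X.measurable_ε j
  nonneg := by
    rintro (i | j)
    · fin_cases i <;> simp [variances] <;> positivity
    · simp [variances]; positivity
  law := by
    rintro (i | j)
    · fin_cases i
      · have h1 : μ.map (fun ω => X.v ω - M.p0) = (μ.map X.v).map (fun x => x - M.p0) :=
          (Measure.map_map (g := fun x : ℝ => x - M.p0) (by fun_prop) X.measurable_v).symm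
        have h2 := gaussianReal_map_sub_const (μ := M.p0) (v := (M.σv ^ 2).toNNReal) M.p0
        rw [sub_self] at h2
        simpa [Primitives.centered, variances, X.law_v, h2] using h1
      exacts [X.law_z, X.law_u1, X.law_u1p, X.law_u2]
    · exact X.law_ε j
  indep := by
    have h := X.indep.comp
      (g := Sum.elim ![fun x : ℝ => x - M.p0, id, id, id, id] fun _ => id) (by
        rintro (i | j)
        · fin_cases i
          · exact measurable_id.sub_const _
          all_goals exact measurable_id
        · exact measurable_id)
    convert! h using 1
    funext i
    rcases i with (i | j)
    · fin_cases i <;> rfl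
    · rfl

theorem Primitives.isProbabilityMeasure (X : Primitives M J σz μ) : IsProbabilityMeasure μ :=
  X.isGaussianFamily.isProbabilityMeasure

/-- The coefficients of a linear combination of the exogenous randomness. -/
abbrev coef (a b c d e : ℝ) (f : Fin J → ℝ) : Fin 5 ⊕ Fin J → ℝ := Sum.elim ![a, b, c, d, e] f

theorem Primitives.lin_coef (X : Primitives M J σz μ) (a b c d e : ℝ) (f : Fin J → ℝ) (ω : Ω) :
    lin X.centered (coef a b c d e f) ω =
      a * (X.v ω - M.p0) + b * X.z ω + c * X.u1 ω + d * X.u1p ω + e * X.u2 ω +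
        ∑ j, f j * X.ε j ω := by
  simp [lin, Primitives.centered, Fin.sum_univ_five]

theorem covOf_coef (a b c d e a' b' c' d' e' : ℝ) (f f' : Fin J → ℝ) :
    covOf (variances M J σz) (coef a b c d e f) (coef a' b' c' d' e' f') =
      a * a' * M.σv ^ 2 + b * b' * σz ^ 2 + c * c' * M.σ1 ^ 2 + d * d' * M.σ1p ^ 2 +
        e * e' * M.σ2 ^ 2 + ∑ j, f j * f' j * M.σε ^ 2 := by
  simp [covOf, variances, Fin.sum_univ_five]

/-! The linear play. -/

/-- The variance of the first order flow when the informed trader has intensity `α`. -/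
def flowVar (M : Market) (σz α : ℝ) : ℝ := α ^ 2 * M.σv ^ 2 + σz ^ 2 + M.σ1 ^ 2

/-- The regression coefficient of `v` on the first order flow. -/
def slopeV (M : Market) (σz α : ℝ) : ℝ := α * M.σv ^ 2 / flowVar M σz α

/-- The regression coefficient of the first informed order on the first order flow. -/
def slopeI (M : Market) (σz α : ℝ) : ℝ := (α ^ 2 * M.σv ^ 2 + σz ^ 2) / flowVar M σz α

theorem flowVar_pos (M : Market) (σz α : ℝ) : 0 < flowVar M σz α := by
  have := M.σ1_pos
  unfold flowVar; positivity

/-- The linear profile in which the conditional means given `y₁` are the linear regressions. -/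
def regressionProfile (M : Market) (J : ℕ) (σz : ℝ) (c : Coeffs) : Profile J :=
  linearProfile M c (fun y => M.p0 + slopeV M σz c.α1 * y) (fun y => slopeI M σz c.α1 * y)
    fun _ y => slopeI M σz c.α1 * y

/-- The first order flow. -/
def vecY1 (J : ℕ) (α : ℝ) : Fin 5 ⊕ Fin J → ℝ := coef α 1 1 0 0 0

/-- The value of the asset net of its conditional mean given the first order flow. -/
def vecW (M : Market) (J : ℕ) (σz α : ℝ) : Fin 5 ⊕ Fin J → ℝ :=
  coef (1 - slopeV M σz α * α) (-slopeV M σz α) (-slopeV M σz α) 0 0 0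

/-- The first informed order net of its conditional mean given the first order flow. -/
def vecD (M : Market) (J : ℕ) (σz α : ℝ) : Fin 5 ⊕ Fin J → ℝ :=
  coef ((1 - slopeI M σz α) * α) (1 - slopeI M σz α) (-slopeI M σz α) 0 0 0

def vecU1p (J : ℕ) : Fin 5 ⊕ Fin J → ℝ := coef 0 0 0 1 0 0
def vecU2 (J : ℕ) : Fin 5 ⊕ Fin J → ℝ := coef 0 0 0 0 1 0

/-- The sum of the signal errors. -/
def vecE (J : ℕ) : Fin 5 ⊕ Fin J → ℝ := coef 0 0 0 0 0 1

/-- A single signal error. -/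
def vecEps {J : ℕ} (j : Fin J) : Fin 5 ⊕ Fin J → ℝ := coef 0 0 0 0 0 (Pi.single j 1)

/-- The signal errors reach the two later flows only through their sum `vecE`. The terms of `vecY2`
with `β12` are the high-frequency traders' reversed orders. No component along the first flow is
left. -/
def vecY1p (M : Market) (J : ℕ) (σz α b : ℝ) : Fin 5 ⊕ Fin J → ℝ :=
  (b * J) • vecD M J σz α + b • vecE J + vecU1p J

def vecY2 (M : Market) (J : ℕ) (σz : ℝ) (c : Coeffs) : Fin 5 ⊕ Fin J → ℝ :=
  c.α21 • vecW M J σz c.α1 + (c.α22 - c.β12 * J) • vecD M J σz c.α1 - c.β12 • vecE J + vecU2 J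

section Cov

variable (M J σz) (α : ℝ)

theorem cov_Y1_Y1 : covOf (variances M J σz) (vecY1 J α) (vecY1 J α) = flowVar M σz α := by
  simp only [vecY1, covOf_coef, flowVar, Pi.zero_apply, zero_mul, mul_zero, Finset.sum_const_zero,
    add_zero]
  ring

theorem cov_W_Y1 : covOf (variances M J σz) (vecW M J σz α) (vecY1 J α) = 0 := by
  have := (flowVar_pos M σz α).ne'
  simp only [vecW, vecY1, covOf_coef, slopeV, Pi.zero_apply, zero_mul, mul_zero,
    Finset.sum_const_zero, add_zero]
  field_simp
  simp only [flowVar]; ring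

theorem cov_D_Y1 : covOf (variances M J σz) (vecD M J σz α) (vecY1 J α) = 0 := by
  have := (flowVar_pos M σz α).ne'
  simp only [vecD, vecY1, covOf_coef, slopeI, Pi.zero_apply, zero_mul, mul_zero,
    Finset.sum_const_zero, add_zero]
  field_simp
  simp only [flowVar]; ring

theorem cov_W_W : covOf (variances M J σz) (vecW M J σz α) (vecW M J σz α) =
    M.σv ^ 2 * (σz ^ 2 + M.σ1 ^ 2) / flowVar M σz α := by
  have := (flowVar_pos M σz α).ne'
  simp only [vecW, covOf_coef, slopeV, Pi.zero_apply, zero_mul, mul_zero,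
    Finset.sum_const_zero, add_zero]
  field_simp
  simp only [flowVar]; ring

theorem cov_W_D : covOf (variances M J σz) (vecW M J σz α) (vecD M J σz α) =
    α * M.σv ^ 2 * M.σ1 ^ 2 / flowVar M σz α := by
  have := (flowVar_pos M σz α).ne'
  simp only [vecW, vecD, covOf_coef, slopeV, slopeI, Pi.zero_apply, zero_mul, mul_zero,
    Finset.sum_const_zero, add_zero]
  field_simp
  simp only [flowVar]; ring

theorem cov_D_D : covOf (variances M J σz) (vecD M J σz α) (vecD M J σz α) =
    (α ^ 2 * M.σv ^ 2 + σz ^ 2) * M.σ1 ^ 2 / flowVar M σz α := by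
  have := (flowVar_pos M σz α).ne'
  simp only [vecD, covOf_coef, slopeI, Pi.zero_apply, zero_mul, mul_zero,
    Finset.sum_const_zero, add_zero]
  field_simp
  simp only [flowVar]; ring

theorem cov_E_E : covOf (variances M J σz) (vecE J) (vecE J) = J * M.σε ^ 2 := by
  simp [vecE, covOf_coef]

theorem cov_E_Eps (j : Fin J) :
    covOf (variances M J σz) (vecE J) (vecEps j) = M.σε ^ 2 := by
  simp [vecE, vecEps, covOf_coef, ← Finset.sum_mul]

theorem cov_Eps_Eps (j : Fin J) :
    covOf (variances M J σz) (vecEps j) (vecEps j) = M.σε ^ 2 := by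
  simp [vecEps, covOf_coef, Pi.single_apply]

theorem cov_U1p_U1p : covOf (variances M J σz) (vecU1p J) (vecU1p J) = M.σ1p ^ 2 := by
  simp [vecU1p, covOf_coef]

theorem cov_U2_U2 : covOf (variances M J σz) (vecU2 J) (vecU2 J) = M.σ2 ^ 2 := by
  simp [vecU2, covOf_coef]

theorem cov_E_Y1 : covOf (variances M J σz) (vecE J) (vecY1 J α) = 0 := by
  simp [vecE, vecY1, covOf_coef]

theorem cov_Eps_Y1 (j : Fin J) : covOf (variances M J σz) (vecEps j) (vecY1 J α) = 0 := by
  simp [vecEps, vecY1, covOf_coef]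

theorem cov_U1p_Y1 : covOf (variances M J σz) (vecU1p J) (vecY1 J α) = 0 := by
  simp [vecU1p, vecY1, covOf_coef]

theorem cov_U2_Y1 : covOf (variances M J σz) (vecU2 J) (vecY1 J α) = 0 := by
  simp [vecU2, vecY1, covOf_coef]

theorem cov_W_E : covOf (variances M J σz) (vecW M J σz α) (vecE J) = 0 := by
  simp [vecE, vecW, covOf_coef]

theorem cov_W_Eps (j : Fin J) : covOf (variances M J σz) (vecW M J σz α) (vecEps j) = 0 := by
  simp [vecEps, vecW, covOf_coef]

theorem cov_W_U1p : covOf (variances M J σz) (vecW M J σz α) (vecU1p J) = 0 := by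
  simp [vecU1p, vecW, covOf_coef]

theorem cov_W_U2 : covOf (variances M J σz) (vecW M J σz α) (vecU2 J) = 0 := by
  simp [vecU2, vecW, covOf_coef]

theorem cov_D_E : covOf (variances M J σz) (vecD M J σz α) (vecE J) = 0 := by
  simp [vecE, vecD, covOf_coef]

theorem cov_D_Eps (j : Fin J) : covOf (variances M J σz) (vecD M J σz α) (vecEps j) = 0 := by
  simp [vecEps, vecD, covOf_coef]

theorem cov_D_U1p : covOf (variances M J σz) (vecD M J σz α) (vecU1p J) = 0 := by
  simp [vecU1p, vecD, covOf_coef]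

theorem cov_D_U2 : covOf (variances M J σz) (vecD M J σz α) (vecU2 J) = 0 := by
  simp [vecU2, vecD, covOf_coef]

theorem cov_E_U1p : covOf (variances M J σz) (vecE J) (vecU1p J) = 0 := by
  simp [vecU1p, vecE, covOf_coef]

theorem cov_E_U2 : covOf (variances M J σz) (vecE J) (vecU2 J) = 0 := by
  simp [vecU2, vecE, covOf_coef]

theorem cov_U1p_Eps (j : Fin J) : covOf (variances M J σz) (vecU1p J) (vecEps j) = 0 := by
  simp [vecU1p, vecEps, covOf_coef]

theorem cov_U2_Eps (j : Fin J) : covOf (variances M J σz) (vecU2 J) (vecEps j) = 0 := by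
  simp [vecU2, vecEps, covOf_coef]

theorem cov_U1p_U2 : covOf (variances M J σz) (vecU1p J) (vecU2 J) = 0 := by
  simp [vecU1p, vecU2, covOf_coef]

end Cov

variable (X : Primitives M J σz μ) (c : Coeffs)

theorem I1_regressionProfile (ω : Ω) :
    I1 X (regressionProfile M J σz c) ω = c.α1 * (X.v ω - M.p0) + X.z ω := rfl

theorem lin_vecY1 (ω : Ω) :
    lin X.centered (vecY1 J c.α1) ω = Y1 X (regressionProfile M J σz c) ω := by
  simp only [vecY1, X.lin_coef, Y1, I1_regressionProfile]; simp

theorem lin_vecW (ω : Ω) : lin X.centered (vecW M J σz c.α1) ω =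
    X.v ω - M.p0 - slopeV M σz c.α1 * Y1 X (regressionProfile M J σz c) ω := by
  simp only [vecW, X.lin_coef, Y1, I1_regressionProfile]; simp; ring

theorem lin_vecD (ω : Ω) : lin X.centered (vecD M J σz c.α1) ω =
    I1 X (regressionProfile M J σz c) ω -
      slopeI M σz c.α1 * Y1 X (regressionProfile M J σz c) ω := by
  simp only [vecD, X.lin_coef, Y1, I1_regressionProfile]; simp; ring

theorem lin_vecE (ω : Ω) : lin X.centered (vecE J) ω = ∑ j, X.ε j ω := by
  simp only [vecE, X.lin_coef]; simp

theorem lin_vecEps (j : Fin J) (ω : Ω) : lin X.centered (vecEps j) ω = X.ε j ω := by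
  simp only [vecEps, X.lin_coef]; simp [Pi.single_apply]

theorem lin_vecU1p (ω : Ω) : lin X.centered (vecU1p J) ω = X.u1p ω := by
  simp only [vecU1p, X.lin_coef]; simp

theorem lin_vecU2 (ω : Ω) : lin X.centered (vecU2 J) ω = X.u2 ω := by
  simp only [vecU2, X.lin_coef]; simp

theorem X1_regressionProfile (j : Fin J) (ω : Ω) : X1 X (regressionProfile M J σz c) j ω =
    c.β12 * lin X.centered (vecD M J σz c.α1 + vecEps j) ω := by
  rw [lin_add, lin_vecD, lin_vecEps]
  simp only [X1, Sig, regressionProfile, linearProfile]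
  ring

theorem lin_vecY1p (ω : Ω) : lin X.centered (vecY1p M J σz c.α1 c.β12) ω =
    Y1p X (regressionProfile M J σz c) ω := by
  simp only [Y1p, X1_regressionProfile, vecY1p, lin_add, lin_smul, lin_vecE, lin_vecEps,
    lin_vecU1p, ← Finset.mul_sum, Finset.sum_add_distrib]
  simp
  ring

theorem I2_regressionProfile (ω : Ω) : I2 X (regressionProfile M J σz c) ω =
    lin X.centered (c.α21 • vecW M J σz c.α1 + c.α22 • vecD M J σz c.α1) ω := by
  rw [lin_add, lin_smul, lin_smul, lin_vecD, lin_vecW]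
  simp only [I2, regressionProfile, linearProfile]
  ring

theorem lin_vecY2 (ω : Ω) : lin X.centered (vecY2 M J σz c) ω =
    Y2 X (regressionProfile M J σz c) ω := by
  have h : ∀ j, X2 X (regressionProfile M J σz c) j ω =
      -X1 X (regressionProfile M J σz c) j ω := fun j => rfl
  simp only [Y2, I2_regressionProfile, h, X1_regressionProfile, vecY2, lin_add, lin_sub, lin_smul,
    lin_vecE, lin_vecEps, lin_vecU2, ← Finset.mul_sum, Finset.sum_add_distrib,
    Finset.sum_neg_distrib]
  simp
  ring

end Primitives

/-! ### Beliefs as regressions, and the dealers' prices -/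

section Beliefs

variable {M : Market} {J : ℕ} {σz : ℝ} {Ω : Type*} [MeasurableSpace Ω] {μ : Measure Ω}

/-- A predictor that depends measurably on the signal is the conditional mean if and only if its
error is uncorrelated with every component of the signal. -/
theorem IsGaussianFamily.eq_condExp_iff {ι : Type*} [Fintype ι] {Z : ι → Ω → ℝ} {s : ι → ℝ}
    (h : IsGaussianFamily Z s μ) {κ β : Type*} [Fintype κ] [MeasurableSpace β] {F P : Ω → ℝ}
    {a : ι → ℝ} (b : κ → ι → ℝ) {f : Ω → β} (hf : Measurable f) {p : β → ℝ}
    (hp : Measurable p) (hpf : ∀ ω, P ω = p (f ω)) (hF : Integrable F μ)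
    (ha : ∀ ω, F ω - P ω = lin Z a ω) {G : (κ → ℝ) → β} (hG : Measurable G)
    (hGf : f = fun ω => G fun k => lin Z (b k) ω) {g : κ → β → ℝ} (hg : ∀ k, Measurable (g k))
    (hgf : ∀ k ω, g k (f ω) = lin Z (b k) ω) :
    P =ᵐ[μ] condExp (sigmaOf f) μ F ↔ ∀ k, covOf s a (b k) = 0 := by
  have := h.isProbabilityMeasure
  have hP : Measurable[sigmaOf f] P := by
    rw [show P = p ∘ f from funext hpf]
    exact hp.comp (comap_measurable f)
  have hPi : Integrable P μ := by
    have := hF.sub (h.integrable_lin a)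
    refine this.congr (ae_of_all _ fun ω => ?_)
    have := ha ω
    simp only [Pi.sub_apply]
    linarith
  have h1 : condExp (sigmaOf f) μ (lin Z a) =ᵐ[μ] condExp (sigmaOf f) μ F - P := by
    have h2 : lin Z a = F - P := funext fun ω => (ha ω).symm
    rw [h2]
    refine (condExp_sub hF hPi _).trans ?_
    rw [condExp_of_stronglyMeasurable hf.comap_le hP.stronglyMeasurable hPi]
  constructor
  · intro hPF k
    refine h.covOf_eq_zero_of_condExp hf (hg k) (hgf k) (h1.trans ?_)
    filter_upwards [hPF] with ω hω
    simp [hω]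
  · intro hcov
    have h2 := h.condExp_lin_eq_zero b hG hGf hcov
    filter_upwards [h1, h2] with ω h3 h4
    rw [h4] at h3
    simp only [Pi.sub_apply, Pi.zero_apply] at h3
    linarith

variable (X : Primitives M J σz μ) (c : Coeffs)

theorem Primitives.integrable_v : Integrable X.v μ := by
  have := X.isProbabilityMeasure
  have h := (X.isGaussianFamily.integrable_lin (coef 1 0 0 0 0 0)).add (integrable_const M.p0)
  refine h.congr (ae_of_all _ fun ω => ?_)
  simp only [Pi.add_apply, X.lin_coef]
  simp

theorem Primitives.memLp_v : MemLp X.v 2 μ := by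
  have := X.isProbabilityMeasure
  have h := (X.isGaussianFamily.memLp_lin (coef 1 0 0 0 0 0)).add (memLp_const M.p0)
  refine h.ae_eq (ae_of_all _ fun ω => ?_)
  simp only [Pi.add_apply, X.lin_coef]
  simp

theorem measurable_Y1 : Measurable (Y1 X (regressionProfile M J σz c)) := by
  rw [← funext (lin_vecY1 X c)]
  exact X.isGaussianFamily.measurable_lin _

theorem measurable_Y1p : Measurable (Y1p X (regressionProfile M J σz c)) := by
  rw [← funext (lin_vecY1p X c)]
  exact X.isGaussianFamily.measurable_lin _

theorem measurable_Y2 : Measurable (Y2 X (regressionProfile M J σz c)) := by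
  rw [← funext (lin_vecY2 X c)]
  exact X.isGaussianFamily.measurable_lin _

theorem regression_eq_condExp {F : Ω → ℝ} {k r : ℝ} {a : Fin 5 ⊕ Fin J → ℝ} (hF : Integrable F μ)
    (ha : ∀ ω, F ω - (k + r * Y1 X (regressionProfile M J σz c) ω) = lin X.centered a ω)
    (hcov : covOf (variances M J σz) a (vecY1 J c.α1) = 0) :
    (fun ω => k + r * Y1 X (regressionProfile M J σz c) ω) =ᵐ[μ]
      condExp (sigmaOf (Y1 X (regressionProfile M J σz c))) μ F :=
  (X.isGaussianFamily.eq_condExp_iff (fun _ : Fin 1 => vecY1 J c.α1) (measurable_Y1 X c)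
    (p := fun y => k + r * y) (by fun_prop) (fun _ => rfl) hF ha (G := fun x => x 0) (by fun_prop)
    (by simp only [lin_vecY1]) (g := fun _ => id) (fun _ => measurable_id)
    (fun _ ω => (lin_vecY1 X c ω).symm)).2 fun _ => hcov

theorem isBelief_regressionProfile :
    IsBelief X (regressionProfile M J σz c) (fun y => M.p0 + slopeV M σz c.α1 * y)
      (fun y => slopeI M σz c.α1 * y) fun _ y => slopeI M σz c.α1 * y where
  continuous_ev := by fun_prop
  continuous_ei := by fun_prop
  continuous_es _ := by fun_prop
  ev_eq := by
    refine regression_eq_condExp X c (a := vecW M J σz c.α1) X.integrable_v (fun ω => ?_)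
      (cov_W_Y1 M J σz _)
    rw [lin_vecW]; ring
  ei_eq := by
    have h := regression_eq_condExp X c (k := 0) (r := slopeI M σz c.α1)
      (F := I1 X (regressionProfile M J σz c)) (a := vecD M J σz c.α1) ?_ (fun ω => ?_)
      (cov_D_Y1 M J σz _)
    · simpa using h
    · refine (X.isGaussianFamily.integrable_lin (coef c.α1 1 0 0 0 0)).congr
        (ae_of_all _ fun ω => ?_)
      simp only [X.lin_coef, I1_regressionProfile]
      simp
    · rw [lin_vecD]; ring
  es_eq j := by
    have h := regression_eq_condExp X c (k := 0) (r := slopeI M σz c.α1)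
      (F := Sig X (regressionProfile M J σz c) j) (a := vecD M J σz c.α1 + vecEps j) ?_
      (fun ω => ?_) ?_
    · simpa using h
    · refine (X.isGaussianFamily.integrable_lin (coef c.α1 1 0 0 0 0 + vecEps j)).congr
        (ae_of_all _ fun ω => ?_)
      simp only [lin_add, X.lin_coef, Sig, I1_regressionProfile, lin_vecEps]
      simp
    · rw [lin_add, lin_vecD, lin_vecEps, Sig]; ring
    · rw [covOf_add_left, cov_D_Y1, cov_Eps_Y1, add_zero]

/-- Continuous functions of the first order flow that agree almost surely are equal. -/
theorem continuous_eq_of_ae_Y1 {g g' : ℝ → ℝ} (hg : Continuous g) (hg' : Continuous g')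
    (h : (fun ω => g (Y1 X (regressionProfile M J σz c) ω)) =ᵐ[μ]
      fun ω => g' (Y1 X (regressionProfile M J σz c) ω)) : g = g' := by
  have hG := X.isGaussianFamily
  have hlaw : HasGaussianLaw (lin X.centered (vecY1 J c.α1)) μ := by
    let L : (Fin 5 ⊕ Fin J → ℝ) →L[ℝ] ℝ := ∑ i, vecY1 J c.α1 i • ContinuousLinearMap.proj i
    have := hG.hasGaussianLaw_pi.map_fun L
    convert! this using 2 with ω
    simp [L, lin]
  have hmap := hlaw.map_eq_gaussianReal
  have hvar : Var[lin X.centered (vecY1 J c.α1); μ] = flowVar M σz c.α1 := by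
    rw [← covariance_self (hG.measurable_lin _).aemeasurable, hG.covariance_lin, cov_Y1_Y1]
  rw [hvar] at hmap
  have hv : (flowVar M σz c.α1).toNNReal ≠ 0 := by
    simpa using flowVar_pos M σz c.α1
  -- The first flow has positive variance because of `u1`, so its law charges every nonempty open
  -- set and almost sure equality of continuous functions is equality.
  have hpos : (μ.map (lin X.centered (vecY1 J c.α1))).IsOpenPosMeasure := by
    rw [hmap]
    exact (gaussianReal_absolutelyContinuous' _ hv).isOpenPosMeasure
  have h1 : g =ᵐ[μ.map (lin X.centered (vecY1 J c.α1))] g' := by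
    rw [Filter.EventuallyEq, ae_map_iff (hG.measurable_lin _).aemeasurable
      (measurableSet_eq_fun hg.measurable hg'.measurable)]
    simp only [lin_vecY1]
    exact h
  exact (Continuous.ae_eq_iff_eq _ hg hg').1 h1

/-- The first order flow does not depend on the beliefs, so both sets of beliefs represent the same
conditional means of the same variable; continuous representatives are unique. This removes the
existential quantifier over beliefs. -/
theorem IsBelief.linearProfile_eq {ev ei : ℝ → ℝ} {es : Fin J → ℝ → ℝ}
    (h : IsBelief X (linearProfile M c ev ei es) ev ei es) :
    linearProfile M c ev ei es = regressionProfile M J σz c := by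
  have h0 := isBelief_regressionProfile X c
  have h1 : ev = fun y => M.p0 + slopeV M σz c.α1 * y :=
    continuous_eq_of_ae_Y1 X c h.continuous_ev h0.continuous_ev (h.ev_eq.trans h0.ev_eq.symm)
  have h2 : ei = fun y => slopeI M σz c.α1 * y :=
    continuous_eq_of_ae_Y1 X c h.continuous_ei h0.continuous_ei (h.ei_eq.trans h0.ei_eq.symm)
  have h3 : es = fun _ y => slopeI M σz c.α1 * y := funext fun j =>
    continuous_eq_of_ae_Y1 X c (h.continuous_es j) (h0.continuous_es j)
      ((h.es_eq j).trans (h0.es_eq j).symm)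
  rw [h1, h2, h3]
  rfl

theorem isMixedLinear_iff :
    IsMixedLinear X c ↔ IsMixedEquilibrium X (fun _ => ∞) (regressionProfile M J σz c) := by
  constructor
  · rintro ⟨ev, ei, es, hb, he⟩
    rwa [hb.linearProfile_eq] at he
  · exact fun h => ⟨_, _, _, isBelief_regressionProfile X c, h⟩

theorem isPureLinear_iff :
    IsPureLinear X c ↔ IsPureEquilibrium X (fun _ => ∞) (regressionProfile M J σz c) := by
  constructor
  · rintro ⟨ev, ei, es, hb, he⟩
    rwa [hb.linearProfile_eq] at he
  · exact fun h => ⟨_, _, _, isBelief_regressionProfile X c, h⟩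

/-- Weak-efficiency pricing in terms of covariances of the order flows. -/
theorem dealersEfficient_iff :
    DealersEfficient X (regressionProfile M J σz c) ↔
      slopeV M σz c.α1 = c.l1 ∧
      covOf (variances M J σz) (vecW M J σz c.α1 - c.l1p • vecY1p M J σz c.α1 c.β12)
        (vecY1p M J σz c.α1 c.β12) = 0 ∧
      covOf (variances M J σz) (vecW M J σz c.α1 - c.l21 • vecY1p M J σz c.α1 c.β12 -
        c.l22 • vecY2 M J σz c) (vecY1p M J σz c.α1 c.β12) = 0 ∧
      covOf (variances M J σz) (vecW M J σz c.α1 - c.l21 • vecY1p M J σz c.α1 c.β12 -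
        c.l22 • vecY2 M J σz c) (vecY2 M J σz c) = 0 := by
  have hG := X.isGaussianFamily
  have hY1 := measurable_Y1 X c
  have hY1p := measurable_Y1p X c
  have hY2 := measurable_Y2 X c
  have e1 := hG.eq_condExp_iff (F := X.v) (P := Price1 X (regressionProfile M J σz c))
    (a := vecW M J σz c.α1 + (slopeV M σz c.α1 - c.l1) • vecY1 J c.α1)
    (fun _ : Fin 1 => vecY1 J c.α1) hY1
    (p := fun y => M.p0 + c.l1 * y) (by fun_prop) (fun _ => rfl) X.integrable_v
    (fun ω => by
      simp only [lin_add, lin_smul, lin_vecW, lin_vecY1, Price1, regressionProfile, linearProfile]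
      ring)
    (G := fun x => x 0) (by fun_prop) (by simp only [lin_vecY1]) (g := fun _ => id)
    (fun _ => measurable_id) (fun _ ω => (lin_vecY1 X c ω).symm)
  have e2 := hG.eq_condExp_iff (F := X.v) (P := Price1p X (regressionProfile M J σz c))
    (a := vecW M J σz c.α1 + (slopeV M σz c.α1 - c.l1) • vecY1 J c.α1 -
      c.l1p • vecY1p M J σz c.α1 c.β12)
    ![vecY1 J c.α1, vecY1p M J σz c.α1 c.β12] (hY1.prodMk hY1p)
    (p := fun y => M.p0 + c.l1 * y.1 + c.l1p * y.2) (by fun_prop) (fun _ => rfl) X.integrable_v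
    (fun ω => by
      simp only [lin_add, lin_sub, lin_smul, lin_vecW, lin_vecY1, lin_vecY1p, Price1p,
        regressionProfile, linearProfile]
      ring)
    (G := fun x => (x 0, x 1)) (by fun_prop) (by simp [lin_vecY1, lin_vecY1p])
    (g := ![Prod.fst, Prod.snd])
    (by rw [Fin.forall_fin_two]; exact ⟨measurable_fst, measurable_snd⟩)
    (by simp [Fin.forall_fin_two, lin_vecY1, lin_vecY1p])
  have e3 := hG.eq_condExp_iff (F := X.v) (P := Price2 X (regressionProfile M J σz c))
    (a := vecW M J σz c.α1 + (slopeV M σz c.α1 - c.l1) • vecY1 J c.α1 -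
      c.l21 • vecY1p M J σz c.α1 c.β12 - c.l22 • vecY2 M J σz c)
    ![vecY1 J c.α1, vecY1p M J σz c.α1 c.β12, vecY2 M J σz c] (hY1.prodMk (hY1p.prodMk hY2))
    (p := fun y => M.p0 + c.l1 * y.1 + c.l21 * y.2.1 + c.l22 * y.2.2) (by fun_prop)
    (fun _ => rfl) X.integrable_v
    (fun ω => by
      simp only [lin_add, lin_sub, lin_smul, lin_vecW, lin_vecY1, lin_vecY1p, lin_vecY2, Price2,
        regressionProfile, linearProfile]
      ring)
    (G := fun x => (x 0, x 1, x 2)) (by fun_prop) (by simp [lin_vecY1, lin_vecY1p, lin_vecY2])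
    (g := ![Prod.fst, fun y => y.2.1, fun y => y.2.2])
    (by
      intro k
      fin_cases k
      exacts [measurable_fst, measurable_snd.fst, measurable_snd.snd])
    (by
      intro k ω
      fin_cases k <;> simp [lin_vecY1, lin_vecY1p, lin_vecY2])
  -- Since W and both later flows are uncorrelated with `y₁`, orthogonality of the pricing errors to
  -- `y₁` says only that `l1` is the regression slope.
  have h1p : covOf (variances M J σz) (vecY1p M J σz c.α1 c.β12) (vecY1 J c.α1) = 0 := by
    simp only [vecY1p, covOf_add_left, covOf_smul_left, cov_D_Y1, cov_E_Y1, cov_U1p_Y1]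
    ring
  have h2 : covOf (variances M J σz) (vecY2 M J σz c) (vecY1 J c.α1) = 0 := by
    simp only [vecY2, covOf_add_left, covOf_sub_left, covOf_smul_left, cov_D_Y1, cov_W_Y1,
      cov_E_Y1, cov_U2_Y1]
    ring
  have hS := (flowVar_pos M σz c.α1).ne'
  have h1 : covOf (variances M J σz)
      (vecW M J σz c.α1 + (slopeV M σz c.α1 - c.l1) • vecY1 J c.α1) (vecY1 J c.α1) = 0 ↔
      slopeV M σz c.α1 = c.l1 := by
    rw [covOf_add_left, covOf_smul_left, cov_W_Y1, cov_Y1_Y1, zero_add, mul_eq_zero, sub_eq_zero]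
    simp [hS]
  have hd : DealersEfficient X (regressionProfile M J σz c) ↔ _ ∧ _ ∧ _ :=
    ⟨fun h => ⟨h.price1, h.price1p, h.price2⟩, fun h => ⟨h.1, h.2.1, h.2.2⟩⟩
  rw [hd]
  rw [e1, e2, e3]
  simp only [forall_const, Fin.forall_fin_succ, IsEmpty.forall_iff, and_true,
    Matrix.cons_val_zero, Matrix.cons_val_succ, h1]
  constructor
  · rintro ⟨hs, ⟨-, h5⟩, -, h6, h7⟩
    rw [hs, sub_self, zero_smul, add_zero] at h5 h6 h7
    exact ⟨hs, h5, h6, h7⟩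
  · rintro ⟨hs, h5, h6, h7⟩
    rw [hs, sub_self, zero_smul, add_zero]
    refine ⟨rfl, ⟨?_, h5⟩, ?_, h6, h7⟩
    · rw [covOf_sub_left, covOf_smul_left, cov_W_Y1, h1p]; ring
    · rw [covOf_sub_left, covOf_sub_left, covOf_smul_left, covOf_smul_left, cov_W_Y1, h1p, h2]
      ring

end Beliefs

/-! ### The informed trader's second order -/

section InformedTrader

variable {M : Market} {J : ℕ} {σz : ℝ} {Ω : Type*} [MeasurableSpace Ω] {μ : Measure Ω}
variable (X : Primitives M J σz μ) (c : Coeffs)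

/-- A deviation of the informed trader. -/
def itDeviation (P : Profile J) (ι : ℝ → ℝ → ℝ) (κ : ℝ → ℝ → ℝ → ℝ) : Profile J :=
  { P with i1 := ι, i2 := κ }

/-- The expected edge of the informed trader's second order before its own price impact, as a
function of `(v, i₁, y₁)`. -/
def edge (M : Market) (J : ℕ) (σz : ℝ) (c : Coeffs) (t : ℝ × ℝ × ℝ) : ℝ :=
  t.1 - M.p0 - c.l1 * t.2.2 -
    (c.l21 - c.l22) * c.β12 * J * (t.2.1 - slopeI M σz c.α1 * t.2.2)

theorem measurable_edge : Measurable (edge M J σz c) := by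
  unfold edge; fun_prop

/-- The noise in the second price that the informed trader cannot predict. -/
def vecN (J : ℕ) (c : Coeffs) : Fin 5 ⊕ Fin J → ℝ :=
  ((c.l21 - c.l22) * c.β12) • vecE J + c.l21 • vecU1p J + c.l22 • vecU2 J

variable {ι : ℝ → ℝ → ℝ} {κ : ℝ → ℝ → ℝ → ℝ}

theorem I1_itDeviation (P : Profile J) (ω : Ω) :
    I1 X (itDeviation P ι κ) ω = ι (X.v ω) (X.z ω) := rfl

theorem I2_itDeviation (P : Profile J) (ω : Ω) :
    I2 X (itDeviation P ι κ) ω =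
      κ (X.v ω) (ι (X.v ω) (X.z ω)) (ι (X.v ω) (X.z ω) + X.u1 ω) := rfl

/-- The round-trippers' orders enter the price at rate `l21` when opened and `-l22` when reversed,
for any first order played. Apart from the trader's own impact, what she does not know is a fixed
combination of signal errors and later noise orders. -/
theorem value_sub_price2_itDeviation (ω : Ω) :
    X.v ω - Price2 X (itDeviation (regressionProfile M J σz c) ι κ) ω =
      edge M J σz c (X.v ω, I1 X (itDeviation (regressionProfile M J σz c) ι κ) ω,
        Y1 X (itDeviation (regressionProfile M J σz c) ι κ) ω) -
      c.l22 * I2 X (itDeviation (regressionProfile M J σz c) ι κ) ω -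
      lin X.centered (vecN J c) ω := by
  simp only [Price2, Y2, Y1p, X2, X1, Sig, itDeviation, regressionProfile, linearProfile, edge, vecN,
    lin_add, lin_smul, lin_vecE, lin_vecU1p, lin_vecU2, mul_sub, mul_add, Finset.sum_sub_distrib,
    Finset.sum_add_distrib, Finset.sum_neg_distrib, ← Finset.mul_sum, Finset.sum_const,
    Finset.card_univ, Fintype.card_fin, nsmul_eq_mul]
  ring

/-- The map `g` is arbitrary, so this covers the information produced by any deviation: whatever is
generated by `v`, `z`, `u1` is independent of the later noise. -/
theorem condExp_vecN_eq_zero {β : Type*} [MeasurableSpace β] {f : Ω → β} {g : ℝ × ℝ × ℝ → β}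
    (hg : Measurable g) (hf : f = fun ω => g (X.v ω, X.z ω, X.u1 ω)) :
    condExp (sigmaOf f) μ (lin X.centered (vecN J c)) =ᵐ[μ] 0 := by
  refine X.isGaussianFamily.condExp_lin_eq_zero
    (![coef 1 0 0 0 0 0, coef 0 1 0 0 0 0, coef 0 0 1 0 0 0] : Fin 3 → _)
    (g := fun x => g (x 0 + M.p0, x 1, x 2)) (by fun_prop) ?_ ?_
  · rw [hf]
    funext ω
    simp only [Matrix.cons_val_zero, Matrix.cons_val_one, Matrix.cons_val, X.lin_coef]
    simp
  · intro k
    simp only [vecN, covOf_add_left, covOf_smul_left, vecE, vecU1p, vecU2]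
    fin_cases k <;> simp [covOf_coef]

/-- The unpredictable part of the price is multiplied by a known order and drops out, leaving a
concave quadratic in the second order when `l22 > 0`. -/
theorem condExp_ITProfit2 (hι : Measurable fun t : ℝ × ℝ => ι t.1 t.2)
    (hκ : Measurable fun t : ℝ × ℝ × ℝ => κ t.1 t.2.1 t.2.2)
    (hint : Integrable (ITProfit2 X (itDeviation (regressionProfile M J σz c) ι κ)) μ) :
    condExp (sigmaOf fun ω => (X.v ω, I1 X (itDeviation (regressionProfile M J σz c) ι κ) ω,
        Y1 X (itDeviation (regressionProfile M J σz c) ι κ) ω)) μ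
      (ITProfit2 X (itDeviation (regressionProfile M J σz c) ι κ)) =ᵐ[μ]
    fun ω => I2 X (itDeviation (regressionProfile M J σz c) ι κ) ω *
      (edge M J σz c (X.v ω, I1 X (itDeviation (regressionProfile M J σz c) ι κ) ω,
        Y1 X (itDeviation (regressionProfile M J σz c) ι κ) ω) -
      c.l22 * I2 X (itDeviation (regressionProfile M J σz c) ι κ) ω) := by
  have := X.isProbabilityMeasure
  set Q := itDeviation (regressionProfile M J σz c) ι κ with hQ
  set f : Ω → ℝ × ℝ × ℝ := fun ω => (X.v ω, I1 X Q ω, Y1 X Q ω) with hf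
  have hιm : Measurable (I1 X Q) := hι.comp (X.measurable_v.prodMk X.measurable_z)
  have hfm : Measurable f := X.measurable_v.prodMk (hιm.prodMk (hιm.add X.measurable_u1))
  have hI2 : Measurable[sigmaOf f] (I2 X Q) := hκ.comp (comap_measurable f)
  have hed : Measurable[sigmaOf f] fun ω => edge M J σz c (f ω) :=
    (measurable_edge c).comp (comap_measurable f)
  have hN : condExp (sigmaOf f) μ (lin X.centered (vecN J c)) =ᵐ[μ] 0 := by
    refine condExp_vecN_eq_zero X c
      (g := fun t => (t.1, ι t.1 t.2.1, ι t.1 t.2.1 + t.2.2)) ?_ rfl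
    have h1 : Measurable fun t : ℝ × ℝ × ℝ => ι t.1 t.2.1 :=
      hι.comp (measurable_fst.prodMk measurable_snd.fst)
    exact measurable_fst.prodMk (h1.prodMk (h1.add measurable_snd.snd))
  refine condExp_add_mul_eq hfm.comap_le (b := fun ω => -I2 X Q ω)
    (R := lin X.centered (vecN J c)) ?_ hI2.neg (X.isGaussianFamily.integrable_lin _) hN hint
    (ae_of_all _ fun ω => ?_)
  · exact hI2.mul (hed.sub (hI2.const_mul _))
  · simp only [ITProfit2]
    rw [hQ, value_sub_price2_itDeviation]
    ring

/-- Deviations with square-integrable first order and bounded change of the second order have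
integrable profits. -/
theorem memLp_itDeviation (δ : ℝ)
    (hI : MemLp (I1 X (itDeviation (regressionProfile M J σz c) ι
      fun v i y => (regressionProfile M J σz c).i2 v i y + δ)) 2 μ) :
    Integrable (ITProfit1 X (itDeviation (regressionProfile M J σz c) ι
      fun v i y => (regressionProfile M J σz c).i2 v i y + δ)) μ ∧
    Integrable (ITProfit2 X (itDeviation (regressionProfile M J σz c) ι
      fun v i y => (regressionProfile M J σz c).i2 v i y + δ)) μ := by
  have := X.isProbabilityMeasure
  set Q := itDeviation (regressionProfile M J σz c) ι
      fun v i y => (regressionProfile M J σz c).i2 v i y + δ with hQ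
  have hv := X.memLp_v
  have hu : MemLp X.u1 2 μ := by
    convert X.isGaussianFamily.memLp_lin (coef 0 0 1 0 0 0) using 1
    funext ω; simp only [X.lin_coef]; simp
  have hY : MemLp (Y1 X Q) 2 μ := hI.add hu
  have hc : ∀ k : ℝ, MemLp (fun _ : Ω => k) 2 μ := fun k => memLp_const k
  have h2 : MemLp (I2 X Q) 2 μ := by
    have h3 := ((((hv.sub (hc M.p0)).sub (hY.const_mul (slopeV M σz c.α1))).const_mul c.α21).add
      ((hI.sub (hY.const_mul (slopeI M σz c.α1))).const_mul c.α22)).add (hc δ)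
    refine h3.ae_eq (ae_of_all _ fun ω => ?_)
    simp only [Pi.add_apply, Pi.sub_apply]
    simp only [I2, hQ, itDeviation, regressionProfile, linearProfile]
    ring
  have hp1 : MemLp (fun ω => X.v ω - Price1 X Q ω) 2 μ := by
    have h3 := (hv.sub (hc M.p0)).sub (hY.const_mul c.l1)
    refine h3.ae_eq (ae_of_all _ fun ω => ?_)
    simp only [Pi.sub_apply]
    simp only [Price1, hQ, itDeviation, regressionProfile, linearProfile]
    ring
  have hp2 : MemLp (fun ω => X.v ω - Price2 X Q ω) 2 μ := by
    have h3 := ((((hv.sub (hc M.p0)).sub (hY.const_mul c.l1)).sub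
      ((hI.sub (hY.const_mul (slopeI M σz c.α1))).const_mul
        ((c.l21 - c.l22) * c.β12 * J))).sub (h2.const_mul c.l22)).sub
      (X.isGaussianFamily.memLp_lin (vecN J c))
    refine h3.ae_eq (ae_of_all _ fun ω => ?_)
    simp only [Pi.sub_apply]
    rw [hQ, value_sub_price2_itDeviation]
    simp only [edge]
  exact ⟨hp1.integrable_mul hI, hp2.integrable_mul h2⟩

theorem regressionProfile_isMeasurable : (regressionProfile M J σz c).IsMeasurable where
  p1 := by simp only [regressionProfile, linearProfile]; fun_prop
  p1p := by simp only [regressionProfile, linearProfile]; fun_prop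
  p2 := by simp only [regressionProfile, linearProfile]; fun_prop
  i1 := by simp only [regressionProfile, linearProfile]; fun_prop
  i2 := by simp only [regressionProfile, linearProfile]; fun_prop
  x1 _ := by simp only [regressionProfile, linearProfile]; fun_prop
  x2 _ := by simp only [regressionProfile, linearProfile]; fun_prop

theorem slopeI_lt_one : slopeI M σz c.α1 < 1 := by
  have h := flowVar_pos M σz c.α1
  rw [slopeI, div_lt_one h]
  have := pow_pos M.σ1_pos 2
  unfold flowVar
  linarith

/-- Optimality of the informed trader's second order. -/
theorem itSecondOptimal_iff (hl1 : slopeV M σz c.α1 = c.l1) :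
    ITSecondOptimal X (regressionProfile M J σz c) ↔
      0 < c.l22 ∧ 2 * c.l22 * c.α21 = 1 ∧
        2 * c.l22 * c.α22 = -((c.l21 - c.l22) * c.β12 * J) := by
  have := X.isProbabilityMeasure
  have hP := regressionProfile_isMeasurable (M := M) (J := J) (σz := σz) c
  constructor
  · intro h
    -- Test case: a constant first order `k` and a shift of the second order by `δ`, which changes
    -- the conditional profit by `-l22 δ² + δ (edge - 2 l22 i₂)`.
    have key : ∀ k : ℝ, ∀ᵐ ω ∂μ, 0 < c.l22 ∧
        edge M J σz c (X.v ω, k, k + X.u1 ω) -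
          2 * c.l22 * (regressionProfile M J σz c).i2 (X.v ω) k (k + X.u1 ω) = 0 := by
      intro k
      have hι : Measurable fun t : ℝ × ℝ => (fun _ _ : ℝ => k) t.1 t.2 := measurable_const
      have hi : ∀ δ, Integrable (ITProfit2 X (itDeviation (regressionProfile M J σz c)
          (fun _ _ => k) fun v i y => (regressionProfile M J σz c).i2 v i y + δ)) μ := fun δ =>
        (memLp_itDeviation X c δ (memLp_const k)).2
      have hκ : ∀ δ : ℝ, Measurable fun t : ℝ × ℝ × ℝ =>
          (fun v i y => (regressionProfile M J σz c).i2 v i y + δ) t.1 t.2.1 t.2.2 := fun δ =>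
        hP.i2.add_const δ
      have hi0 : Integrable (ITProfit2 X (itDeviation (regressionProfile M J σz c)
          (fun _ _ => k) (regressionProfile M J σz c).i2)) μ := by
        have := hi 0
        simpa only [add_zero] using this
      have h1 : ∀ δ : ℝ, ∀ᵐ ω ∂μ, δ ≠ 0 → -c.l22 * δ ^ 2 + δ *
          (edge M J σz c (X.v ω, k, k + X.u1 ω) -
          2 * c.l22 * (regressionProfile M J σz c).i2 (X.v ω) k (k + X.u1 ω)) < 0 := by
        intro δ
        have hb := h (fun _ _ => k) hι
          (fun v i y => (regressionProfile M J σz c).i2 v i y + δ) (hκ δ) hi0 (hi δ)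
        filter_upwards [hb, condExp_ITProfit2 X c hι hP.i2 hi0,
          condExp_ITProfit2 X c hι (hκ δ) (hi δ)] with ω hb1 hb2 hb3 hδ
        have hb4 := hb1.2 fun h3 => hδ (add_eq_left.1 h3)
        rw [EReal.coe_lt_coe_iff] at hb4
        have hb5 := (hb3.symm.trans_lt hb4).trans_eq hb2
        simp only [I1_itDeviation, I2_itDeviation, Y1] at hb5
        linarith
      -- Each shift has its own null set, so only countably many shifts are used.
      have h2 : ∀ᵐ ω ∂μ, ∀ n : ℕ, _ := ae_all_iff.2 fun n => (h1 (1 / ((n : ℝ) + 1))).and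
        (h1 (-(1 / ((n : ℝ) + 1))))
      filter_upwards [h2] with ω hω
      refine slope_eq_zero_of_forall_step_neg fun n => ?_
      have hn : (1 / ((n : ℝ) + 1)) ≠ 0 := by positivity
      have h3 := (hω n).1 hn
      have h4 := (hω n).2 (neg_ne_zero.2 hn)
      exact ⟨h3, by linarith⟩
    have hl : 0 < c.l22 := by
      obtain ⟨ω, hω⟩ := (key 0).exists
      exact hω.1
    have key2 : ∀ k : ℝ, (2 * c.l22 * c.α21 - 1) * c.l1 * k -
          (2 * c.l22 * c.α22 + (c.l21 - c.l22) * c.β12 * J) * (1 - slopeI M σz c.α1) * k = 0 ∧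
        ∀ b, covOf (variances M J σz) (coef (1 - 2 * c.l22 * c.α21) 0
          ((2 * c.l22 * c.α21 - 1) * c.l1 + (2 * c.l22 * c.α22 + (c.l21 - c.l22) * c.β12 * J) *
            slopeI M σz c.α1) 0 0 0) b = 0 := by
      intro k
      refine X.isGaussianFamily.eq_zero_of_ae_eq_zero ?_
      filter_upwards [key k] with ω hω
      refine Eq.trans ?_ hω.2
      rw [X.lin_coef]
      simp only [edge, regressionProfile, linearProfile, hl1]
      simp
      ring
    have h5 := (key2 0).2 (coef 1 0 0 0 0 0)
    rw [covOf_coef] at h5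
    have hσ := M.σv_pos
    have h6 : 2 * c.l22 * c.α21 = 1 := by
      have : (1 - 2 * c.l22 * c.α21) * M.σv ^ 2 = 0 := by simpa using h5
      have := (mul_eq_zero.1 this).resolve_right (by positivity)
      linarith
    refine ⟨hl, h6, ?_⟩
    -- The constant term at `k = 1` determines `α22`. The coefficient of `u1` would not do: its
    -- factor `slopeI` vanishes when there is neither intensity nor endogenous noise, whereas `1 -
    -- slopeI` is always positive.
    have h7 := (key2 1).1
    rw [h6, sub_self, zero_mul, zero_mul, zero_sub, mul_one, neg_eq_zero] at h7
    have := (mul_eq_zero.1 h7).resolve_right (sub_ne_zero.2 (slopeI_lt_one c).ne')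
    linarith
  · rintro ⟨hl, h1, h2⟩ ι hι κ hκ
    intro Q Q' f hi hi'
    filter_upwards [condExp_ITProfit2 X c hι hP.i2 hi, condExp_ITProfit2 X c hι hκ hi']
      with ω hω hω'
    -- The rule solves the first-order condition identically, after any first order, so a deviation
    -- loses `l22` times the squared difference.
    have hopt : edge M J σz c (X.v ω, I1 X Q ω, Y1 X Q ω) = 2 * c.l22 * I2 X Q ω := by
      have h3 : I2 X Q ω = c.α21 * (X.v ω - (M.p0 + slopeV M σz c.α1 * Y1 X Q ω)) +
        c.α22 * (I1 X Q ω - slopeI M σz c.α1 * Y1 X Q ω) := rfl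
      rw [h3, hl1]
      simp only [edge]
      linear_combination (-(X.v ω - M.p0 - c.l1 * Y1 X Q ω)) * h1 -
        (I1 X Q ω - slopeI M σz c.α1 * Y1 X Q ω) * h2
    have e1 : condExp (sigmaOf f) μ (ITProfit2 X Q) ω = c.l22 * I2 X Q ω ^ 2 := by
      refine hω.trans ?_
      change I2 X Q ω * (edge M J σz c (X.v ω, I1 X Q ω, Y1 X Q ω) - c.l22 * I2 X Q ω) = _
      rw [hopt]; ring
    have e2 : condExp (sigmaOf f) μ (ITProfit2 X Q') ω =
        2 * c.l22 * I2 X Q ω * I2 X Q' ω - c.l22 * I2 X Q' ω ^ 2 := by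
      refine hω'.trans ?_
      change I2 X Q' ω * (edge M J σz c (X.v ω, I1 X Q ω, Y1 X Q ω) - c.l22 * I2 X Q' ω) = _
      rw [hopt]; ring
    rw [e1, e2, EReal.coe_le_coe_iff, EReal.coe_lt_coe_iff]
    refine ⟨by nlinarith [mul_nonneg hl.le (sq_nonneg (I2 X Q' ω - I2 X Q ω))], fun hne => ?_⟩
    have := mul_pos hl (pow_pos (abs_pos.2 (sub_ne_zero.2 hne)) 2)
    rw [sq_abs] at this
    linarith

end InformedTrader

/-! ### The informed trader's first order -/

section InformedTraderFirst

variable {M : Market} {J : ℕ} {σz : ℝ} {Ω : Type*} [MeasurableSpace Ω] {μ : Measure Ω}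
variable (X : Primitives M J σz μ) (c : Coeffs)

/-- The response of the informed trader's second order to her first order. -/
def orderResponse (M : Market) (σz : ℝ) (c : Coeffs) : ℝ :=
  c.α22 * (1 - slopeI M σz c.α1) - c.α21 * c.l1

/-- The response of the informed trader's second order to the first noise order. -/
def noiseResponse (M : Market) (σz : ℝ) (c : Coeffs) : ℝ :=
  -(c.α21 * c.l1 + c.α22 * slopeI M σz c.α1)

/-- The informed trader's expected total profit when `v - p₀ = V` and she first orders `i`. -/
def itValue (M : Market) (σz : ℝ) (c : Coeffs) (V i : ℝ) : ℝ :=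
  i * V - c.l1 * i ^ 2 + c.l22 * (c.α21 * V + orderResponse M σz c * i) ^ 2 +
    c.l22 * noiseResponse M σz c ^ 2 * M.σ1 ^ 2

/-- The first-stage deviation to the pure strategy `ι`, followed by the prescribed second order. -/
def firstDeviation (M : Market) (J : ℕ) (σz : ℝ) (c : Coeffs) (ι : ℝ → ℝ) : Profile J :=
  itDeviation (regressionProfile M J σz c) (fun v _ => ι v) (regressionProfile M J σz c).i2

theorem lin_vecU1 (ω : Ω) : lin X.centered (coef 0 0 1 0 0 0) ω = X.u1 ω := by
  simp only [X.lin_coef]; simp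

theorem cov_N_U1 :
    covOf (variances M J σz) (vecN J c) (coef 0 0 1 0 0 0) = 0 := by
  simp only [vecN, covOf_add_left, covOf_smul_left, vecE, vecU1p, vecU2]
  simp [covOf_coef]

theorem cov_N_V :
    covOf (variances M J σz) (vecN J c) (coef 1 0 0 0 0 0) = 0 := by
  simp only [vecN, covOf_add_left, covOf_smul_left, vecE, vecU1p, vecU2]
  simp [covOf_coef]

theorem condExp_given_v_eq_zero {R : Ω → ℝ} {φ : ℝ × ℝ → ℝ} (hφ : Measurable φ)
    (hR : R = fun ω => φ (lin X.centered (vecN J c) ω, X.u1 ω)) (h0 : ∫ ω, R ω ∂μ = 0) :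
    condExp (sigmaOf X.v) μ R =ᵐ[μ] 0 := by
  refine X.isGaussianFamily.condExp_comp_eq_zero
    (![vecN J c, coef 0 0 1 0 0 0] : Fin 2 → _) (fun _ : Fin 1 => coef 1 0 0 0 0 0)
    (φ := fun x => φ (x 0, x 1)) (hφ.comp (by fun_prop)) ?_ (g := fun x => x 0 + M.p0)
    (by fun_prop) ?_ ?_ h0
  · rw [hR]
    funext ω
    simp [lin_vecU1]
  · funext ω
    simp only [X.lin_coef]
    simp
  · intro l k
    fin_cases l
    · exact cov_N_V c
    · simp [covOf_coef]

/-- By the second-stage rule the edge is `2 l22 i₂`, so the second profit is `l22 i₂²` minus noise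
times `i₂`. Expanding in `u1` leaves a function of `v` plus known multiples of four centered
variables. -/
theorem ITProfit_firstDeviation (hl1 : slopeV M σz c.α1 = c.l1) (hv : 2 * c.l22 * c.α21 = 1)
    (ho : 2 * c.l22 * c.α22 = -((c.l21 - c.l22) * c.β12 * J)) (ι : ℝ → ℝ) (ω : Ω) :
    ITProfit X (firstDeviation M J σz c ι) ω =
      itValue M σz c (X.v ω - M.p0) (ι (X.v ω)) +
      ((2 * c.l22 * noiseResponse M σz c *
          (c.α21 * (X.v ω - M.p0) + orderResponse M σz c * ι (X.v ω)) - c.l1 * ι (X.v ω)) *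
          X.u1 ω +
        c.l22 * noiseResponse M σz c ^ 2 * (X.u1 ω ^ 2 - M.σ1 ^ 2) +
        -(c.α21 * (X.v ω - M.p0) + orderResponse M σz c * ι (X.v ω)) *
          lin X.centered (vecN J c) ω +
        -noiseResponse M σz c * (lin X.centered (vecN J c) ω * X.u1 ω)) := by
  have h1 : I2 X (firstDeviation M J σz c ι) ω =
      c.α21 * (X.v ω - M.p0) + orderResponse M σz c * ι (X.v ω) +
        noiseResponse M σz c * X.u1 ω := by
    simp only [I2, I1, Y1, firstDeviation, itDeviation, regressionProfile, linearProfile,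
      orderResponse, noiseResponse, hl1]
    ring
  have h2 : ITProfit1 X (firstDeviation M J σz c ι) ω =
      (X.v ω - M.p0 - c.l1 * (ι (X.v ω) + X.u1 ω)) * ι (X.v ω) := by
    simp only [ITProfit1, Price1, I1, Y1, firstDeviation, itDeviation, regressionProfile,
      linearProfile]
    ring
  have h3 : edge M J σz c (X.v ω, ι (X.v ω), ι (X.v ω) + X.u1 ω) =
      2 * c.l22 * I2 X (firstDeviation M J σz c ι) ω := by
    rw [h1]
    simp only [edge, orderResponse, noiseResponse]
    linear_combination (-(X.v ω - M.p0 - c.l1 * (ι (X.v ω) + X.u1 ω))) * hv -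
        (ι (X.v ω) - slopeI M σz c.α1 * (ι (X.v ω) + X.u1 ω)) * ho
  have h4 : ITProfit2 X (firstDeviation M J σz c ι) ω =
      (edge M J σz c (X.v ω, ι (X.v ω), ι (X.v ω) + X.u1 ω) -
        c.l22 * I2 X (firstDeviation M J σz c ι) ω - lin X.centered (vecN J c) ω) *
        I2 X (firstDeviation M J σz c ι) ω := by
    rw [ITProfit2]
    unfold firstDeviation
    rw [value_sub_price2_itDeviation]
    rfl
  rw [ITProfit, h2, h4, h3, h1]
  simp only [itValue]
  ring

/-- The four centered variables are independent of `v`. As `ι` is arbitrary, their products with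
known coefficients need not be integrable one by one, so `condExp_add_sum_mul_eq` is used. -/
theorem condExp_ITProfit (hl1 : slopeV M σz c.α1 = c.l1) (hv : 2 * c.l22 * c.α21 = 1)
    (ho : 2 * c.l22 * c.α22 = -((c.l21 - c.l22) * c.β12 * J)) {ι : ℝ → ℝ} (hι : Measurable ι)
    (hint : Integrable (ITProfit X (firstDeviation M J σz c ι)) μ) :
    condExp (sigmaOf X.v) μ (ITProfit X (firstDeviation M J σz c ι)) =ᵐ[μ]
      fun ω => itValue M σz c (X.v ω - M.p0) (ι (X.v ω)) := by
  have := X.isProbabilityMeasure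
  have hG := X.isGaussianFamily
  have hvm : Measurable[sigmaOf X.v] X.v := comap_measurable X.v
  have hιv : Measurable[sigmaOf X.v] fun ω => ι (X.v ω) := hι.comp hvm
  have hg : Measurable[sigmaOf X.v] fun ω =>
      c.α21 * (X.v ω - M.p0) + orderResponse M σz c * ι (X.v ω) :=
    ((hvm.sub_const _).const_mul _).add (hιv.const_mul _)
  have hu1 : Integrable X.u1 μ := by
    rw [← funext (lin_vecU1 X)]
    exact hG.integrable_lin _
  have hu1' := hG.integral_lin (coef 0 0 1 0 0 0)
  have hu2 := hG.integrable_lin_mul_lin (coef 0 0 1 0 0 0) (coef 0 0 1 0 0 0)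
  have hu2' := hG.integral_lin_mul_lin (coef 0 0 1 0 0 0) (coef 0 0 1 0 0 0)
  have hN := hG.integrable_lin (vecN J c)
  have hN' := hG.integral_lin (vecN J c)
  have hNu := hG.integrable_lin_mul_lin (vecN J c) (coef 0 0 1 0 0 0)
  have hNu' := hG.integral_lin_mul_lin (vecN J c) (coef 0 0 1 0 0 0)
  rw [cov_N_U1] at hNu'
  rw [covOf_coef] at hu2'
  simp only [lin_vecU1] at hu1' hu2 hu2' hNu hNu'
  have hsq : Integrable (fun ω => X.u1 ω ^ 2 - M.σ1 ^ 2) μ := by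
    simp only [pow_two (X.u1 _)]
    exact hu2.sub (integrable_const _)
  have hsq' : ∫ ω, (X.u1 ω ^ 2 - M.σ1 ^ 2) ∂μ = 0 := by
    simp only [pow_two (X.u1 _)]
    rw [integral_sub hu2 (integrable_const _), hu2']
    simp
  refine condExp_add_sum_mul_eq X.measurable_v.comap_le Finset.univ
    (b := ![fun ω => 2 * c.l22 * noiseResponse M σz c *
          (c.α21 * (X.v ω - M.p0) + orderResponse M σz c * ι (X.v ω)) - c.l1 * ι (X.v ω),
        fun _ => c.l22 * noiseResponse M σz c ^ 2,
        fun ω => -(c.α21 * (X.v ω - M.p0) + orderResponse M σz c * ι (X.v ω)),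
        fun _ => -noiseResponse M σz c])
    (R := ![X.u1, fun ω => X.u1 ω ^ 2 - M.σ1 ^ 2, lin X.centered (vecN J c),
      fun ω => lin X.centered (vecN J c) ω * X.u1 ω]) ?_ ?_ ?_ ?_ hint (ae_of_all _ fun ω => ?_)
  · unfold itValue
    exact (((hιv.mul (hvm.sub_const _)).sub ((hιv.pow_const 2).const_mul _)).add
      ((hg.pow_const 2).const_mul _)).add_const _
  · intro k _
    fin_cases k
    · exact (hg.const_mul _).sub (hιv.const_mul _)
    · exact measurable_const
    · exact hg.neg
    · exact measurable_const
  · intro k _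
    fin_cases k
    exacts [hu1, hsq, hN, hNu]
  · intro k _
    fin_cases k
    · exact condExp_given_v_eq_zero X c (φ := fun x => x.2) (by fun_prop) rfl hu1'
    · exact condExp_given_v_eq_zero X c (φ := fun x => x.2 ^ 2 - M.σ1 ^ 2) (by fun_prop) rfl hsq'
    · exact condExp_given_v_eq_zero X c (φ := fun x => x.1) (by fun_prop) rfl hN'
    · exact condExp_given_v_eq_zero X c (φ := fun x => x.1 * x.2) (by fun_prop) rfl hNu'
  · rw [ITProfit_firstDeviation X c hl1 hv ho]
    simp [Fin.sum_univ_four]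

theorem integrable_ITProfit_firstDeviation {ι : ℝ → ℝ} (hι : MemLp (fun ω => ι (X.v ω)) 2 μ) :
    Integrable (ITProfit X (firstDeviation M J σz c ι)) μ := by
  obtain ⟨h1, h2⟩ := memLp_itDeviation X c (ι := fun v _ => ι v) 0 hι
  simp only [add_zero] at h1 h2
  exact h1.add h2

/-- An affine function of the value that vanishes almost surely is zero. -/
theorem affine_value_eq_zero {p q : ℝ} (h : ∀ᵐ ω ∂μ, p * (X.v ω - M.p0) + q = 0) :
    p = 0 ∧ q = 0 := by
  have hσ := M.σv_pos
  obtain ⟨h1, h2⟩ := X.isGaussianFamily.eq_zero_of_ae_eq_zero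
    (a := coef p 0 0 0 0 0) (k := q) (by
      filter_upwards [h] with ω hω
      rw [X.lin_coef]
      simpa using hω)
  have h3 := h2 (coef 1 0 0 0 0 0)
  rw [covOf_coef] at h3
  refine ⟨?_, h1⟩
  have : p * M.σv ^ 2 = 0 := by simpa using h3
  exact (mul_eq_zero.1 this).resolve_right (by positivity)

/-- Indifference of the informed trader among all first orders. -/
theorem itFirstIndifferent_iff (hl1 : slopeV M σz c.α1 = c.l1) (hv : 2 * c.l22 * c.α21 = 1)
    (ho : 2 * c.l22 * c.α22 = -((c.l21 - c.l22) * c.β12 * J)) :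
    ITFirstIndifferent X (regressionProfile M J σz c) ↔
      1 + orderResponse M σz c = 0 ∧ c.l22 * orderResponse M σz c ^ 2 = c.l1 := by
  have := X.isProbabilityMeasure
  constructor
  · intro h
    have hi : ∀ k : ℝ, Integrable (ITProfit X (firstDeviation M J σz c fun _ => k)) μ := fun k =>
      integrable_ITProfit_firstDeviation X c (memLp_const k)
    have h1 := h (fun _ => 1) (fun _ => 0) measurable_const measurable_const (hi 1) (hi 0)
    -- The values of the orders 1 and 0 differ by an affine function of `v`; its two coefficients
    -- are those of `i V` and `i²` in `itValue`, so these two constant strategies already suffice.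
    obtain ⟨h2, h3⟩ := affine_value_eq_zero X (p := 1 + orderResponse M σz c)
      (q := c.l22 * orderResponse M σz c ^ 2 - c.l1) (by
        filter_upwards [h1, condExp_ITProfit X c hl1 hv ho measurable_const (hi 1),
          condExp_ITProfit X c hl1 hv ho measurable_const (hi 0)] with ω h4 h5 h6
        have h7 := h5.symm.trans (h4.trans h6)
        simp only [itValue] at h7
        linear_combination h7 - orderResponse M σz c * (X.v ω - M.p0) * hv)
    exact ⟨h2, sub_eq_zero.1 h3⟩
  · rintro ⟨h1, h2⟩ ι ι' hι hι'
    intro Q Q' hi hi'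
    have h3 : ∀ V i, itValue M σz c V i = itValue M σz c V 0 := by
      intro V i
      simp only [itValue]
      linear_combination i ^ 2 * h2 + i * V * h1 + orderResponse M σz c * i * V * hv
    refine (condExp_ITProfit X c hl1 hv ho hι hi).trans
      (Filter.EventuallyEq.trans ?_ (condExp_ITProfit X c hl1 hv ho hι' hi').symm)
    refine ae_of_all _ fun ω => ?_
    simp only [h3]

theorem z_ae_eq_zero (X : Primitives M J 0 μ) : ∀ᵐ ω ∂μ, X.z ω = 0 := by
  have h := X.law_z
  simp only [ne_eq, OfNat.ofNat_ne_zero, not_false_eq_true, zero_pow, Real.toNNReal_zero,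
    gaussianReal_zero_var] at h
  have h1 : ∀ᵐ x ∂(μ.map X.z), x = 0 := by
    rw [h]
    exact (ae_dirac_iff (measurableSet_singleton (0 : ℝ))).2 rfl
  exact ae_of_ae_map X.measurable_z.aemeasurable h1

/-- Optimality of the informed trader's first order without endogenous noise. -/
theorem itFirstOptimal_iff (X : Primitives M J 0 μ) (hl1 : slopeV M 0 c.α1 = c.l1)
    (hv : 2 * c.l22 * c.α21 = 1)
    (ho : 2 * c.l22 * c.α22 = -((c.l21 - c.l22) * c.β12 * J)) :
    ITFirstOptimal X (regressionProfile M J 0 c) ↔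
      c.l22 * orderResponse M 0 c ^ 2 < c.l1 ∧
        1 + orderResponse M 0 c + 2 * c.α1 * (c.l22 * orderResponse M 0 c ^ 2 - c.l1) = 0 := by
  have := X.isProbabilityMeasure
  have hz := z_ae_eq_zero X
  have hm : ∀ δ, Measurable fun v => c.α1 * (v - M.p0) + δ := by fun_prop
  have hi : ∀ δ : ℝ, Integrable (ITProfit X (firstDeviation M J 0 c
      fun v => c.α1 * (v - M.p0) + δ)) μ := fun δ =>
    integrable_ITProfit_firstDeviation X c
      (((X.memLp_v.sub (memLp_const M.p0)).const_mul c.α1).add (memLp_const δ))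
  have hI1 : ∀ᵐ ω ∂μ, I1 X (regressionProfile M J 0 c) ω = c.α1 * (X.v ω - M.p0) := by
    filter_upwards [hz] with ω hω
    rw [I1_regressionProfile, hω, add_zero]
  -- Without endogenous noise the prescribed order is almost surely the pure strategy `α1 (v - p0)`,
  -- so the value formula for pure strategies applies to it.
  have hPV : condExp (sigmaOf X.v) μ (ITProfit X (regressionProfile M J 0 c)) =ᵐ[μ]
      fun ω => itValue M 0 c (X.v ω - M.p0) (c.α1 * (X.v ω - M.p0)) := by
    have h1 : ITProfit X (regressionProfile M J 0 c) =ᵐ[μ]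
        ITProfit X (firstDeviation M J 0 c fun v => c.α1 * (v - M.p0) + 0) := by
      filter_upwards [hI1] with ω hω
      have h2 : I1 X (regressionProfile M J 0 c) ω =
          I1 X (firstDeviation M J 0 c fun v => c.α1 * (v - M.p0) + 0) ω := by
        rw [hω]; exact (add_zero _).symm
      simp only [ITProfit, ITProfit1, ITProfit2, Price1, Price2, Y2, Y1p, X2, I2, X1, Sig, Y1, h2]
      rfl
    refine (condExp_congr_ae h1).trans ?_
    have h3 := condExp_ITProfit X c hl1 hv ho (hm 0) (hi 0)
    simpa only [add_zero] using h3
  -- Exact Taylor expansion of the quadratic value around the prescribed order.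
  have hval : ∀ V i, itValue M 0 c V (c.α1 * V) - itValue M 0 c V i =
      (c.α1 * V - i) * V * (1 + orderResponse M 0 c +
        2 * c.α1 * (c.l22 * orderResponse M 0 c ^ 2 - c.l1)) +
      (c.l1 - c.l22 * orderResponse M 0 c ^ 2) * (i - c.α1 * V) ^ 2 := by
    intro V i
    simp only [itValue]
    linear_combination orderResponse M 0 c * V * (c.α1 * V - i) * hv
  constructor
  · intro h
    have h1 : ∀ δ : ℝ, ∀ᵐ ω ∂μ, δ ≠ 0 →
        -(c.l1 - c.l22 * orderResponse M 0 c ^ 2) * δ ^ 2 + δ * ((X.v ω - M.p0) *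
        (1 + orderResponse M 0 c +
          2 * c.α1 * (c.l22 * orderResponse M 0 c ^ 2 - c.l1))) < 0 := by
      intro δ
      filter_upwards [h _ (hm δ) (hi δ), hPV, condExp_ITProfit X c hl1 hv ho (hm δ) (hi δ), hI1]
        with ω h1 h2 h3 h4 hδ
      have h5 := h1.2 (by
        rw [h4]
        exact fun h6 => hδ (add_eq_left.1 h6))
      rw [EReal.coe_lt_coe_iff] at h5
      have h6 := (h3.symm.trans_lt h5).trans_eq h2
      have h7 := hval (X.v ω - M.p0) (c.α1 * (X.v ω - M.p0) + δ)
      linarith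
    have h2 : ∀ᵐ ω ∂μ, ∀ n : ℕ, _ := ae_all_iff.2 fun n => (h1 (1 / ((n : ℝ) + 1))).and
      (h1 (-(1 / ((n : ℝ) + 1))))
    have h3 : ∀ᵐ ω ∂μ, 0 < c.l1 - c.l22 * orderResponse M 0 c ^ 2 ∧ (X.v ω - M.p0) *
        (1 + orderResponse M 0 c +
          2 * c.α1 * (c.l22 * orderResponse M 0 c ^ 2 - c.l1)) = 0 := by
      filter_upwards [h2] with ω hω
      refine slope_eq_zero_of_forall_step_neg fun n => ?_
      have hn : (1 / ((n : ℝ) + 1)) ≠ 0 := by positivity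
      have h3 := (hω n).1 hn
      have h4 := (hω n).2 (neg_ne_zero.2 hn)
      exact ⟨h3, by linarith⟩
    refine ⟨?_, (affine_value_eq_zero X (q := 0) ?_).1⟩
    · obtain ⟨ω, hω⟩ := h3.exists
      exact sub_pos.1 hω.1
    · filter_upwards [h3] with ω hω
      rw [add_zero, mul_comm]
      exact hω.2
  · rintro ⟨h1, h2⟩ ι hι
    intro Q' hi'
    filter_upwards [hPV, condExp_ITProfit X c hl1 hv ho hι hi', hI1] with ω h3 h4 h5
    have h6 := hval (X.v ω - M.p0) (ι (X.v ω))
    rw [h2, mul_zero, zero_add] at h6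
    have h7 : condExp (sigmaOf X.v) μ (ITProfit X Q') ω =
      itValue M 0 c (X.v ω - M.p0) (ι (X.v ω)) := h4
    rw [h3, h7, EReal.coe_le_coe_iff, EReal.coe_lt_coe_iff]
    have h8 := sub_pos.2 h1
    refine ⟨?_, fun hne => ?_⟩
    · have := mul_nonneg h8.le (sq_nonneg (ι (X.v ω) - c.α1 * (X.v ω - M.p0)))
      linarith
    · rw [h5] at hne
      have h9 : ι (X.v ω) - c.α1 * (X.v ω - M.p0) ≠ 0 := sub_ne_zero.2 hne
      have := mul_pos h8 (pow_pos (abs_pos.2 h9) 2)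
      rw [sq_abs] at this
      linarith

end InformedTraderFirst

/-! ### The high-frequency traders' orders -/

section HighFrequencyTraders

variable {M : Market} {J : ℕ} {σz : ℝ} {Ω : Type*} [MeasurableSpace Ω] {μ : Measure Ω}
variable (X : Primitives M J σz μ) (c : Coeffs)

theorem penalized_of_cost_eq_zero {Ω : Type*} {m m0 : MeasurableSpace Ω} {μ : Measure Ω} {γ : ℝ≥0∞}
    {profit cost : Ω → ℝ} {ω : Ω} (h : condExp m μ cost ω = 0) :
    penalized μ m γ profit cost ω = ((condExp m μ profit ω : ℝ) : EReal) := by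
  simp [penalized, h]

theorem penalized_top_of_cost_pos {Ω : Type*} {m m0 : MeasurableSpace Ω} {μ : Measure Ω}
    {profit cost : Ω → ℝ} {ω : Ω} (h : 0 < condExp m μ cost ω) : penalized μ m ∞ profit cost ω = ⊥ := by
  have h1 : ∞ * ENNReal.ofReal (condExp m μ cost ω) = ∞ :=
    ENNReal.top_mul (by simpa using h)
  simp [penalized, h1]

/-- Round-trippers close their positions, whatever their first order. -/
theorem hftSecondOptimal_regressionProfile (j : Fin J) :
    HFTSecondOptimal X (fun _ => ∞) (regressionProfile M J σz c) j := by
  have := X.isProbabilityMeasure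
  intro ξ hξ χ hχ Q Q' f hi hc hi' hc'
  have hSm : ∀ k, Measurable (Sig X Q k) := fun k =>
    (((X.measurable_v.sub_const _).const_mul _).add X.measurable_z).add (X.measurable_ε k)
  have hYm : Measurable (Y1 X Q) := measurable_Y1 X c
  have hx1 : ∀ k, Measurable fun t : ℝ × ℝ => Q.x1 k t.1 t.2 := by
    intro k
    by_cases hk : k = j
    · subst hk
      simpa only [Q, Function.update_self] using hξ
    · simpa only [Q, Function.update_of_ne hk] using (regressionProfile_isMeasurable c).x1 k
  have hXm : ∀ k, Measurable (X1 X Q k) := fun k => (hx1 k).comp ((hSm k).prodMk hYm)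
  have hYpm : Measurable (Y1p X Q) :=
    (Finset.measurable_fun_sum _ fun k _ => hXm k).add X.measurable_u1p
  have hf : Measurable f := (hSm j).prodMk (hYm.prodMk hYpm)
  have hX1f : Measurable[sigmaOf f] (X1 X Q j) :=
    ((hx1 j).comp (measurable_fst.prodMk measurable_snd.fst)).comp (comap_measurable f)
  have hX2 : ∀ ω, X2 X Q j ω = -X1 X Q j ω := fun ω => rfl
  have hX2' : X2 X Q' j = fun ω => χ (f ω).1 (f ω).2.1 (f ω).2.2 := by
    funext ω
    simp only [X2, Q', Function.update_self]
    rfl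
  have hX2f : Measurable[sigmaOf f] (X2 X Q' j) := by
    rw [hX2']
    exact hχ.comp (comap_measurable f)
  have hX1 : ∀ ω, X1 X Q' j ω = X1 X Q j ω := fun ω => rfl
  have hsq : SqInventory X Q j = 0 := by
    funext ω
    simp [SqInventory, hX2]
  -- The trader knows her own inventory, so its conditional expected square is the square itself.
  have hsq' : condExp (sigmaOf f) μ (SqInventory X Q' j) = SqInventory X Q' j :=
    condExp_of_stronglyMeasurable hf.comap_le ((hX1f.add hX2f).pow_const 2).stronglyMeasurable hc'
  -- On this event, known to the trader, the deviation agrees with the prescribed order and so do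
  -- the conditional profits. Off it the inventory is nonzero and the penalized value is `⊥`.
  let A : Set Ω := {ω | X2 X Q' j ω = X2 X Q j ω}
  have hA : MeasurableSet[sigmaOf f] A := by
    have h1 : A = (fun ω => X2 X Q' j ω - -X1 X Q j ω) ⁻¹' {0} := by
      ext ω
      simp only [A, Set.mem_ofPred_eq, Set.mem_preimage, Set.mem_singleton_iff, hX2, sub_eq_zero]
    rw [h1]
    exact (hX2f.sub hX1f.neg) (measurableSet_singleton 0)
  have hAprofit : A.indicator (HFTProfit2 X Q' j) = A.indicator (HFTProfit2 X Q j) := by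
    funext ω
    by_cases hω : ω ∈ A
    · rw [Set.indicator_of_mem hω, Set.indicator_of_mem hω]
      have h1 : X2 X Q' j ω = X2 X Q j ω := hω
      have h2 : ∀ k, X2 X Q' k ω = X2 X Q k ω := by
        intro k
        by_cases hk : k = j
        · rw [hk, h1]
        · simp only [X2, Q', Function.update_of_ne hk]
          rfl
      have h3 : Y2 X Q' ω = Y2 X Q ω := by
        simp only [Y2, h2]
        rfl
      simp only [HFTProfit2, Price2, h3, h1]
      rfl
    · rw [Set.indicator_of_notMem hω, Set.indicator_of_notMem hω]
  have hcond : A.indicator (condExp (sigmaOf f) μ (HFTProfit2 X Q' j)) =ᵐ[μ]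
      A.indicator (condExp (sigmaOf f) μ (HFTProfit2 X Q j)) := by
    refine (condExp_indicator hi' hA).symm.trans ?_
    rw [hAprofit]
    exact condExp_indicator hi hA
  filter_upwards [hcond] with ω hω
  have h0 : condExp (sigmaOf f) μ (SqInventory X Q j) ω = 0 := by
    rw [hsq, condExp_zero]; rfl
  rw [penalized_of_cost_eq_zero h0]
  by_cases hωA : ω ∈ A
  · have h1 : X2 X Q' j ω = X2 X Q j ω := hωA
    have h2 : condExp (sigmaOf f) μ (SqInventory X Q' j) ω = 0 := by
      rw [hsq', SqInventory, h1, hX1, hX2]; ring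
    rw [Set.indicator_of_mem hωA, Set.indicator_of_mem hωA] at hω
    rw [penalized_of_cost_eq_zero h2, hω]
    exact ⟨le_rfl, fun h => absurd h1 h⟩
  · have h1 : X2 X Q' j ω ≠ X2 X Q j ω := hωA
    have h2 : 0 < condExp (sigmaOf f) μ (SqInventory X Q' j) ω := by
      rw [hsq', SqInventory, hX1]
      have : X1 X Q j ω + X2 X Q' j ω ≠ 0 := by
        intro h
        apply h1
        rw [hX2]
        linarith
      positivity
    rw [penalized_top_of_cost_pos h2]
    exact ⟨bot_le, fun _ => EReal.bot_lt_coe _⟩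

/-- The slope of the price pressure that a round-tripper exerts against herself. -/
def hftImpact (c : Coeffs) : ℝ := c.l1p + c.l22 - c.l21

/-- The first-order condition of a high-frequency trader's first order: the price increase net of
the impact of her own order. -/
def vecFOC (M : Market) (J : ℕ) (σz : ℝ) (c : Coeffs) (j : Fin J) : Fin 5 ⊕ Fin J → ℝ :=
  (c.l21 - c.l1p) • vecY1p M J σz c.α1 c.β12 + c.l22 • vecY2 M J σz c -
    (hftImpact c * c.β12) • (vecD M J σz c.α1 + vecEps j)

/-- The deviation of a single high-frequency trader in the first stage. -/
def hftDeviation (P : Profile J) (j : Fin J) (ξ : ℝ → ℝ → ℝ) : Profile J :=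
  { P with x1 := Function.update P.x1 j ξ }

/-- A round trip earns the order times `p₂ - p₁₊`. Raising the own order by d raises `y₁₊` and
lowers `y₂` by d, which reduces this price difference by `hftImpact c * d`. The last term is the
marginal profit at the prescribed order. -/
theorem HFTProfit_hftDeviation (j : Fin J) (ξ : ℝ → ℝ → ℝ) (ω : Ω) :
    HFTProfit X (hftDeviation (regressionProfile M J σz c) j ξ) j ω =
      2 * hftImpact c * X1 X (regressionProfile M J σz c) j ω *
          X1 X (hftDeviation (regressionProfile M J σz c) j ξ) j ω -
        hftImpact c * X1 X (hftDeviation (regressionProfile M J σz c) j ξ) j ω ^ 2 +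
      X1 X (hftDeviation (regressionProfile M J σz c) j ξ) j ω *
        lin X.centered (vecFOC M J σz c j) ω := by
  set Q := hftDeviation (regressionProfile M J σz c) j ξ with hQ
  have hsum : ∑ k, X1 X Q k ω = ∑ k, X1 X (regressionProfile M J σz c) k ω +
      (X1 X Q j ω - X1 X (regressionProfile M J σz c) j ω) := by
    rw [← sub_eq_iff_eq_add', ← Finset.sum_sub_distrib]
    refine Finset.sum_eq_single j (fun k _ hk => ?_) (by simp)
    have : Q.x1 k = (regressionProfile M J σz c).x1 k := Function.update_of_ne hk _ _
    simp only [X1, this]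
    exact sub_self _
  have hX2 : ∀ k, X2 X Q k ω = -X1 X Q k ω := fun k => rfl
  have hX2' : ∀ k, X2 X (regressionProfile M J σz c) k ω =
    -X1 X (regressionProfile M J σz c) k ω := fun k => rfl
  have hY1p : Y1p X Q ω = Y1p X (regressionProfile M J σz c) ω +
      (X1 X Q j ω - X1 X (regressionProfile M J σz c) j ω) := by
    simp only [Y1p, hsum]; ring
  have hY2 : Y2 X Q ω = Y2 X (regressionProfile M J σz c) ω -
      (X1 X Q j ω - X1 X (regressionProfile M J σz c) j ω) := by
    have : I2 X Q ω = I2 X (regressionProfile M J σz c) ω := rfl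
    simp only [Y2, hX2, hX2', Finset.sum_neg_distrib, hsum, this]; ring
  have hp : HFTProfit X Q j ω = X1 X Q j ω *
      ((c.l21 - c.l1p) * Y1p X Q ω + c.l22 * Y2 X Q ω) := by
    have h1 : Price1p X Q ω = M.p0 + c.l1 * Y1 X Q ω + c.l1p * Y1p X Q ω := rfl
    have h2 : Price2 X Q ω = M.p0 + c.l1 * Y1 X Q ω + c.l21 * Y1p X Q ω + c.l22 * Y2 X Q ω := rfl
    simp only [HFTProfit, HFTProfit1, HFTProfit2, hX2, h1, h2]
    ring
  have hx : lin X.centered (vecFOC M J σz c j) ω =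
      (c.l21 - c.l1p) * Y1p X (regressionProfile M J σz c) ω +
        c.l22 * Y2 X (regressionProfile M J σz c) ω -
        hftImpact c * X1 X (regressionProfile M J σz c) j ω := by
    rw [vecFOC, lin_sub, lin_add, lin_smul, lin_smul, lin_smul, lin_vecY1p, lin_vecY2,
      X1_regressionProfile]
    ring
  rw [hp, hx, hY1p, hY2, hftImpact]
  ring

/-- The signal of a high-frequency trader. -/
theorem lin_signal (j : Fin J) (ω : Ω) :
    lin X.centered (vecD M J σz c.α1 + slopeI M σz c.α1 • vecY1 J c.α1 + vecEps j) ω =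
      Sig X (regressionProfile M J σz c) j ω := by
  rw [lin_add, lin_add, lin_smul, lin_vecD, lin_vecY1, lin_vecEps, Sig]
  ring

theorem measurable_Sig (j : Fin J) : Measurable (Sig X (regressionProfile M J σz c) j) := by
  rw [← funext (lin_signal X c j)]
  exact X.isGaussianFamily.measurable_lin _

theorem cov_vecFOC_Y1 (j : Fin J) :
    covOf (variances M J σz) (vecFOC M J σz c j) (vecY1 J c.α1) = 0 := by
  simp only [vecFOC, vecY1p, vecY2, covOf_add_left, covOf_sub_left, covOf_smul_left, cov_D_Y1,
    cov_W_Y1, cov_E_Y1, cov_U1p_Y1, cov_U2_Y1, cov_Eps_Y1]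
  ring

/-- The first-order condition holds on average given the trader's information if and only if its
error is uncorrelated with the unpredictable part of her signal. -/
theorem condExp_vecFOC_eq_zero_iff (j : Fin J) :
    condExp (sigmaOf fun ω => (Sig X (regressionProfile M J σz c) j ω,
      Y1 X (regressionProfile M J σz c) ω)) μ (lin X.centered (vecFOC M J σz c j)) =ᵐ[μ] 0 ↔
    covOf (variances M J σz) (vecFOC M J σz c j) (vecD M J σz c.α1 + vecEps j) = 0 := by
  have hcov : covOf (variances M J σz) (vecFOC M J σz c j)
      (vecD M J σz c.α1 + slopeI M σz c.α1 • vecY1 J c.α1 + vecEps j) =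
      covOf (variances M J σz) (vecFOC M J σz c j) (vecD M J σz c.α1 + vecEps j) := by
    simp only [covOf_add_right, covOf_smul_right, cov_vecFOC_Y1]
    ring
  rw [← hcov]
  constructor
  · exact X.isGaussianFamily.covOf_eq_zero_of_condExp
      ((measurable_Sig X c j).prodMk (measurable_Y1 X c)) measurable_fst
      (fun ω => (lin_signal X c j ω).symm)
  · intro h
    refine X.isGaussianFamily.condExp_lin_eq_zero
      (![vecD M J σz c.α1 + slopeI M σz c.α1 • vecY1 J c.α1 + vecEps j, vecY1 J c.α1] :
        Fin 2 → _)
      (g := fun x => (x 0, x 1)) (by fun_prop) ?_ ?_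
    · funext ω
      simp [lin_signal, lin_vecY1]
    · rw [Fin.forall_fin_two]
      exact ⟨h, cov_vecFOC_Y1 c j⟩

theorem sqInventory_hftDeviation (j : Fin J) (ξ : ℝ → ℝ → ℝ) :
    SqInventory X (hftDeviation (regressionProfile M J σz c) j ξ) j = 0 := by
  funext ω
  have : X2 X (hftDeviation (regressionProfile M J σz c) j ξ) j ω =
    -X1 X (hftDeviation (regressionProfile M J σz c) j ξ) j ω := rfl
  simp [SqInventory, this]

theorem hftDeviation_self (P : Profile J) (j : Fin J) : hftDeviation P j (P.x1 j) = P := by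
  simp [hftDeviation]

theorem memLp_X1 (j : Fin J) : MemLp (X1 X (regressionProfile M J σz c) j) 2 μ := by
  rw [funext (X1_regressionProfile X c j)]
  exact (X.isGaussianFamily.memLp_lin _).const_mul _

theorem X1_hftDeviation (P : Profile J) (j : Fin J) (ξ : ℝ → ℝ → ℝ) (ω : Ω) :
    X1 X (hftDeviation P j ξ) j ω = ξ (Sig X P j ω) (Y1 X P ω) := by
  simp only [X1, hftDeviation, Function.update_self]
  rfl

theorem integrable_HFTProfit_add_const (j : Fin J) (δ : ℝ) :
    Integrable (HFTProfit X (hftDeviation (regressionProfile M J σz c) j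
      fun s y => (regressionProfile M J σz c).x1 j s y + δ) j) μ := by
  have := X.isProbabilityMeasure
  have hx := memLp_X1 X c j
  have hx' : MemLp (X1 X (hftDeviation (regressionProfile M J σz c) j
      fun s y => (regressionProfile M J σz c).x1 j s y + δ) j) 2 μ := by
    rw [funext (X1_hftDeviation X _ j _)]
    exact hx.add (memLp_const δ)
  rw [funext (HFTProfit_hftDeviation X c j _)]
  simp only [pow_two]
  exact (((hx.const_mul _).integrable_mul hx').sub ((hx'.integrable_mul hx').const_mul _)).add
    (hx'.integrable_mul (X.isGaussianFamily.memLp_lin _))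

/-- For sufficiency: once the marginal profit has zero conditional mean, any measurable deviation is
worth a quadratic with vertex at the prescribed order. -/
theorem condExp_HFTProfit {j : Fin J}
    (h0 : condExp (sigmaOf fun ω => (Sig X (regressionProfile M J σz c) j ω,
      Y1 X (regressionProfile M J σz c) ω)) μ (lin X.centered (vecFOC M J σz c j)) =ᵐ[μ] 0)
    {ξ : ℝ → ℝ → ℝ} (hξ : Measurable fun t : ℝ × ℝ => ξ t.1 t.2)
    (hi : Integrable (HFTProfit X (hftDeviation (regressionProfile M J σz c) j ξ) j) μ) :
    condExp (sigmaOf fun ω => (Sig X (regressionProfile M J σz c) j ω,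
      Y1 X (regressionProfile M J σz c) ω)) μ
      (HFTProfit X (hftDeviation (regressionProfile M J σz c) j ξ) j) =ᵐ[μ] fun ω =>
      2 * hftImpact c * X1 X (regressionProfile M J σz c) j ω *
          X1 X (hftDeviation (regressionProfile M J σz c) j ξ) j ω -
        hftImpact c * X1 X (hftDeviation (regressionProfile M J σz c) j ξ) j ω ^ 2 := by
  have := X.isProbabilityMeasure
  have hf : Measurable fun ω => (Sig X (regressionProfile M J σz c) j ω,
      Y1 X (regressionProfile M J σz c) ω) :=
    (measurable_Sig X c j).prodMk (measurable_Y1 X c)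
  have hx : Measurable[sigmaOf fun ω => (Sig X (regressionProfile M J σz c) j ω,
      Y1 X (regressionProfile M J σz c) ω)] (X1 X (regressionProfile M J σz c) j) :=
    ((regressionProfile_isMeasurable c).x1 j).comp (comap_measurable _)
  have hx' : Measurable[sigmaOf fun ω => (Sig X (regressionProfile M J σz c) j ω,
      Y1 X (regressionProfile M J σz c) ω)]
      (X1 X (hftDeviation (regressionProfile M J σz c) j ξ) j) := by
    rw [funext (X1_hftDeviation X _ j _)]
    exact hξ.comp (comap_measurable _)
  exact condExp_add_mul_eq hf.comap_le
    (((hx.const_mul _).mul hx').sub ((hx'.pow_const 2).const_mul _)) hx'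
    (X.isGaussianFamily.integrable_lin _) h0 hi
    (ae_of_all _ fun ω => HFTProfit_hftDeviation X c j ξ ω)

/-- For necessity: the first-order condition is not yet known here, so its conditional mean appears
as the slope in the shift `δ`. -/
theorem condExp_HFTProfit_add_const (j : Fin J) (δ : ℝ) :
    condExp (sigmaOf fun ω => (Sig X (regressionProfile M J σz c) j ω,
      Y1 X (regressionProfile M J σz c) ω)) μ
      (HFTProfit X (hftDeviation (regressionProfile M J σz c) j
        fun s y => (regressionProfile M J σz c).x1 j s y + δ) j) =ᵐ[μ] fun ω =>
      condExp (sigmaOf fun ω => (Sig X (regressionProfile M J σz c) j ω,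
        Y1 X (regressionProfile M J σz c) ω)) μ
        (HFTProfit X (regressionProfile M J σz c) j) ω - hftImpact c * δ ^ 2 +
      δ * condExp (sigmaOf fun ω => (Sig X (regressionProfile M J σz c) j ω,
        Y1 X (regressionProfile M J σz c) ω)) μ (lin X.centered (vecFOC M J σz c j)) ω := by
  have := X.isProbabilityMeasure
  have hf : Measurable fun ω => (Sig X (regressionProfile M J σz c) j ω,
      Y1 X (regressionProfile M J σz c) ω) :=
    (measurable_Sig X c j).prodMk (measurable_Y1 X c)
  have hi0 : Integrable (HFTProfit X (regressionProfile M J σz c) j) μ := by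
    have h := integrable_HFTProfit_add_const X c j 0
    simp only [add_zero] at h
    rwa [hftDeviation_self] at h
  have h1 : HFTProfit X (hftDeviation (regressionProfile M J σz c) j
        fun s y => (regressionProfile M J σz c).x1 j s y + δ) j =
      (HFTProfit X (regressionProfile M J σz c) j + fun _ => -(hftImpact c * δ ^ 2)) +
        δ • lin X.centered (vecFOC M J σz c j) := by
    funext ω
    have h2 := HFTProfit_hftDeviation X c j ((regressionProfile M J σz c).x1 j) ω
    rw [hftDeviation_self] at h2
    have h3 : X1 X (hftDeviation (regressionProfile M J σz c) j
        fun s y => (regressionProfile M J σz c).x1 j s y + δ) j ω =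
        X1 X (regressionProfile M J σz c) j ω + δ := by
      rw [X1_hftDeviation]; rfl
    simp only [Pi.add_apply, Pi.smul_apply, smul_eq_mul]
    rw [HFTProfit_hftDeviation, h3, h2]
    ring
  rw [h1]
  have hc : Integrable (fun _ : Ω => -(hftImpact c * δ ^ 2)) μ := integrable_const _
  have hlin := X.isGaussianFamily.integrable_lin (vecFOC M J σz c j)
  refine (condExp_add (hi0.add hc) (hlin.smul δ) _).trans ?_
  filter_upwards [condExp_add (m := sigmaOf fun ω => (Sig X (regressionProfile M J σz c) j ω,
      Y1 X (regressionProfile M J σz c) ω)) hi0 hc,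
    condExp_smul (μ := μ) δ (lin X.centered (vecFOC M J σz c j))
      (sigmaOf fun ω => (Sig X (regressionProfile M J σz c) j ω,
      Y1 X (regressionProfile M J σz c) ω))] with ω h2 h3
  rw [condExp_const hf.comap_le] at h2
  simp only [Pi.add_apply, Pi.smul_apply, smul_eq_mul] at h2 h3 ⊢
  rw [h2, h3]
  ring

/-- Optimality of a high-frequency trader's first order. -/
theorem hftFirstOptimal_iff (j : Fin J) :
    HFTFirstOptimal X (fun _ => ∞) (regressionProfile M J σz c) j ↔
      0 < hftImpact c ∧
      covOf (variances M J σz) (vecFOC M J σz c j) (vecD M J σz c.α1 + vecEps j) = 0 := by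
  have := X.isProbabilityMeasure
  have hP := regressionProfile_isMeasurable (M := M) (J := J) (σz := σz) c
  -- Every first order is followed by its reversal, so the inventory vanishes and, by `∞ * 0 = 0`,
  -- the aversion plays no role in the first stage.
  have hsq : ∀ (ξ : ℝ → ℝ → ℝ) (ω : Ω), condExp (sigmaOf fun ω => (Sig X (regressionProfile M J σz c) j ω,
      Y1 X (regressionProfile M J σz c) ω)) μ
      (SqInventory X (hftDeviation (regressionProfile M J σz c) j ξ) j) ω = 0 := by
    intro ξ ω
    rw [sqInventory_hftDeviation, condExp_zero]; rfl
  have hsq0 : ∀ ω : Ω, condExp (sigmaOf fun ω => (Sig X (regressionProfile M J σz c) j ω,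
      Y1 X (regressionProfile M J σz c) ω)) μ
      (SqInventory X (regressionProfile M J σz c) j) ω = 0 := by
    intro ω
    have := hsq ((regressionProfile M J σz c).x1 j) ω
    rwa [hftDeviation_self] at this
  rw [← condExp_vecFOC_eq_zero_iff X c j]
  constructor
  · intro h
    have h1 : ∀ δ : ℝ, ∀ᵐ ω ∂μ, δ ≠ 0 → -hftImpact c * δ ^ 2 + δ *
        condExp (sigmaOf fun ω => (Sig X (regressionProfile M J σz c) j ω,
          Y1 X (regressionProfile M J σz c) ω)) μ (lin X.centered (vecFOC M J σz c j)) ω < 0 := by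
      intro δ
      have hb := h (fun s y => (regressionProfile M J σz c).x1 j s y + δ) ((hP.x1 j).add_const δ)
        (integrable_HFTProfit_add_const X c j δ) (by
          refine (integrable_zero Ω ℝ μ).congr (ae_of_all _ fun ω => ?_)
          exact (congrFun (sqInventory_hftDeviation X c j _) ω).symm)
      filter_upwards [hb, condExp_HFTProfit_add_const X c j δ] with ω hb1 hb2 hδ
      have hb3 := hb1.2 (by
        intro h2
        have h3 := X1_hftDeviation X (regressionProfile M J σz c) j
          (fun s y => (regressionProfile M J σz c).x1 j s y + δ) ω
        exact hδ (add_eq_left.1 (h3.symm.trans h2)))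
      have hb4 := (penalized_of_cost_eq_zero (γ := ∞) (hsq _ ω)).symm.trans_lt
        (hb3.trans_eq (penalized_of_cost_eq_zero (hsq0 ω)))
      have hb5 := EReal.coe_lt_coe_iff.1 hb4
      have hb6 := hb2.symm.trans_lt hb5
      linarith
    have h2 : ∀ᵐ ω ∂μ, ∀ n : ℕ, _ := ae_all_iff.2 fun n => (h1 (1 / ((n : ℝ) + 1))).and
      (h1 (-(1 / ((n : ℝ) + 1))))
    have h3 : ∀ᵐ ω ∂μ, 0 < hftImpact c ∧
        condExp (sigmaOf fun ω => (Sig X (regressionProfile M J σz c) j ω,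
          Y1 X (regressionProfile M J σz c) ω)) μ (lin X.centered (vecFOC M J σz c j)) ω = 0 := by
      filter_upwards [h2] with ω hω
      refine slope_eq_zero_of_forall_step_neg fun n => ?_
      have hn : (1 / ((n : ℝ) + 1)) ≠ 0 := by positivity
      have h3 := (hω n).1 hn
      have h4 := (hω n).2 (neg_ne_zero.2 hn)
      exact ⟨h3, by linarith⟩
    obtain ⟨ω, hω⟩ := h3.exists
    exact ⟨hω.1, h3.mono fun ω h => h.2⟩
  · rintro ⟨hK, h0⟩ ξ hξ Q' f hi hc
    have hi0 : Integrable (HFTProfit X (hftDeviation (regressionProfile M J σz c) j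
        ((regressionProfile M J σz c).x1 j)) j) μ := by
      have h := integrable_HFTProfit_add_const X c j 0
      simpa only [add_zero] using h
    filter_upwards [condExp_HFTProfit X c h0 hξ hi, condExp_HFTProfit X c h0 (hP.x1 j) hi0]
      with ω h1 h2
    rw [hftDeviation_self] at h2
    have h3 : penalized μ (sigmaOf f) ∞ (HFTProfit X Q' j) (SqInventory X Q' j) ω = _ :=
      penalized_of_cost_eq_zero (hsq _ ω)
    have h4 : penalized μ (sigmaOf f) ∞ (HFTProfit X (regressionProfile M J σz c) j)
      (SqInventory X (regressionProfile M J σz c) j) ω = _ :=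
      penalized_of_cost_eq_zero (hsq0 ω)
    have h5 : condExp (sigmaOf f) μ (HFTProfit X Q' j) ω =
      2 * hftImpact c * X1 X (regressionProfile M J σz c) j ω * X1 X Q' j ω -
        hftImpact c * X1 X Q' j ω ^ 2 := h1
    have h6 : condExp (sigmaOf f) μ (HFTProfit X (regressionProfile M J σz c) j) ω =
      2 * hftImpact c * X1 X (regressionProfile M J σz c) j ω *
        X1 X (regressionProfile M J σz c) j ω -
        hftImpact c * X1 X (regressionProfile M J σz c) j ω ^ 2 := h2
    rw [h3, h4, h5, h6, EReal.coe_le_coe_iff, EReal.coe_lt_coe_iff]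
    refine ⟨?_, fun hne => ?_⟩
    · have := mul_nonneg hK.le
        (sq_nonneg (X1 X Q' j ω - X1 X (regressionProfile M J σz c) j ω))
      linarith
    · have := mul_pos hK (pow_pos (abs_pos.2 (sub_ne_zero.2 hne)) 2)
      rw [sq_abs] at this
      linarith

end HighFrequencyTraders

/-! ### The shared equilibrium conditions as covariance equations -/

section Equilibrium

variable {M : Market} {J : ℕ} {σz : ℝ} {Ω : Type*} [MeasurableSpace Ω] {μ : Measure Ω}
variable (X : Primitives M J σz μ) (c : Coeffs)

theorem regressionProfile_integrable :
    Integrable (ITProfit1 X (regressionProfile M J σz c)) μ ∧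
    Integrable (ITProfit2 X (regressionProfile M J σz c)) μ ∧
    (∀ j, Integrable (HFTProfit1 X (regressionProfile M J σz c) j) μ) ∧
    (∀ j, Integrable (HFTProfit2 X (regressionProfile M J σz c) j) μ) ∧
    ∀ j, Integrable (SqInventory X (regressionProfile M J σz c) j) μ := by
  have := X.isProbabilityMeasure
  have hG := X.isGaussianFamily
  have hc : ∀ k : ℝ, MemLp (fun _ : Ω => k) 2 μ := fun k => memLp_const k
  have hv := X.memLp_v
  have hY1 : MemLp (Y1 X (regressionProfile M J σz c)) 2 μ := by
    rw [← funext (lin_vecY1 X c)]; exact hG.memLp_lin _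
  have hY1p : MemLp (Y1p X (regressionProfile M J σz c)) 2 μ := by
    rw [← funext (lin_vecY1p X c)]; exact hG.memLp_lin _
  have hY2 : MemLp (Y2 X (regressionProfile M J σz c)) 2 μ := by
    rw [← funext (lin_vecY2 X c)]; exact hG.memLp_lin _
  have hI1 : MemLp (I1 X (regressionProfile M J σz c)) 2 μ := by
    refine (hG.memLp_lin (coef c.α1 1 0 0 0 0)).ae_eq (ae_of_all _ fun ω => ?_)
    simp only [X.lin_coef, I1_regressionProfile]
    simp
  have hI2 : MemLp (I2 X (regressionProfile M J σz c)) 2 μ := by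
    rw [funext (I2_regressionProfile X c)]; exact hG.memLp_lin _
  have hX1 := memLp_X1 X c
  have hX2 : ∀ j, MemLp (X2 X (regressionProfile M J σz c) j) 2 μ := fun j => (hX1 j).neg
  have hp1 : MemLp (fun ω => X.v ω - Price1 X (regressionProfile M J σz c) ω) 2 μ :=
    hv.sub ((hc M.p0).add (hY1.const_mul c.l1))
  have hp1p : MemLp (fun ω => X.v ω - Price1p X (regressionProfile M J σz c) ω) 2 μ :=
    hv.sub (((hc M.p0).add (hY1.const_mul c.l1)).add (hY1p.const_mul c.l1p))
  have hp2 : MemLp (fun ω => X.v ω - Price2 X (regressionProfile M J σz c) ω) 2 μ :=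
    hv.sub ((((hc M.p0).add (hY1.const_mul c.l1)).add (hY1p.const_mul c.l21)).add
      (hY2.const_mul c.l22))
  refine ⟨hp1.integrable_mul hI1, hp2.integrable_mul hI2, fun j => hp1p.integrable_mul (hX1 j),
    fun j => hp2.integrable_mul (hX2 j), fun j => ?_⟩
  unfold SqInventory
  simp only [pow_two]
  exact ((hX1 j).add (hX2 j)).integrable_mul ((hX1 j).add (hX2 j))

/-- The equilibrium conditions that mixed and pure strategies share, in terms of covariances. -/
theorem isBaseEquilibrium_iff :
    IsBaseEquilibrium X (fun _ => ∞) (regressionProfile M J σz c) ↔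
      (slopeV M σz c.α1 = c.l1 ∧
      covOf (variances M J σz) (vecW M J σz c.α1 - c.l1p • vecY1p M J σz c.α1 c.β12)
        (vecY1p M J σz c.α1 c.β12) = 0 ∧
      covOf (variances M J σz) (vecW M J σz c.α1 - c.l21 • vecY1p M J σz c.α1 c.β12 -
        c.l22 • vecY2 M J σz c) (vecY1p M J σz c.α1 c.β12) = 0 ∧
      covOf (variances M J σz) (vecW M J σz c.α1 - c.l21 • vecY1p M J σz c.α1 c.β12 -
        c.l22 • vecY2 M J σz c) (vecY2 M J σz c) = 0) ∧
      (0 < c.l22 ∧ 2 * c.l22 * c.α21 = 1 ∧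
        2 * c.l22 * c.α22 = -((c.l21 - c.l22) * c.β12 * J)) ∧
      ∀ j : Fin J, 0 < hftImpact c ∧
        covOf (variances M J σz) (vecFOC M J σz c j) (vecD M J σz c.α1 + vecEps j) = 0 := by
  rw [← dealersEfficient_iff X c]
  simp only [← hftFirstOptimal_iff X c]
  constructor
  · intro h
    exact ⟨h.dealers, (itSecondOptimal_iff X c ((dealersEfficient_iff X c).1 h.dealers).1).1
      h.it_second, h.hft_first⟩
  · rintro ⟨h1, h2, h3⟩
    obtain ⟨i1, i2, i3, i4, i5⟩ := regressionProfile_integrable X c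
    exact ⟨regressionProfile_isMeasurable c, i1, i2, i3, i4, i5, h1,
      (itSecondOptimal_iff X c ((dealersEfficient_iff X c).1 h1).1).2 h2,
      hftSecondOptimal_regressionProfile X c, h3⟩

end Equilibrium

/-! ### Covariances in dimensionless form -/

section Scaling

variable (M : Market) (J : ℕ) (σz : ℝ) (c : Coeffs)

theorem Coeffs.α1_eq : c.α1 = c.A1 M * (M.σ1 / M.σv) := by
  have := M.σv_pos; have := M.σ1_pos
  rw [Coeffs.A1]; field_simp

theorem Coeffs.α21_eq : c.α21 = c.A21 M * (M.σ1 / M.σv) := by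
  have := M.σv_pos; have := M.σ1_pos
  rw [Coeffs.A21]; field_simp

theorem Coeffs.l1_eq : c.l1 = c.L1 M * (M.σv / M.σ1) := by
  have := M.σv_pos; have := M.σ1_pos
  rw [Coeffs.L1]; field_simp

theorem Coeffs.l1p_eq : c.l1p = c.L1p M * (M.σv / M.σ1) := by
  have := M.σv_pos; have := M.σ1_pos
  rw [Coeffs.L1p]; field_simp

theorem Coeffs.l21_eq : c.l21 = c.L21 M * (M.σv / M.σ1) := by
  have := M.σv_pos; have := M.σ1_pos
  rw [Coeffs.L21]; field_simp

theorem Coeffs.l22_eq : c.l22 = c.L22 M * (M.σv / M.σ1) := by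
  have := M.σv_pos; have := M.σ1_pos
  rw [Coeffs.L22]; field_simp

theorem Market.sq_σ1p_eq : M.σ1p ^ 2 = M.θ1p * M.σ1 ^ 2 := by
  have := M.σ1_pos
  rw [Market.θ1p]; field_simp

theorem Market.sq_σ2_eq : M.σ2 ^ 2 = M.θ2 * M.σ1 ^ 2 := by
  have := M.σ1_pos
  rw [Market.θ2]; field_simp

theorem Market.sq_σε_eq : M.σε ^ 2 = M.θε * M.σ1 ^ 2 := by
  have := M.σ1_pos
  rw [Market.θε]; field_simp

theorem flowVar_scaled : flowVar M σz c.α1 =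
    M.σ1 ^ 2 * (c.A1 M ^ 2 + σz ^ 2 / M.σ1 ^ 2 + 1) := by
  have := M.σv_pos; have := M.σ1_pos
  rw [flowVar, c.α1_eq M]; field_simp

theorem scaledFlowVar_pos : 0 < c.A1 M ^ 2 + σz ^ 2 / M.σ1 ^ 2 + 1 := by positivity

theorem cov_W_W_scaled : covOf (variances M J σz) (vecW M J σz c.α1) (vecW M J σz c.α1) =
    M.σv ^ 2 * (σz ^ 2 / M.σ1 ^ 2 + 1) / (c.A1 M ^ 2 + σz ^ 2 / M.σ1 ^ 2 + 1) := by
  have := M.σ1_pos; have := (scaledFlowVar_pos M σz c).ne'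
  rw [cov_W_W, flowVar_scaled, div_eq_div_iff (by positivity) this]
  field_simp

theorem cov_W_D_scaled : covOf (variances M J σz) (vecW M J σz c.α1) (vecD M J σz c.α1) =
    M.σv * M.σ1 * c.A1 M / (c.A1 M ^ 2 + σz ^ 2 / M.σ1 ^ 2 + 1) := by
  have := M.σv_pos; have := M.σ1_pos; have := (scaledFlowVar_pos M σz c).ne'
  rw [cov_W_D, flowVar_scaled, c.α1_eq M, div_eq_div_iff (by positivity) this]
  field_simp

theorem cov_D_D_scaled : covOf (variances M J σz) (vecD M J σz c.α1) (vecD M J σz c.α1) =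
    M.σ1 ^ 2 * (c.A1 M ^ 2 + σz ^ 2 / M.σ1 ^ 2) / (c.A1 M ^ 2 + σz ^ 2 / M.σ1 ^ 2 + 1) := by
  have := M.σv_pos; have := M.σ1_pos; have := (scaledFlowVar_pos M σz c).ne'
  rw [cov_D_D, flowVar_scaled, c.α1_eq M, div_eq_div_iff (by positivity) this]
  field_simp

theorem cov_Y1p_Y1p : covOf (variances M J σz) (vecY1p M J σz c.α1 c.β12)
    (vecY1p M J σz c.α1 c.β12) =
    M.σ1 ^ 2 / (c.A1 M ^ 2 + σz ^ 2 / M.σ1 ^ 2 + 1) *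
      (c.β12 ^ 2 * J * (M.θε * (c.A1 M ^ 2 + σz ^ 2 / M.σ1 ^ 2 + 1) +
        J * (c.A1 M ^ 2 + σz ^ 2 / M.σ1 ^ 2)) +
        M.θ1p * (c.A1 M ^ 2 + σz ^ 2 / M.σ1 ^ 2 + 1)) := by
  have := (scaledFlowVar_pos M σz c).ne'
  simp only [vecY1p, covOf_add_left, covOf_add_right, covOf_smul_left, covOf_smul_right,
    cov_D_D_scaled, cov_D_E, cov_D_U1p, cov_E_E, cov_E_U1p, cov_U1p_U1p, M.sq_σε_eq, M.sq_σ1p_eq,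
    covOf_comm _ (vecE J) (vecD _ _ _ _), covOf_comm _ (vecU1p J) (vecD _ _ _ _),
    covOf_comm _ (vecU1p J) (vecE J)]
  -- The ratio `θ_z` is kept as an atom so that clearing denominators does not break it up.
  generalize σz ^ 2 / M.σ1 ^ 2 = z at *
  field_simp
  ring

theorem cov_W_Y1p : covOf (variances M J σz) (vecW M J σz c.α1)
    (vecY1p M J σz c.α1 c.β12) =
    M.σv * M.σ1 / (c.A1 M ^ 2 + σz ^ 2 / M.σ1 ^ 2 + 1) * (c.β12 * J * c.A1 M) := by
  simp only [vecY1p, covOf_add_right, covOf_smul_right, cov_W_D_scaled, cov_W_E, cov_W_U1p]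
  ring

theorem cov_Y2_Y1p : covOf (variances M J σz) (vecY2 M J σz c)
    (vecY1p M J σz c.α1 c.β12) =
    M.σ1 ^ 2 / (c.A1 M ^ 2 + σz ^ 2 / M.σ1 ^ 2 + 1) *
      (c.β12 * J * (c.A21 M * c.A1 M + (c.α22 - c.β12 * J) * (c.A1 M ^ 2 + σz ^ 2 / M.σ1 ^ 2)) -
        c.β12 ^ 2 * J * M.θε * (c.A1 M ^ 2 + σz ^ 2 / M.σ1 ^ 2 + 1)) := by
  have h1 := M.σv_pos; have h2 := M.σ1_pos; have := (scaledFlowVar_pos M σz c).ne'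
  simp only [vecY2, covOf_add_left, covOf_sub_left, covOf_smul_left, cov_W_Y1p]
  simp only [vecY1p, covOf_add_right, covOf_smul_right, cov_D_D_scaled,
    cov_D_E, cov_D_U1p, cov_E_E, cov_E_U1p, M.sq_σε_eq,
    covOf_comm _ (vecE J) (vecD _ _ _ _), covOf_comm _ (vecU2 J) (vecD _ _ _ _),
    covOf_comm _ (vecU2 J) (vecE J), cov_E_U2, cov_D_U2, covOf_comm _ (vecU2 J) (vecU1p J),
    cov_U1p_U2]
  rw [c.α21_eq M]
  generalize σz ^ 2 / M.σ1 ^ 2 = z at *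
  field_simp
  ring

theorem cov_W_Y2 : covOf (variances M J σz) (vecW M J σz c.α1) (vecY2 M J σz c) =
    M.σv * M.σ1 / (c.A1 M ^ 2 + σz ^ 2 / M.σ1 ^ 2 + 1) *
      (c.A21 M * (σz ^ 2 / M.σ1 ^ 2 + 1) + (c.α22 - c.β12 * J) * c.A1 M) := by
  have h1 := M.σv_pos; have h2 := M.σ1_pos; have := (scaledFlowVar_pos M σz c).ne'
  simp only [vecY2, covOf_add_right, covOf_sub_right, covOf_smul_right, cov_W_D_scaled,
    cov_W_W_scaled, cov_W_E, cov_W_U2]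
  rw [c.α21_eq M]
  generalize σz ^ 2 / M.σ1 ^ 2 = z at *
  field_simp
  ring

theorem cov_Y2_Y2 : covOf (variances M J σz) (vecY2 M J σz c) (vecY2 M J σz c) =
    M.σ1 ^ 2 / (c.A1 M ^ 2 + σz ^ 2 / M.σ1 ^ 2 + 1) *
      (c.A21 M ^ 2 * (σz ^ 2 / M.σ1 ^ 2 + 1) + 2 * c.A21 M * (c.α22 - c.β12 * J) * c.A1 M +
        (c.α22 - c.β12 * J) ^ 2 * (c.A1 M ^ 2 + σz ^ 2 / M.σ1 ^ 2) +
        (c.β12 ^ 2 * J * M.θε + M.θ2) * (c.A1 M ^ 2 + σz ^ 2 / M.σ1 ^ 2 + 1)) := by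
  have h1 := M.σv_pos; have h2 := M.σ1_pos; have := (scaledFlowVar_pos M σz c).ne'
  nth_rw 1 [vecY2]
  simp only [covOf_add_left, covOf_sub_left, covOf_smul_left, cov_W_Y2]
  simp only [vecY2, covOf_add_right, covOf_sub_right, covOf_smul_right, cov_D_D_scaled,
    cov_D_E, cov_E_E, cov_D_U2, cov_E_U2, cov_U2_U2, M.sq_σε_eq, M.sq_σ2_eq, cov_W_E, cov_W_U2,
    covOf_comm _ (vecE J) (vecD _ _ _ _), covOf_comm _ (vecU2 J) (vecD _ _ _ _),
    covOf_comm _ (vecD _ _ _ _) (vecW _ _ _ _), cov_W_D_scaled,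
    covOf_comm _ (vecE J) (vecW _ _ _ _), covOf_comm _ (vecU2 J) (vecW _ _ _ _),
    covOf_comm _ (vecU2 J) (vecE J)]
  rw [c.α21_eq M]
  generalize σz ^ 2 / M.σ1 ^ 2 = z at *
  field_simp
  ring

theorem cov_vecFOC (j : Fin J) :
    covOf (variances M J σz) (vecFOC M J σz c j) (vecD M J σz c.α1 + vecEps j) =
    M.σv * M.σ1 / (c.A1 M ^ 2 + σz ^ 2 / M.σ1 ^ 2 + 1) *
    ((c.L21 M - c.L1p M) * (c.β12 * (J * (c.A1 M ^ 2 + σz ^ 2 / M.σ1 ^ 2) +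
        M.θε * (c.A1 M ^ 2 + σz ^ 2 / M.σ1 ^ 2 + 1))) +
      c.L22 M * (c.A21 M * c.A1 M +
        (c.α22 - c.β12 * J) * (c.A1 M ^ 2 + σz ^ 2 / M.σ1 ^ 2) -
        c.β12 * M.θε * (c.A1 M ^ 2 + σz ^ 2 / M.σ1 ^ 2 + 1)) -
      (c.L1p M + c.L22 M - c.L21 M) * c.β12 * (c.A1 M ^ 2 + σz ^ 2 / M.σ1 ^ 2 +
        M.θε * (c.A1 M ^ 2 + σz ^ 2 / M.σ1 ^ 2 + 1))) := by
  have h1 := M.σv_pos; have h2 := M.σ1_pos; have := (scaledFlowVar_pos M σz c).ne'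
  simp only [vecFOC, vecY1p, vecY2, covOf_add_right, covOf_add_left, covOf_sub_left,
    covOf_smul_left, cov_D_D_scaled, cov_W_D_scaled, cov_W_Eps, cov_D_Eps, cov_E_Eps, cov_U1p_Eps,
    cov_U2_Eps, cov_Eps_Eps, covOf_comm _ (vecE J) (vecD _ _ _ _),
    covOf_comm _ (vecU2 J) (vecD _ _ _ _), covOf_comm _ (vecU1p J) (vecD _ _ _ _),
    covOf_comm _ (vecEps j) (vecD _ _ _ _), cov_D_E, cov_D_U1p, cov_D_U2, M.sq_σε_eq, hftImpact]
  rw [c.α21_eq M, c.l1p_eq M, c.l21_eq M, c.l22_eq M]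
  generalize σz ^ 2 / M.σ1 ^ 2 = z at *
  field_simp
  ring

theorem slopeI_scaled : 1 - slopeI M σz c.α1 = 1 / (c.A1 M ^ 2 + σz ^ 2 / M.σ1 ^ 2 + 1) := by
  have h1 := M.σv_pos; have h2 := M.σ1_pos; have := (scaledFlowVar_pos M σz c).ne'
  rw [slopeI, flowVar_scaled, c.α1_eq M, eq_div_iff this]
  field_simp
  ring

theorem orderResponse_scaled
    (h : c.L1 M * (c.A1 M ^ 2 + σz ^ 2 / M.σ1 ^ 2 + 1) = c.A1 M) :
    orderResponse M σz c =
      (c.α22 - c.A21 M * c.A1 M) / (c.A1 M ^ 2 + σz ^ 2 / M.σ1 ^ 2 + 1) := by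
  have h1 := M.σv_pos; have h2 := M.σ1_pos; have := (scaledFlowVar_pos M σz c).ne'
  rw [orderResponse, slopeI_scaled, c.α21_eq M, c.l1_eq M, (eq_div_iff this).2 h]
  generalize σz ^ 2 / M.σ1 ^ 2 = z at *
  field_simp

end Scaling

/-! ### Equilibrium conditions in dimensionless form -/

section Scaling

variable (M : Market) (J : ℕ) (σz : ℝ) (c : Coeffs)

theorem Market.θ1p_pos : 0 < M.θ1p := by
  have := M.σ1_pos; have := M.σ1p_pos
  rw [Market.θ1p]; positivity

theorem Market.θ2_pos : 0 < M.θ2 := by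
  have := M.σ1_pos; have := M.σ2_pos
  rw [Market.θ2]; positivity

theorem Market.θε_nonneg : 0 ≤ M.θε := by
  rw [Market.θε]; positivity

theorem price1_scaled : slopeV M σz c.α1 = c.l1 ↔
    c.L1 M * (c.A1 M ^ 2 + σz ^ 2 / M.σ1 ^ 2 + 1) = c.A1 M := by
  have h1 := M.σv_pos; have h2 := M.σ1_pos; have := scaledFlowVar_pos M σz c
  rw [slopeV, flowVar_scaled, div_eq_iff (by positivity), c.α1_eq M, c.l1_eq M]
  generalize σz ^ 2 / M.σ1 ^ 2 = z at *
  field_simp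
  exact eq_comm

theorem price1p_scaled :
    covOf (variances M J σz) (vecW M J σz c.α1 - c.l1p • vecY1p M J σz c.α1 c.β12)
      (vecY1p M J σz c.α1 c.β12) =
    M.σv * M.σ1 / (c.A1 M ^ 2 + σz ^ 2 / M.σ1 ^ 2 + 1) * (c.β12 * J * c.A1 M -
      c.L1p M * (c.β12 ^ 2 * J * (M.θε * (c.A1 M ^ 2 + σz ^ 2 / M.σ1 ^ 2 + 1) +
        J * (c.A1 M ^ 2 + σz ^ 2 / M.σ1 ^ 2)) +
        M.θ1p * (c.A1 M ^ 2 + σz ^ 2 / M.σ1 ^ 2 + 1))) := by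
  have h2 := M.σ1_pos; have := (scaledFlowVar_pos M σz c).ne'
  rw [covOf_sub_left, covOf_smul_left, cov_W_Y1p, cov_Y1p_Y1p, c.l1p_eq M]
  generalize σz ^ 2 / M.σ1 ^ 2 = z at *
  field_simp

theorem price2_flow1p_scaled :
    covOf (variances M J σz) (vecW M J σz c.α1 - c.l21 • vecY1p M J σz c.α1 c.β12 -
      c.l22 • vecY2 M J σz c) (vecY1p M J σz c.α1 c.β12) =
    M.σv * M.σ1 / (c.A1 M ^ 2 + σz ^ 2 / M.σ1 ^ 2 + 1) * (c.β12 * J * c.A1 M -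
      (c.L21 M * (c.β12 ^ 2 * J * (M.θε * (c.A1 M ^ 2 + σz ^ 2 / M.σ1 ^ 2 + 1) +
        J * (c.A1 M ^ 2 + σz ^ 2 / M.σ1 ^ 2)) +
        M.θ1p * (c.A1 M ^ 2 + σz ^ 2 / M.σ1 ^ 2 + 1)) +
      c.L22 M * (c.β12 * J * (c.A21 M * c.A1 M +
        (c.α22 - c.β12 * J) * (c.A1 M ^ 2 + σz ^ 2 / M.σ1 ^ 2)) -
        c.β12 ^ 2 * J * M.θε * (c.A1 M ^ 2 + σz ^ 2 / M.σ1 ^ 2 + 1)))) := by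
  have h2 := M.σ1_pos; have := (scaledFlowVar_pos M σz c).ne'
  rw [covOf_sub_left, covOf_sub_left, covOf_smul_left, covOf_smul_left, cov_W_Y1p, cov_Y1p_Y1p,
    cov_Y2_Y1p, c.l21_eq M, c.l22_eq M]
  generalize σz ^ 2 / M.σ1 ^ 2 = z at *
  field_simp
  ring

theorem price2_flow2_scaled :
    covOf (variances M J σz) (vecW M J σz c.α1 - c.l21 • vecY1p M J σz c.α1 c.β12 -
      c.l22 • vecY2 M J σz c) (vecY2 M J σz c) =
    M.σv * M.σ1 / (c.A1 M ^ 2 + σz ^ 2 / M.σ1 ^ 2 + 1) *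
      (c.A21 M * (σz ^ 2 / M.σ1 ^ 2 + 1) + (c.α22 - c.β12 * J) * c.A1 M -
      (c.L21 M * (c.β12 * J * (c.A21 M * c.A1 M +
        (c.α22 - c.β12 * J) * (c.A1 M ^ 2 + σz ^ 2 / M.σ1 ^ 2)) -
        c.β12 ^ 2 * J * M.θε * (c.A1 M ^ 2 + σz ^ 2 / M.σ1 ^ 2 + 1)) +
      c.L22 M * (c.A21 M ^ 2 * (σz ^ 2 / M.σ1 ^ 2 + 1) +
        2 * c.A21 M * (c.α22 - c.β12 * J) * c.A1 M +
        (c.α22 - c.β12 * J) ^ 2 * (c.A1 M ^ 2 + σz ^ 2 / M.σ1 ^ 2) +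
        (c.β12 ^ 2 * J * M.θε + M.θ2) * (c.A1 M ^ 2 + σz ^ 2 / M.σ1 ^ 2 + 1)))) := by
  have h2 := M.σ1_pos; have := (scaledFlowVar_pos M σz c).ne'
  rw [covOf_sub_left, covOf_sub_left, covOf_smul_left, covOf_smul_left, cov_W_Y2, cov_Y2_Y2,
    covOf_comm _ (vecY1p _ _ _ _ _), cov_Y2_Y1p, c.l21_eq M, c.l22_eq M]
  generalize σz ^ 2 / M.σ1 ^ 2 = z at *
  field_simp
  ring

theorem it_scaled : (0 < c.l22 ∧ 2 * c.l22 * c.α21 = 1 ∧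
      2 * c.l22 * c.α22 = -((c.l21 - c.l22) * c.β12 * J)) ↔
    0 < c.L22 M ∧ 2 * c.L22 M * c.A21 M = 1 ∧
      2 * c.L22 M * c.α22 = -((c.L21 M - c.L22 M) * c.β12 * J) := by
  have h1 := M.σv_pos; have h2 := M.σ1_pos
  have hk : 0 < M.σv / M.σ1 := by positivity
  refine and_congr ?_ (and_congr ?_ ?_)
  · rw [c.l22_eq M, mul_pos_iff_of_pos_right hk]
  · rw [c.l22_eq M, c.α21_eq M]
    field_simp
  · rw [c.l22_eq M, c.l21_eq M]
    constructor <;> intro h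
    · apply mul_right_cancel₀ hk.ne'
      linear_combination h
    · linear_combination M.σv / M.σ1 * h

theorem hftImpact_scaled : hftImpact c = (c.L1p M + c.L22 M - c.L21 M) * (M.σv / M.σ1) := by
  rw [hftImpact, c.l1p_eq M, c.l22_eq M, c.l21_eq M]
  ring

end Scaling

/-! ### Assembling the characterizations -/

section Theorem

variable {M : Market} {J : ℕ} {σz : ℝ} {Ω : Type*} [MeasurableSpace Ω] {μ : Measure Ω}
variable (X : Primitives M J σz μ) (c : Coeffs)

/-- The equilibrium conditions that mixed and pure strategies share, in dimensionless form. -/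
theorem isBaseEquilibrium_iff_linearEquations (hJ : 1 ≤ J) :
    IsBaseEquilibrium X (fun _ => ∞) (regressionProfile M J σz c) ↔
      LinearEquations J M.θ1p M.θ2 M.θε (σz ^ 2 / M.σ1 ^ 2) (c.A1 M) c.β12
        (c.L1 M) (c.L1p M) (c.L21 M) (c.L22 M) (c.A21 M) c.α22 := by
  have h1 := M.σv_pos; have h2 := M.σ1_pos; have := scaledFlowVar_pos M σz c
  have hk : M.σv * M.σ1 / (c.A1 M ^ 2 + σz ^ 2 / M.σ1 ^ 2 + 1) ≠ 0 := by positivity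
  have hk' : 0 < M.σv / M.σ1 := by positivity
  -- The trader conditions do not depend on `j`; they are not vacuous because there is at least one
  -- trader.
  have : Nonempty (Fin J) := ⟨⟨0, hJ⟩⟩
  rw [isBaseEquilibrium_iff, price1_scaled, price1p_scaled, price2_flow1p_scaled,
    price2_flow2_scaled, it_scaled M]
  simp only [cov_vecFOC, hftImpact_scaled M, forall_const, mul_eq_zero_iff_left hk,
    mul_pos_iff_of_pos_right hk', sub_eq_zero]
  constructor
  · rintro ⟨⟨e1, e2, e3, e4⟩, ⟨e5, e6, e7⟩, e8, e9⟩
    exact ⟨e1, e2, e3, e4, e5, e6, e7, e8, sub_eq_zero.2 e9⟩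
  · rintro ⟨e1, e2, e3, e4, e5, e6, e7, e8, e9⟩
    exact ⟨⟨e1, e2, e3, e4⟩, ⟨e5, e6, e7⟩, e8, sub_eq_zero.1 e9⟩

theorem isMixedLinear_iff_system (hJ : 1 ≤ J) (hσz : 0 ≤ σz) :
    IsMixedLinear X c ↔
      MixedSystem J M.θ1p M.θ2 M.θε (c.A1 M) (σz ^ 2 / M.σ1 ^ 2) c.β12 ∧
      MixedFormulas J M.θ1p M.θε (c.A1 M) (σz ^ 2 / M.σ1 ^ 2) c.β12
        (c.L1 M) (c.L1p M) (c.L21 M) (c.L22 M) (c.A21 M) c.α22 := by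
  have h1 := M.σv_pos; have h2 := M.σ1_pos; have hS := scaledFlowVar_pos M σz c
  have hk : 0 < M.σv / M.σ1 := by positivity
  have hσ : 0 < σz ↔ 0 < σz ^ 2 / M.σ1 ^ 2 := by
    rw [div_pos_iff_of_pos_right (by positivity), sq_pos_iff, hσz.lt_iff_ne']
  -- The first-stage value formula presupposes the price slope and the second-stage rules, so this
  -- translation holds only given the shared conditions.
  have hfirst (hb : IsBaseEquilibrium X (fun _ => ∞) (regressionProfile M J σz c)) :
      ITFirstIndifferent X (regressionProfile M J σz c) ↔
        c.A1 M ^ 2 + σz ^ 2 / M.σ1 ^ 2 + 1 + c.α22 - c.A21 M * c.A1 M = 0 ∧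
        c.L22 M * (c.α22 - c.A21 M * c.A1 M) ^ 2 =
          c.L1 M * (c.A1 M ^ 2 + σz ^ 2 / M.σ1 ^ 2 + 1) ^ 2 := by
    obtain ⟨⟨hl1, -⟩, ⟨-, hv, ho⟩, -⟩ := (isBaseEquilibrium_iff X c).1 hb
    rw [itFirstIndifferent_iff X c hl1 hv ho,
      orderResponse_scaled M σz c ((price1_scaled M σz c).1 hl1), c.l22_eq M, c.l1_eq M]
    generalize σz ^ 2 / M.σ1 ^ 2 = z at *
    refine and_congr ?_ ?_
    · rw [one_add_div hS.ne', div_eq_zero_iff, or_iff_left hS.ne', add_sub_assoc]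
    · rw [mul_right_comm, mul_left_inj' hk.ne', div_pow, ← mul_div_assoc,
        div_eq_iff (by positivity)]
  -- Without noise both sides fail: the left by `noise`, the right by `z_pos`.
  by_cases hz : 0 < σz
  · rw [← mixed_equations_iff (by exact_mod_cast hJ) M.θ1p_pos M.θ2_pos M.θε_nonneg (hσ.1 hz),
      isMixedLinear_iff, ← isBaseEquilibrium_iff_linearEquations X c hJ]
    exact ⟨fun h => ⟨h.1, (hfirst h.1).1 h.it_first⟩, fun h => ⟨h.1, hz, (hfirst h.1).2 h.2⟩⟩
  · exact iff_of_false (fun h => hz ((isMixedLinear_iff X c).1 h).noise)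
      fun h => hz (hσ.2 h.1.z_pos)

theorem isPureLinear_iff_system (hJ : 1 ≤ J) :
    IsPureLinear X c ↔
      σz = 0 ∧
      PureSystem J M.θ1p M.θ2 M.θε (c.L21 M) (c.L22 M) (c.A1 M) c.β12 ∧
      PureFormulas J M.θ1p M.θε (c.L21 M) (c.L22 M) (c.A1 M) c.β12
        (c.L1 M) (c.L1p M) (c.A21 M) c.α22 := by
  have h1 := M.σv_pos; have h2 := M.σ1_pos
  have hS : 0 < c.A1 M ^ 2 + 1 := by positivity
  have hk : 0 < M.σv / M.σ1 := by positivity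
  rcases eq_or_ne σz 0 with rfl | hz
  swap
  · exact iff_of_false (fun h => hz ((isPureLinear_iff X c).1 h).noise) fun h => hz h.1
  have h0 : (0 : ℝ) ^ 2 / M.σ1 ^ 2 = 0 := by simp
  have hbase := isBaseEquilibrium_iff_linearEquations X c hJ
  rw [h0] at hbase
  have hfirst (hb : IsBaseEquilibrium X (fun _ => ∞) (regressionProfile M J 0 c)) :
      ITFirstOptimal X (regressionProfile M J 0 c) ↔
        c.L22 M * (c.α22 - c.A21 M * c.A1 M) ^ 2 < c.L1 M * (c.A1 M ^ 2 + 1) ^ 2 ∧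
        (c.A1 M ^ 2 + 1) ^ 2 + (c.α22 - c.A21 M * c.A1 M) * (c.A1 M ^ 2 + 1) +
          2 * c.A1 M * (c.L22 M * (c.α22 - c.A21 M * c.A1 M) ^ 2 -
            c.L1 M * (c.A1 M ^ 2 + 1) ^ 2) = 0 := by
    obtain ⟨⟨hl1, -⟩, ⟨-, hv, ho⟩, -⟩ := (isBaseEquilibrium_iff X c).1 hb
    rw [itFirstOptimal_iff c X hl1 hv ho,
      orderResponse_scaled M 0 c ((price1_scaled M 0 c).1 hl1), c.l22_eq M, c.l1_eq M, h0,
      add_zero, c.α1_eq M]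
    refine and_congr ?_ ?_
    · rw [mul_right_comm, mul_lt_mul_iff_left₀ hk, div_pow, ← mul_div_assoc,
        div_lt_iff₀ (by positivity)]
    -- The response enters squared, so the square of the scaled flow variance clears all
    -- denominators.
    · rw [← mul_eq_zero_iff_left (pow_ne_zero 2 hS.ne')]
      refine Eq.congr ?_ rfl
      field_simp
  rw [← pure_equations_iff (by exact_mod_cast hJ) M.θ1p_pos M.θ2_pos M.θε_nonneg,
    isPureLinear_iff, ← hbase]
  exact ⟨fun h => ⟨rfl, h.1, (hfirst h.1).1 h.it_first⟩,
    fun h => ⟨h.2.1, rfl, (hfirst h.2.1).2 h.2.2⟩⟩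

end Theorem

end Kyle
end

theorem mainTheorem2 {Ω : Type*} [MeasurableSpace Ω] (μ : Measure Ω) [IsProbabilityMeasure μ]
    (M : Kyle.Market) (J : ℕ) (hJ : 1 ≤ J) (σz : ℝ) (hσz : 0 ≤ σz)
    (X : Kyle.Primitives M J σz μ) (c : Kyle.Coeffs) :
    (Kyle.IsMixedLinear X c ↔
      Kyle.MixedSystem J M.θ1p M.θ2 M.θε (c.A1 M) (σz ^ 2 / M.σ1 ^ 2) c.β12 ∧
      Kyle.MixedFormulas J M.θ1p M.θε (c.A1 M) (σz ^ 2 / M.σ1 ^ 2) c.β12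
        (c.L1 M) (c.L1p M) (c.L21 M) (c.L22 M) (c.A21 M) c.α22) ∧
    (Kyle.IsPureLinear X c ↔
      σz = 0 ∧
      Kyle.PureSystem J M.θ1p M.θ2 M.θε (c.L21 M) (c.L22 M) (c.A1 M) c.β12 ∧
      Kyle.PureFormulas J M.θ1p M.θε (c.L21 M) (c.L22 M) (c.A1 M) c.β12
        (c.L1 M) (c.L1p M) (c.A21 M) c.α22) ∧
    (Kyle.IsMixedLinear X c → 0 < c.β12) ∧
    (Kyle.IsPureLinear X c → 0 < c.L21 M ∧ 0 < c.L22 M ∧ 0 < c.A1 M ∧ 0 < c.β12) := by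
  have hJ' : (0 : ℝ) < J := by exact_mod_cast hJ
  have hm := Kyle.isMixedLinear_iff_system X c hJ hσz
  have hp := Kyle.isPureLinear_iff_system X c hJ
  exact ⟨hm, hp, fun h => (hm.1 h).1.intensity_pos hJ' M.θ1p_pos M.θε_nonneg,
    fun h => (hp.1 h).2.1.signs hJ' M.θ1p_pos M.θ2_pos M.θε_nonneg⟩
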